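/- Let $I\subseteq\mathbb{R}$ be a nonempty open interval unbounded below and closed downwards (so $I=\mathbb{R}$ or $I=(-\infty,T)$), and let $a:I\to(0,\infty)$ be of class $C^2$ with $a(t)\simeq\bar a\,e^{H_\Lambda t}$ (ratio tending to $1$) as $t\to-\infty$, for constants $\bar a,H_\Lambda>0$. Consider the flat FLRW spacetime $M=I\times\mathbb{R}^3$, $g=-dt^2+a(t)^2\,(dr^2+r^2d\Omega^2)$, and put $H=\dot a/a$. Then $\lambda(t)=\int_{-\infty}^t a(t')\,dt'$ is finite for every $t\in I$, and through every point of $M$ there passes an affinely parametrized null geodesic $\gamma:(0,\ell)\to M$ along which $t\to-\infty$ as the parameter tends to $0^+$. The past null boundary $\mathscr{B}^-$ is the set of past end points of all such geodesics. Along any of them, call a parallely propagated orthonormal frame a p.p. tetrad. The end of $\gamma$ is a ($C^0$) p.p. curvature singularity if some component of the Riemann tensor in a p.p. tetrad has no finite limit at $0^+$. It is a scalar curvature singularity if some scalar polynomial in the Riemann tensor (a polynomial in the components in orthonormal frames that is invariant under Lorentz transformations) has no finite limit there. The spacetime is locally ($C^0$-) extendible beyond the end of $\gamma$ if an open set $U\subseteq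 M$ containing $\gamma((0,\varepsilon))$ for some $\varepsilon>0$ can be embedded isometrically, by a $C^3$ map, into a Lorentzian manifold with metric of class $C^2$ (continuous curvature) in which the image of $\gamma$ converges to a point as the parameter tends to $0^+$. (i) If $|\dot H/a^2|\to\infty$ as $t\to-\infty$, then $\mathscr{B}^-$ is a p.p. curvature singularity and the spacetime cannot be extended beyond $\mathscr{B}^-$: along every null geodesic $\gamma$ as above, the end is a p.p. curvature singularity, in every p.p. tetrad some component of the Riemann tensor tends to infinity in absolute value, and $(M,g)$ is not locally extendible beyond the end of $\gamma$. If moreover $\dot H\to0$ as $t\to-\infty$, then the end is not a scalar curvature singularity, so that $\mathscr{B}^-$ is an intermediate (non-scalar) singularity. (ii) If $\dot H/a^2$ converges to a finite limit as $t\to-\infty$, then along every such null geodesic the end is not a p.p. curvature singularity and $(M,g)$ is locally extendible beyond it. The extension is obtained in the coordinates $\lambda$, $v=\eta+r$ and $\omega=x/r\in S^2$, where $\eta(t)=\int_{t_0}^t dt'/a(t')$ with any $t_0\in I$: there is an open set $V\subset\mathbb{R}\times(\mathbb{R}\times S^2)$ with a Lorentzian metric $g'$ of class $C^2$ such that $(\lambda,v,\omega)$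 maps $\{r\neq0\}\subset M$ isometrically onto $V\cap\{\lambda>0\}$, such that $V$ contains the whole hypersurface $\{\lambda=0\}$, and such that the points of this hypersurface are exactly the limits of the null geodesics running into $\mathscr{B}^-$ (each of them converges to such a point, and each such point is the limit of one of them). -/

import Mathlib

/-! ### Lorentzian geometry in a coordinate domain of `ℝ⁴` -/

/-- A coordinate 4-tuple; index `0` is the time-like (or null) coordinate. -/
abbrev Coord : Type := Fin 4 → ℝ

/-- The coordinate components `g_{ij}(x)` of a metric. -/
abbrev MetricField : Type := Coord → Matrix (Fin 4) (Fin 4) ℝ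

/-- The Minkowski matrix `diag(-1, 1, 1, 1)`. -/
def minkowski : Matrix (Fin 4) (Fin 4) ℝ := Matrix.diagonal ![-1, 1, 1, 1]

/-- The partial derivative `∂ₖ f`. -/
noncomputable def partialDeriv (k : Fin 4) (f : Coord → ℝ) (x : Coord) : ℝ :=
  fderiv ℝ f x (Pi.single k 1)

/-- The Christoffel symbols
`Γⁱⱼₖ = ½ gⁱˡ (∂ⱼ g_{lk} + ∂ₖ g_{lj} - ∂ₗ g_{jk})`. -/
noncomputable def christoffel (g : MetricField) (x : Coord) (i j k : Fin 4) : ℝ :=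
  (1 / 2 : ℝ) * ∑ l, (g x)⁻¹ i l *
    (partialDeriv j (fun y => g y l k) x + partialDeriv k (fun y => g y l j) x
      - partialDeriv l (fun y => g y j k) x)

/-- The curvature tensor
`Rⁱⱼₖₗ = ∂ₖ Γⁱₗⱼ - ∂ₗ Γⁱₖⱼ + Γⁱₖₘ Γᵐₗⱼ - Γⁱₗₘ Γᵐₖⱼ`. -/
noncomputable def riemannUp (g : MetricField) (x : Coord) (i j k l : Fin 4) : ℝ :=
  partialDeriv k (fun y => christoffel g y i l j) x
    - partialDeriv l (fun y => christoffel g y i k j) x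
    + ∑ m, (christoffel g x i k m * christoffel g x m l j
        - christoffel g x i l m * christoffel g x m k j)

/-- The Riemann tensor with all indices down, `R_{ijkl} = g_{im} Rᵐⱼₖₗ`. -/
noncomputable def riemann (g : MetricField) (x : Coord) (i j k l : Fin 4) : ℝ :=
  ∑ m, g x i m * riemannUp g x m j k l

/-- The components `T(E_M, E_N, E_P, E_Q)` of a covariant 4-tensor in the frame whose vectors are
the columns `E_M = (E i M)_i` of the matrix `E`. -/
def frameComponents (T : Fin 4 → Fin 4 → Fin 4 → Fin 4 → ℝ) (E : Matrix (Fin 4) (Fin 4) ℝ)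
    (M N P Q : Fin 4) : ℝ :=
  ∑ i, ∑ j, ∑ k, ∑ l, T i j k l * E i M * E j N * E k P * E l Q

/-- The columns of `E` form an orthonormal frame (a tetrad) at `x`. -/
def IsTetradAt (g : MetricField) (x : Coord) (E : Matrix (Fin 4) (Fin 4) ℝ) : Prop :=
  E.transpose * g x * E = minkowski

/-- `g` is a Lorentzian metric of class `C²` (so that its Riemann tensor is `C⁰`) on `V`. -/
structure IsLorentzMetricOn (V : Set Coord) (g : MetricField) : Prop where
  contDiffOn : ∀ i j, ContDiffOn ℝ 2 (fun x => g x i j) V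
  symm : ∀ x ∈ V, (g x).IsSymm
  signature : ∀ x ∈ V, ∃ E, IsTetradAt g x E

/-- `φ` maps `(U, g)` isometrically into `(V, g')`: it is of class `C³`, injective, and `g` is the
pull-back of `g'`.  (If `U`, `V` are open and the metrics are nondegenerate, `φ` is then an open
embedding by the inverse function theorem.) -/
structure IsIsometricEmbedding (U : Set Coord) (g : MetricField) (V : Set Coord)
    (g' : MetricField) (φ : Coord → Coord) : Prop where
  contDiffOn : ContDiffOn ℝ 3 φ U
  injOn : Set.InjOn φ U
  mapsTo : Set.MapsTo φ U V
  pullback : ∀ x ∈ U, ∀ i j, g x i j =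
    ∑ k, ∑ l, g' (φ x) k l * partialDeriv i (fun y => φ y k) x * partialDeriv j (fun y => φ y l) x

/-- `γ` is an affinely parametrized geodesic of `g` for parameter values in the open set `J`. -/
def IsGeodesicOn (g : MetricField) (γ : ℝ → Coord) (J : Set ℝ) : Prop :=
  ∀ s ∈ J, DifferentiableAt ℝ γ s ∧
    HasDerivAt (deriv γ)
      (fun i => -∑ j, ∑ k, christoffel g (γ s) i j k * deriv γ s j * deriv γ s k) s

/-- `E` is a parallely propagated orthonormal tetrad along `γ` for parameter values in `J`:
its vectors satisfy `∇_{γ'} E_M = 0`. -/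
def IsParallelTetradOn (g : MetricField) (γ : ℝ → Coord) (J : Set ℝ)
    (E : ℝ → Matrix (Fin 4) (Fin 4) ℝ) : Prop :=
  ∀ s ∈ J, IsTetradAt g (γ s) (E s) ∧
    ∀ i M, HasDerivAt (fun τ => E τ i M)
      (-∑ j, ∑ k, christoffel g (γ s) i j k * deriv γ s j * E s k M) s

/-- A `C⁰` p.p. curvature singularity at the end `s → 0⁺` of a curve `γ : (0, ℓ) → M`: some
component of the Riemann tensor in a parallely propagated tetrad has no finite limit there.
(Two such tetrads differ by a constant Lorentz transformation, so their choice is immaterial.) -/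
def IsPPCurvatureSingularity (g : MetricField) (γ : ℝ → Coord) (ℓ : ℝ) : Prop :=
  ∃ E, IsParallelTetradOn g γ (Set.Ioo 0 ℓ) E ∧ ∃ M N P Q : Fin 4, ¬ ∃ L : ℝ,
    Filter.Tendsto (fun s => frameComponents (riemann g (γ s)) (E s) M N P Q)
      (nhdsWithin 0 (Set.Ioi 0)) (nhds L)

/-- A polynomial in the tetrad components of a covariant 4-tensor. -/
abbrev TensorPolynomial : Type := MvPolynomial (Fin 4 × Fin 4 × Fin 4 × Fin 4) ℝ

/-- The value of a polynomial at a 4-tensor. -/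
noncomputable def TensorPolynomial.value (p : TensorPolynomial)
    (T : Fin 4 → Fin 4 → Fin 4 → Fin 4 → ℝ) : ℝ :=
  MvPolynomial.eval (fun q => T q.1 q.2.1 q.2.2.1 q.2.2.2) p

/-- `p` is a scalar: its value is unchanged by Lorentz transformations of the tetrad. -/
def TensorPolynomial.IsScalar (p : TensorPolynomial) : Prop :=
  ∀ A : Matrix (Fin 4) (Fin 4) ℝ, A.transpose * minkowski * A = minkowski →
    ∀ T : Fin 4 → Fin 4 → Fin 4 → Fin 4 → ℝ, p.value (frameComponents T A) = p.value T

/-- A scalar curvature singularity at the end `s → 0⁺` of a curve `γ : (0, ℓ) → M`: some scalar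
polynomial in the Riemann tensor (evaluated in any tetrads, parallel or not) has no finite limit
there. -/
def IsScalarCurvatureSingularity (g : MetricField) (γ : ℝ → Coord) (ℓ : ℝ) : Prop :=
  ∃ p : TensorPolynomial, p.IsScalar ∧ ∃ E : ℝ → Matrix (Fin 4) (Fin 4) ℝ,
    (∀ s ∈ Set.Ioo 0 ℓ, IsTetradAt g (γ s) (E s)) ∧ ¬ ∃ L : ℝ,
      Filter.Tendsto (fun s => p.value (frameComponents (riemann g (γ s)) (E s)))
        (nhdsWithin 0 (Set.Ioi 0)) (nhds L)

/-- `(M, g)` is locally `C⁰`-extendible (continuous curvature, i.e. `C²` metric) beyond the end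
`s → 0⁺` of the curve `γ : (0, ℓ) → M`: an open part `U` of `M` that contains a final piece of `γ`
embeds isometrically into a Lorentzian coordinate domain `(V, g')` in which that piece of `γ` ends
at a point of `V`.  Nothing is lost by asking for a coordinate domain: an extension into a manifold
can be restricted to a chart around the end point of the curve. -/
def IsLocallyExtendibleAlong (M : Set Coord) (g : MetricField) (γ : ℝ → Coord) (ℓ : ℝ) : Prop :=
  ∃ (U V : Set Coord) (g' : MetricField) (φ : Coord → Coord),
    IsOpen U ∧ U ⊆ M ∧ IsOpen V ∧ IsLorentzMetricOn V g' ∧ IsIsometricEmbedding U g V g' φ ∧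
    (∃ ε, 0 < ε ∧ ε ≤ ℓ ∧ ∀ s ∈ Set.Ioo 0 ε, γ s ∈ U) ∧
    ∃ q ∈ V, Filter.Tendsto (fun s => φ (γ s)) (nhdsWithin 0 (Set.Ioi 0)) (nhds q)

/-! ### Flat FLRW spacetimes -/

/-- The manifold `I × ℝ³` of a flat FLRW spacetime, with Cartesian coordinates `(t, x¹, x², x³)`. -/
def flrwDomain (I : Set ℝ) : Set Coord := {x | x 0 ∈ I}

/-- The flat FLRW metric `-dt² + a(t)² ((dx¹)² + (dx²)² + (dx³)²)`. -/
def flrwMetric (a : ℝ → ℝ) : MetricField := fun x =>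
  Matrix.diagonal ![-1, a (x 0) ^ 2, a (x 0) ^ 2, a (x 0) ^ 2]

/-- The Hubble parameter `H = a' / a`. -/
noncomputable def hubble (a : ℝ → ℝ) (t : ℝ) : ℝ := deriv a t / a t

/-- The affine parameter `λ(t) = ∫_{-∞}^t a`. -/
noncomputable def affineParam (a : ℝ → ℝ) (t : ℝ) : ℝ := ∫ s in Set.Iic t, a s

/-- The conformal time `η(t) = ∫_{t₀}^t 1/a`. -/
noncomputable def conformalTime (a : ℝ → ℝ) (t₀ t : ℝ) : ℝ := ∫ s in t₀..t, (a s)⁻¹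

/-- The radial coordinate `r = |(x¹, x², x³)|`. -/
noncomputable def radius (x : Coord) : ℝ := Real.sqrt (x 1 ^ 2 + x 2 ^ 2 + x 3 ^ 2)

/-- The null geodesics `γ : (0, ℓ) → M` that run into the past null boundary `𝓑⁻`: affinely
parametrized null geodesics along which `t → -∞` at the finite parameter value `0`.
The boundary `𝓑⁻` consists of the past end points of these curves. -/
structure IsBoundaryNullGeodesic (I : Set ℝ) (a : ℝ → ℝ) (γ : ℝ → Coord) (ℓ : ℝ) : Prop where
  pos : 0 < ℓ
  mapsTo : Set.MapsTo γ (Set.Ioo 0 ℓ) (flrwDomain I)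
  geodesic : IsGeodesicOn (flrwMetric a) γ (Set.Ioo 0 ℓ)
  velocity_ne_zero : ∀ s ∈ Set.Ioo 0 ℓ, deriv γ s ≠ 0
  null : ∀ s ∈ Set.Ioo 0 ℓ, ∑ i, ∑ j, flrwMetric a (γ s) i j * deriv γ s i * deriv γ s j = 0
  tendsto : Filter.Tendsto (fun s => γ s 0) (nhdsWithin 0 (Set.Ioi 0)) Filter.atBot

/-- The coordinates `λ`, `v = η + r`, `ω = x / r ∈ S²` of a point with `r ≠ 0`.  The pair `(v, ω)`
in `ℝ × S²` is recorded as the point `eᵛ ω` of `ℝ³ \ {0}`, so that no chart of the sphere has to be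
chosen: the result is `(λ, eᵛ ω)`. -/
noncomputable def nullCoordinates (a : ℝ → ℝ) (t₀ : ℝ) (x : Coord) : Coord :=
  Fin.cons (affineParam a (x 0)) fun i : Fin 3 =>
    Real.exp (conformalTime a t₀ (x 0) + radius x) * (x i.succ / radius x)

/-- The spacetime extends with continuous curvature across its whole past null boundary in the
coordinates `(λ, v, ω)`: these are coordinates on the part `r ≠ 0` of the spacetime, and identify it
isometrically with the part `λ > 0` of a Lorentzian domain `(V, g')` with `g'` of class `C²`; the
hypersurface `λ = 0`, `(v, ω) ∈ ℝ × S²` lies in `V` and consists exactly of the past end points of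
the null geodesics that run into the boundary. -/
def ExtendsInNullCoordinates (I : Set ℝ) (a : ℝ → ℝ) (t₀ : ℝ) : Prop :=
  ∃ (V : Set Coord) (g' : MetricField),
    IsOpen V ∧ IsLorentzMetricOn V g' ∧
    IsIsometricEmbedding {x ∈ flrwDomain I | radius x ≠ 0} (flrwMetric a) V g'
      (nullCoordinates a t₀) ∧
    nullCoordinates a t₀ '' {x ∈ flrwDomain I | radius x ≠ 0} = {y ∈ V | 0 < y 0} ∧
    {y ∈ V | y 0 = 0} = {y | y 0 = 0 ∧ radius y ≠ 0} ∧
    (∀ γ ℓ, IsBoundaryNullGeodesic I a γ ℓ → ∃ q ∈ V, q 0 = 0 ∧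
      Filter.Tendsto (fun s => nullCoordinates a t₀ (γ s)) (nhdsWithin 0 (Set.Ioi 0)) (nhds q)) ∧
    ∀ q ∈ V, q 0 = 0 → ∃ γ ℓ, IsBoundaryNullGeodesic I a γ ℓ ∧
      Filter.Tendsto (fun s => nullCoordinates a t₀ (γ s)) (nhdsWithin 0 (Set.Ioi 0)) (nhds q)

/-! The curvature of a flat FLRW metric is `H²` times the constant-curvature tensor minus `Ḣ` times
a tensor built from `dt ⊗ dt` and `g`. In an orthonormal frame it therefore sees the frame only
through the time components `E 0 M`. Along a null geodesic reaching the boundary, the Killing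
momenta and the null condition give `t' = κ/a`, and parallel transport gives `E 0 M = C M / a - m M
* a` with `C` a nonzero null vector (`exists_parallel_time_row_limit`). The frame components thus
behave like `Ḣ/a²` times products of the `C M`, up to the `H²` term. This yields both the divergence
(`exists_tendsto_frameComponents`) and the convergence (`not_isPPCurvatureSingularity`).

Inextendibility: a `C³` isometric embedding transports the connection and the curvature
(`fderiv_connection_eq`, `fderiv_curvature_eq`). A geodesic that converges to an interior point of a
`C²` metric has bounded velocity, so parallel frames along it stay bounded and so do the curvature
components, contradicting the divergence (`not_isLocallyExtendibleAlong`).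

Scalar invariants may be computed in the comoving frame, where the curvature components involve only
`H²` and `Ḣ`. If `Ḣ → 0`, then `H → HΛ` (`tendsto_hubble`), and every scalar polynomial converges.

Extension: since `dλ = a dt` and `dv = dt/a + dr`, the metric becomes `α² dv² - 2 dv dλ + (α v - β)²
dω²`, where `α = a` and `β = aη` are regarded as functions of `λ`. As `d/dλ = a⁻¹ d/dt`, one finds
`α' = H`, `α'' = Ḣ/a`, `β' = Hη + 1/a` and `β'' = (Ḣ/a²)(aη)`. All of these converge when `Ḣ/a²`
does; the delicate one is `β'`, settled by the convergence of `η + 1/(Ha)`. Both coefficients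
therefore extend in class `C²` across `λ = 0` (`exists_extended_coefficients`). There `α = 0` and
`-β = 1/HΛ > 0`, so the extended metric is nondegenerate along the whole hypersurface. -/

set_option maxSynthPendingDepth 3

/-! ### Coordinate-free connection and curvature of a `C²` metric -/

open ContinuousLinearMap in
/-- The metric `g` at `x` as a continuous bilinear form. -/
noncomputable def metricForm (g : MetricField) (x : Coord) : Coord →L[ℝ] Coord →L[ℝ] ℝ :=
  ∑ i, ∑ j, g x i j • (proj (R := ℝ) (φ := fun _ : Fin 4 => ℝ) i).smulRight
    (proj (R := ℝ) (φ := fun _ : Fin 4 => ℝ) j)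

open ContinuousLinearMap in
/-- The Christoffel symbols of `g` at `x` as a continuous bilinear map. -/
noncomputable def connection (g : MetricField) (x : Coord) : Coord →L[ℝ] Coord →L[ℝ] Coord :=
  ∑ i, ∑ j, ∑ k, christoffel g x i j k • (proj (R := ℝ) (φ := fun _ : Fin 4 => ℝ) j).smulRight
    ((proj (R := ℝ) (φ := fun _ : Fin 4 => ℝ) k).smulRight (Pi.single i 1 : Coord))

theorem metricForm_apply (g : MetricField) (x u v : Coord) :
    metricForm g x u v = ∑ i, ∑ j, g x i j * u i * v j := by
  simp [metricForm, mul_assoc]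

theorem connection_apply (g : MetricField) (x u v : Coord) (i : Fin 4) :
    connection g x u v i = ∑ j, ∑ k, christoffel g x i j k * u j * v k := by
  simp only [connection, sum_apply, smul_apply,
    ContinuousLinearMap.smulRight_apply, ContinuousLinearMap.proj_apply, Finset.sum_apply,
    Pi.smul_apply, smul_eq_mul]
  rw [Finset.sum_eq_single i]
  · simp [mul_assoc]
  · intro b _ hb
    simp [hb.symm]
  · simp

theorem metricForm_single (g : MetricField) (x : Coord) (i j : Fin 4) :
    metricForm g x (Pi.single i 1) (Pi.single j 1) = g x i j := by
  simp [metricForm_apply, Pi.single_apply]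

theorem connection_single (g : MetricField) (x : Coord) (i j k : Fin 4) :
    connection g x (Pi.single j 1) (Pi.single k 1) i = christoffel g x i j k := by
  simp [connection_apply, Pi.single_apply]

theorem eq_sum_single (z : Coord) : z = ∑ i, z i • (Pi.single i 1 : Coord) := by
  conv_lhs => rw [← Finset.univ_sum_single z]
  refine Finset.sum_congr rfl fun i _ => ?_
  rw [← Pi.single_smul]
  simp

theorem trilinear_ext {F G : Coord →L[ℝ] Coord →L[ℝ] Coord →L[ℝ] ℝ}
    (h : ∀ i j k, F (Pi.single i 1) (Pi.single j 1) (Pi.single k 1) =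
      G (Pi.single i 1) (Pi.single j 1) (Pi.single k 1)) (u v w : Coord) : F u v w = G u v w := by
  rw [eq_sum_single u, eq_sum_single v, eq_sum_single w]
  simp only [map_sum, map_smul, sum_apply, smul_apply,
    h]

namespace IsLorentzMetricOn

variable {V : Set Coord} {g : MetricField}

theorem isUnit_det (h : IsLorentzMetricOn V g) {x : Coord} (hx : x ∈ V) : IsUnit (g x).det := by
  obtain ⟨E, hE⟩ := h.signature x hx
  have h1 := congrArg Matrix.det hE
  rw [Matrix.det_mul, Matrix.det_mul, Matrix.det_transpose] at h1
  have h2 : (minkowski).det = -1 := by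
    simp [minkowski, Matrix.det_diagonal, Fin.prod_univ_four]
  rw [isUnit_iff_ne_zero]
  rintro h0
  rw [h0, h2] at h1
  norm_num at h1

theorem metricForm_symm (h : IsLorentzMetricOn V g) {x : Coord} (hx : x ∈ V) (u v : Coord) :
    metricForm g x u v = metricForm g x v u := by
  rw [metricForm_apply, metricForm_apply, Finset.sum_comm]
  refine Finset.sum_congr rfl fun i _ => Finset.sum_congr rfl fun j _ => ?_
  rw [(h.symm x hx).apply]
  ring

theorem eq_of_metricForm_eq (h : IsLorentzMetricOn V g) {x : Coord} (hx : x ∈ V) {u v : Coord}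
    (huv : ∀ w, metricForm g x u w = metricForm g x v w) : u = v := by
  have h1 : ∀ z : Coord, ∀ j, metricForm g x z (Pi.single j 1) = Matrix.vecMul z (g x) j := by
    intro z j
    simp [metricForm_apply, Pi.single_apply, Matrix.vecMul, dotProduct, mul_comm]
  have h2 : Matrix.vecMul u (g x) = Matrix.vecMul v (g x) := by
    funext j
    rw [← h1, ← h1, huv]
  have h3 := Matrix.vecMul_injective_iff_isUnit.2 ((Matrix.isUnit_iff_isUnit_det _).2
    (h.isUnit_det hx))
  exact h3 h2

theorem contDiffOn_metricForm (h : IsLorentzMetricOn V g) : ContDiffOn ℝ 2 (metricForm g) V := by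
  unfold metricForm
  exact ContDiffOn.sum fun i _ => ContDiffOn.sum fun j _ =>
    (h.contDiffOn i j).smul contDiffOn_const

theorem contDiffOn_partialDeriv (h : IsLorentzMetricOn V g) (hV : IsOpen V) (i j k : Fin 4) :
    ContDiffOn ℝ 1 (partialDeriv k fun y => g y i j) V := by
  unfold partialDeriv
  exact ((h.contDiffOn i j).fderiv_of_isOpen hV (by norm_num)).clm_apply contDiffOn_const

theorem contDiffOn_inv (h : IsLorentzMetricOn V g) (i j : Fin 4) :
    ContDiffOn ℝ 2 (fun x => (g x)⁻¹ i j) V := by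
  have hdet : ∀ A : Coord → Matrix (Fin 4) (Fin 4) ℝ, (∀ i j, ContDiffOn ℝ 2 (fun x => A x i j) V) →
      ContDiffOn ℝ 2 (fun x => (A x).det) V := by
    intro A hA
    simp only [Matrix.det_apply]
    exact ContDiffOn.sum fun σ _ => ContDiffOn.const_smul _ (contDiffOn_prod fun i _ => hA _ _)
  have h1 : ContDiffOn ℝ 2 (fun x => (g x).adjugate i j) V := by
    simp only [Matrix.adjugate_apply]
    refine hdet _ fun k l => ?_
    by_cases hk : k = j
    · subst hk
      simpa using contDiffOn_const
    · simpa [Matrix.updateRow_ne hk] using h.contDiffOn k l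
  have h2 := (hdet g h.contDiffOn).inv fun x hx => (h.isUnit_det hx).ne_zero
  refine (h2.mul h1).congr fun x hx => ?_
  rw [Matrix.inv_def, Ring.inverse_eq_inv']
  rfl

theorem contDiffOn_christoffel (h : IsLorentzMetricOn V g) (hV : IsOpen V) (i j k : Fin 4) :
    ContDiffOn ℝ 1 (fun x => christoffel g x i j k) V := by
  unfold christoffel
  refine contDiffOn_const.mul (ContDiffOn.sum fun l _ => ?_)
  exact ((h.contDiffOn_inv i l).of_le (by norm_num)).mul
    (((h.contDiffOn_partialDeriv hV _ _ _).add (h.contDiffOn_partialDeriv hV _ _ _)).sub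
      (h.contDiffOn_partialDeriv hV _ _ _))

theorem contDiffOn_connection (h : IsLorentzMetricOn V g) (hV : IsOpen V) :
    ContDiffOn ℝ 1 (connection g) V := by
  unfold connection
  exact ContDiffOn.sum fun i _ => ContDiffOn.sum fun j _ => ContDiffOn.sum fun k _ =>
    (h.contDiffOn_christoffel hV i j k).smul contDiffOn_const

theorem continuousOn_riemann (h : IsLorentzMetricOn V g) (hV : IsOpen V) (i j k l : Fin 4) :
    ContinuousOn (fun x => riemann g x i j k l) V := by
  have hc : ∀ i j k, ContinuousOn (fun x => christoffel g x i j k) V := fun i j k =>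
    (h.contDiffOn_christoffel hV i j k).continuousOn
  have hd : ∀ i j k l, ContinuousOn (partialDeriv l fun x => christoffel g x i j k) V := by
    intro i j k l
    unfold partialDeriv
    exact ((h.contDiffOn_christoffel hV i j k).continuousOn_fderiv_of_isOpen hV le_rfl).clm_apply
      continuousOn_const
  unfold riemann riemannUp
  refine continuousOn_finsetSum _ fun m _ => (h.contDiffOn i m).continuousOn.mul ?_
  refine ((hd _ _ _ _).sub (hd _ _ _ _)).add (continuousOn_finsetSum _ fun n _ => ?_)
  exact ((hc _ _ _).mul (hc _ _ _)).sub ((hc _ _ _).mul (hc _ _ _))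

theorem fderiv_metricForm_single (h : IsLorentzMetricOn V g) (hV : IsOpen V) {x : Coord}
    (hx : x ∈ V) (i j k : Fin 4) :
    fderiv ℝ (metricForm g) x (Pi.single k 1) (Pi.single i 1) (Pi.single j 1) =
      partialDeriv k (fun y => g y i j) x := by
  have h1 : DifferentiableAt ℝ (metricForm g) x :=
    (h.contDiffOn_metricForm.contDiffAt (hV.mem_nhds hx)).differentiableAt (by norm_num)
  have h2 := (h1.hasFDerivAt.clm_apply (hasFDerivAt_const (Pi.single i 1 : Coord) x)).clm_apply
    (hasFDerivAt_const (Pi.single j 1 : Coord) x)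
  simp only [metricForm_single] at h2
  rw [partialDeriv, h2.fderiv]
  simp

/-- The Koszul formula. -/
theorem koszul (h : IsLorentzMetricOn V g) (hV : IsOpen V) {x : Coord} (hx : x ∈ V)
    (u v w : Coord) :
    2 * metricForm g x (connection g x u v) w =
      fderiv ℝ (metricForm g) x u w v + fderiv ℝ (metricForm g) x v w u
        - fderiv ℝ (metricForm g) x w u v := by
  set D := fderiv ℝ (metricForm g) x with hD
  -- Flipping arguments presents both sides as continuous trilinear maps, so that basis vectors
  -- suffice.
  let fl : (Coord →L[ℝ] Coord →L[ℝ] ℝ) →L[ℝ] (Coord →L[ℝ] Coord →L[ℝ] ℝ) :=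
    (ContinuousLinearMap.flipₗᵢ' Coord Coord ℝ (RingHom.id ℝ)
      (RingHom.id ℝ)).toContinuousLinearEquiv.toContinuousLinearMap
  let F : Coord →L[ℝ] Coord →L[ℝ] Coord →L[ℝ] ℝ :=
    2 • ((ContinuousLinearMap.compL ℝ Coord Coord (Coord →L[ℝ] ℝ)) (metricForm g x)).comp
      (connection g x)
  let G : Coord →L[ℝ] Coord →L[ℝ] Coord →L[ℝ] ℝ :=
    fl.comp D + (fl.comp D).flip - fl.comp D.flip
  have hF : ∀ u v w, F u v w = 2 * metricForm g x (connection g x u v) w := by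
    intro u v w
    simp [F]
  have hG : ∀ u v w, G u v w = D u w v + D v w u - D w u v := by
    intro u v w
    simp [G, fl]
  rw [← hF, ← hG]
  refine trilinear_ext (fun j k l => ?_) u v w
  rw [hF, hG, h.fderiv_metricForm_single hV hx, h.fderiv_metricForm_single hV hx,
    h.fderiv_metricForm_single hV hx, h.metricForm_symm hx]
  have h1 : ∀ z : Coord, metricForm g x (Pi.single l 1) z = Matrix.mulVec (g x) z l := by
    intro z
    simp [metricForm_apply, Pi.single_apply, Matrix.mulVec, dotProduct]
  -- The connection is `g⁻¹` applied to the Christoffel symbols of the first kind; lowering the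
  -- index cancels `g⁻¹`.
  have h2 : connection g x (Pi.single j 1) (Pi.single k 1) =
      Matrix.mulVec (g x)⁻¹ (fun l => (1 / 2 : ℝ) * (partialDeriv j (fun y => g y l k) x
        + partialDeriv k (fun y => g y l j) x - partialDeriv l (fun y => g y j k) x)) := by
    funext i
    rw [connection_single, christoffel, Matrix.mulVec, dotProduct, Finset.mul_sum]
    exact Finset.sum_congr rfl fun _ _ => by ring
  rw [h1, h2, Matrix.mulVec_mulVec, Matrix.mul_nonsing_inv _ (h.isUnit_det hx),
    Matrix.one_mulVec]
  ring

end IsLorentzMetricOn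

/-- The curvature operator `R(u, v) w` of `g` at `x`. -/
noncomputable def curvature (g : MetricField) (x u v w : Coord) : Coord :=
  fderiv ℝ (connection g) x u v w - fderiv ℝ (connection g) x v u w
    + connection g x u (connection g x v w) - connection g x v (connection g x u w)

/-- The index formula is the curvature operator on basis vectors; the operator form is the one to
which the chain rule applies without indices. -/
theorem IsLorentzMetricOn.riemannUp_eq {V : Set Coord} {g : MetricField}
    (h : IsLorentzMetricOn V g) (hV : IsOpen V) {x : Coord} (hx : x ∈ V) (i j k l : Fin 4) :
    riemannUp g x i j k l =
      curvature g x (Pi.single k 1) (Pi.single l 1) (Pi.single j 1) i := by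
  have h1 : DifferentiableAt ℝ (connection g) x :=
    ((h.contDiffOn_connection hV).contDiffAt (hV.mem_nhds hx)).differentiableAt (by norm_num)
  have h2 : ∀ k l j : Fin 4, fderiv ℝ (connection g) x (Pi.single k 1) (Pi.single l 1)
      (Pi.single j 1) i = partialDeriv k (fun y => christoffel g y i l j) x := by
    intro k l j
    have h2 := (h1.hasFDerivAt.clm_apply (hasFDerivAt_const (Pi.single l 1 : Coord) x)).clm_apply
      (hasFDerivAt_const (Pi.single j 1 : Coord) x)
    have h3 := (hasFDerivAt_pi'.1 h2) i
    simp only [connection_single] at h3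
    rw [partialDeriv, h3.fderiv]
    simp
  have h3 : ∀ k l j : Fin 4, connection g x (Pi.single k 1) (connection g x (Pi.single l 1)
      (Pi.single j 1)) i = ∑ m, christoffel g x i k m * christoffel g x m l j := by
    intro k l j
    rw [connection_apply]
    simp [Pi.single_apply, connection_single]
  simp only [riemannUp, curvature, Pi.add_apply, Pi.sub_apply, h2, h3, Finset.sum_sub_distrib]
  ring

/-- Every term of `curvature` is linear in each vector separately, with no differentiation of the
vectors themselves. -/
theorem curvature_sum (g : MetricField) (x u v w : Coord) :
    curvature g x u v w = ∑ k, ∑ l, ∑ j, (u k * v l * w j) •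
      curvature g x (Pi.single k 1) (Pi.single l 1) (Pi.single j 1) := by
  have hw : ∀ u v w, curvature g x u v w = ∑ j, w j • curvature g x u v (Pi.single j 1) := by
    intro u v w
    conv_lhs => rw [eq_sum_single w]
    simp only [curvature, map_sum, map_smul, smul_sub, smul_add, Finset.sum_add_distrib,
      Finset.sum_sub_distrib]
  have hv : ∀ u v w, curvature g x u v w = ∑ j, v j • curvature g x u (Pi.single j 1) w := by
    intro u v w
    conv_lhs => rw [eq_sum_single v]
    simp only [curvature, map_sum, map_smul, smul_sub, smul_add, Finset.sum_add_distrib,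
      Finset.sum_sub_distrib, sum_apply, smul_apply]
  have hu : ∀ u v w, curvature g x u v w = ∑ j, u j • curvature g x (Pi.single j 1) v w := by
    intro u v w
    conv_lhs => rw [eq_sum_single u]
    simp only [curvature, map_sum, map_smul, smul_sub, smul_add, Finset.sum_add_distrib,
      Finset.sum_sub_distrib, sum_apply, smul_apply]
  rw [hu]
  refine Finset.sum_congr rfl fun k _ => ?_
  rw [hv, Finset.smul_sum]
  refine Finset.sum_congr rfl fun l _ => ?_
  rw [hw, Finset.smul_sum, Finset.smul_sum]
  refine Finset.sum_congr rfl fun j _ => ?_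
  rw [smul_smul, smul_smul, mul_assoc]

theorem IsLorentzMetricOn.frameComponents_riemann {V : Set Coord} {g : MetricField}
    (h : IsLorentzMetricOn V g) (hV : IsOpen V) {x : Coord} (hx : x ∈ V)
    (E : Matrix (Fin 4) (Fin 4) ℝ) (M N P Q : Fin 4) :
    frameComponents (riemann g x) E M N P Q =
      metricForm g x (E.col M) (curvature g x (E.col P) (E.col Q) (E.col N)) := by
  rw [curvature_sum, metricForm_apply, frameComponents]
  refine Finset.sum_congr rfl fun i _ => ?_
  simp only [riemann, h.riemannUp_eq hV hx, Finset.sum_apply, Pi.smul_apply, smul_eq_mul,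
    Matrix.col_apply, Finset.mul_sum, Finset.sum_mul]
  symm
  rw [Finset.sum_congr rfl fun m _ => Finset.sum_congr rfl fun k _ => Finset.sum_comm]
  rw [Finset.sum_congr rfl fun m _ => Finset.sum_comm, Finset.sum_comm]
  refine Finset.sum_congr rfl fun j _ => ?_
  rw [Finset.sum_comm]
  refine Finset.sum_congr rfl fun k _ => ?_
  rw [Finset.sum_comm]
  refine Finset.sum_congr rfl fun l _ => Finset.sum_congr rfl fun m _ => ?_
  ring

theorem bilinear_ext {F G : Coord →L[ℝ] Coord →L[ℝ] ℝ}
    (h : ∀ i j, F (Pi.single i 1) (Pi.single j 1) = G (Pi.single i 1) (Pi.single j 1)) :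
    F = G := by
  ext u v
  rw [eq_sum_single u, eq_sum_single v]
  simp only [map_sum, map_smul, sum_apply, smul_apply, h]

theorem IsLorentzMetricOn.mono {U V : Set Coord} {g : MetricField} (h : IsLorentzMetricOn V g)
    (hUV : U ⊆ V) : IsLorentzMetricOn U g :=
  ⟨fun i j => (h.contDiffOn i j).mono hUV, fun x hx => h.symm x (hUV hx),
    fun x hx => h.signature x (hUV hx)⟩

/-! ### Naturality of connection and curvature under isometric embeddings -/

namespace IsIsometricEmbedding

variable {U V : Set Coord} {g g' : MetricField} {φ : Coord → Coord}

theorem contDiffAt (hφ : IsIsometricEmbedding U g V g' φ) (hU : IsOpen U) {x : Coord}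
    (hx : x ∈ U) : ContDiffAt ℝ 3 φ x :=
  hφ.contDiffOn.contDiffAt (hU.mem_nhds hx)

theorem metricForm_eq (hφ : IsIsometricEmbedding U g V g' φ) (hU : IsOpen U) {x : Coord}
    (hx : x ∈ U) (u v : Coord) :
    metricForm g x u v = metricForm g' (φ x) (fderiv ℝ φ x u) (fderiv ℝ φ x v) := by
  have h1 : DifferentiableAt ℝ φ x := (hφ.contDiffAt hU hx).differentiableAt (by norm_num)
  have h2 : metricForm g x =
      (metricForm g' (φ x)).bilinearComp (fderiv ℝ φ x) (fderiv ℝ φ x) := by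
    refine bilinear_ext fun i j => ?_
    rw [metricForm_single, hφ.pullback x hx, ContinuousLinearMap.bilinearComp_apply,
      metricForm_apply]
    refine Finset.sum_congr rfl fun k _ => Finset.sum_congr rfl fun l _ => ?_
    have h3 : ∀ i k, partialDeriv i (fun y => φ y k) x = fderiv ℝ φ x (Pi.single i 1) k := by
      intro i k
      rw [partialDeriv, (hasFDerivAt_pi'.1 h1.hasFDerivAt k).fderiv]
      simp
    rw [h3, h3]
  rw [h2, ContinuousLinearMap.bilinearComp_apply]

/-- Nondegeneracy of `g` makes the differential injective, hence onto in equal dimensions.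
Identities in the target can then be tested on image vectors. -/
theorem surjective_fderiv (hφ : IsIsometricEmbedding U g V g' φ) (hU : IsOpen U)
    (hg : IsLorentzMetricOn U g) {x : Coord} (hx : x ∈ U) :
    Function.Surjective (fderiv ℝ φ x) := by
  have h1 : Function.Injective (fderiv ℝ φ x).toLinearMap := by
    intro u v huv
    refine hg.eq_of_metricForm_eq hx fun w => ?_
    rw [hφ.metricForm_eq hU hx, hφ.metricForm_eq hU hx]
    exact congrArg (fun z => metricForm g' (φ x) z (fderiv ℝ φ x w)) huv
  exact LinearMap.injective_iff_surjective.1 h1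

theorem hasFDerivAt_fderiv (hφ : IsIsometricEmbedding U g V g' φ) (hU : IsOpen U) {x : Coord}
    (hx : x ∈ U) : HasFDerivAt (fderiv ℝ φ) (fderiv ℝ (fderiv ℝ φ) x) x :=
  (((hφ.contDiffAt hU hx).fderiv_right (m := 2) (by norm_num)).differentiableAt
    (by norm_num)).hasFDerivAt

theorem fderiv_fderiv_symm (hφ : IsIsometricEmbedding U g V g' φ) (hU : IsOpen U) {x : Coord}
    (hx : x ∈ U) (u v : Coord) :
    fderiv ℝ (fderiv ℝ φ) x u v = fderiv ℝ (fderiv ℝ φ) x v u :=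
  ((hφ.contDiffAt hU hx).isSymmSndFDerivAt (by
    rw [minSmoothness_of_isRCLikeNormedField]; norm_num)).eq u v

theorem fderiv_metricForm (hφ : IsIsometricEmbedding U g V g' φ) (hU : IsOpen U) (hV : IsOpen V)
    (hg' : IsLorentzMetricOn V g') {x : Coord} (hx : x ∈ U) (w u v : Coord) :
    fderiv ℝ (metricForm g) x w u v =
      fderiv ℝ (metricForm g') (φ x) (fderiv ℝ φ x w) (fderiv ℝ φ x u) (fderiv ℝ φ x v)
      + metricForm g' (φ x) (fderiv ℝ (fderiv ℝ φ) x w u) (fderiv ℝ φ x v)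
      + metricForm g' (φ x) (fderiv ℝ φ x u) (fderiv ℝ (fderiv ℝ φ) x w v) := by
  have hd : HasFDerivAt φ (fderiv ℝ φ x) x :=
    ((hφ.contDiffAt hU hx).differentiableAt (by norm_num)).hasFDerivAt
  have hg1 : HasFDerivAt (metricForm g') (fderiv ℝ (metricForm g') (φ x)) (φ x) :=
    ((hg'.contDiffOn_metricForm.contDiffAt (hV.mem_nhds (hφ.mapsTo hx))).differentiableAt
      (by norm_num)).hasFDerivAt
  have h1 : ∀ u, HasFDerivAt (fun y => fderiv ℝ φ y u) _ x := fun u =>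
    (hφ.hasFDerivAt_fderiv hU hx).clm_apply (hasFDerivAt_const u x)
  have h2 := ((hg1.comp x hd).clm_apply (h1 u)).clm_apply (h1 v)
  have h4 : (fun y => metricForm g y u v) =ᶠ[nhds x]
      fun y => metricForm g' (φ y) (fderiv ℝ φ y u) (fderiv ℝ φ y v) := by
    filter_upwards [hU.mem_nhds hx] with y hy using hφ.metricForm_eq hU hy u v
  have h3 := h2.congr_of_eventuallyEq h4
  -- Differentiability of `g` is read off from the pull-back formula, so no regularity of `g` has to
  -- be assumed.
  have h5 : DifferentiableAt ℝ (metricForm g) x := by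
    have h6 : metricForm g =ᶠ[nhds x] fun y =>
        (metricForm g' (φ y)).bilinearComp (fderiv ℝ φ y) (fderiv ℝ φ y) := by
      filter_upwards [hU.mem_nhds hx] with y hy
      ext u v
      exact hφ.metricForm_eq hU hy u v
    unfold metricForm
    refine DifferentiableAt.fun_sum fun i _ => DifferentiableAt.fun_sum fun j _ =>
      DifferentiableAt.smul_const ?_ _
    have h7 := ((hg1.comp x hd).clm_apply (h1 (Pi.single i 1))).clm_apply (h1 (Pi.single j 1))
    refine (h7.congr_of_eventuallyEq ?_).differentiableAt
    filter_upwards [hU.mem_nhds hx] with y hy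
    exact (metricForm_single g y i j).symm.trans (hφ.metricForm_eq hU hy _ _)
  have h8 := (h5.hasFDerivAt.clm_apply (hasFDerivAt_const u x)).clm_apply (hasFDerivAt_const v x)
  have h9 := congrArg (fun L => L w) (h8.unique h3)
  simp at h9
  rw [h9]
  ring

/-- The classical transformation law of Christoffel symbols. Comparing the two Koszul formulas, the
six terms containing `D²φ` collapse by symmetry to `2 g'(D²φ(u, v), Dφ w)`. -/
theorem fderiv_connection_eq (hφ : IsIsometricEmbedding U g V g' φ) (hU : IsOpen U)
    (hV : IsOpen V) (hg : IsLorentzMetricOn U g) (hg' : IsLorentzMetricOn V g') {x : Coord}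
    (hx : x ∈ U) (u v : Coord) :
    fderiv ℝ φ x (connection g x u v) = fderiv ℝ (fderiv ℝ φ) x u v
      + connection g' (φ x) (fderiv ℝ φ x u) (fderiv ℝ φ x v) := by
  have hx' := hφ.mapsTo hx
  refine hg'.eq_of_metricForm_eq hx' fun w' => ?_
  obtain ⟨w, rfl⟩ := hφ.surjective_fderiv hU hg hx w'
  rw [← hφ.metricForm_eq hU hx]
  have h1 := hg.koszul hU hx u v w
  rw [hφ.fderiv_metricForm hU hV hg' hx, hφ.fderiv_metricForm hU hV hg' hx,
    hφ.fderiv_metricForm hU hV hg' hx] at h1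
  have h2 := hg'.koszul hV hx' (fderiv ℝ φ x u) (fderiv ℝ φ x v) (fderiv ℝ φ x w)
  rw [map_add, add_apply]
  have e1 := hφ.fderiv_fderiv_symm hU hx
  rw [e1 w u, e1 w v, e1 v u, hg'.metricForm_symm hx' (fderiv ℝ φ x w)] at h1
  have e2 := hg'.metricForm_symm hx' (fderiv ℝ φ x u) (fderiv ℝ (fderiv ℝ φ) x v w)
  linarith

/-- Differentiate the transformation law and antisymmetrise: the third derivatives of `φ` cancel by
symmetry, which is where class `C³` enters. -/
theorem fderiv_curvature_eq (hφ : IsIsometricEmbedding U g V g' φ) (hU : IsOpen U)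
    (hV : IsOpen V) (hg : IsLorentzMetricOn U g) (hg' : IsLorentzMetricOn V g') {x : Coord}
    (hx : x ∈ U) (u v w : Coord) :
    fderiv ℝ φ x (curvature g x u v w) =
      curvature g' (φ x) (fderiv ℝ φ x u) (fderiv ℝ φ x v) (fderiv ℝ φ x w) := by
  have hx' := hφ.mapsTo hx
  have hd : HasFDerivAt φ (fderiv ℝ φ x) x :=
    ((hφ.contDiffAt hU hx).differentiableAt (by norm_num)).hasFDerivAt
  have hd1 := hφ.hasFDerivAt_fderiv hU hx
  have hc1 : ContDiffAt ℝ 2 (fderiv ℝ φ) x :=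
    (hφ.contDiffAt hU hx).fderiv_right (m := 2) (by norm_num)
  have hd2 : HasFDerivAt (fderiv ℝ (fderiv ℝ φ)) (fderiv ℝ (fderiv ℝ (fderiv ℝ φ)) x) x :=
    ((hc1.fderiv_right (m := 1) (by norm_num)).differentiableAt (by norm_num)).hasFDerivAt
  have hs2 : ∀ u v, fderiv ℝ (fderiv ℝ (fderiv ℝ φ)) x u v =
      fderiv ℝ (fderiv ℝ (fderiv ℝ φ)) x v u := fun u v =>
    (hc1.isSymmSndFDerivAt (by simp)).eq u v
  have hG : HasFDerivAt (connection g) (fderiv ℝ (connection g) x) x :=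
    (((hg.contDiffOn_connection hU).contDiffAt (hU.mem_nhds hx)).differentiableAt
      (by norm_num)).hasFDerivAt
  have hG' : HasFDerivAt (connection g') (fderiv ℝ (connection g') (φ x)) (φ x) :=
    (((hg'.contDiffOn_connection hV).contDiffAt (hV.mem_nhds hx')).differentiableAt
      (by norm_num)).hasFDerivAt
  have key : ∀ u v w, fderiv ℝ (fderiv ℝ φ) x u (connection g x v w)
      + fderiv ℝ φ x (fderiv ℝ (connection g) x u v w) =
      fderiv ℝ (fderiv ℝ (fderiv ℝ φ)) x u v w
      + (fderiv ℝ (connection g') (φ x) (fderiv ℝ φ x u) (fderiv ℝ φ x v) (fderiv ℝ φ x w)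
      + connection g' (φ x) (fderiv ℝ (fderiv ℝ φ) x u v) (fderiv ℝ φ x w)
      + connection g' (φ x) (fderiv ℝ φ x v) (fderiv ℝ (fderiv ℝ φ) x u w)) := by
    intro u v w
    have h1 := hd1.clm_apply ((hG.clm_apply (hasFDerivAt_const v x)).clm_apply
      (hasFDerivAt_const w x))
    have h2 := ((hd2.clm_apply (hasFDerivAt_const v x)).clm_apply (hasFDerivAt_const w x)).add
      (((hG'.comp x hd).clm_apply (hd1.clm_apply (hasFDerivAt_const v x))).clm_apply
        (hd1.clm_apply (hasFDerivAt_const w x)))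
    have h3 := h2.congr_of_eventuallyEq (f₁ := fun y => fderiv ℝ φ y (connection g y v w)) (by
      filter_upwards [hU.mem_nhds hx] with y hy
      exact hφ.fderiv_connection_eq hU hV hg hg' hy v w)
    have h4 := congrArg (fun L => L u) (h1.unique h3)
    simp at h4
    rw [add_comm, h4]
    abel
  have k1 := key u v w
  have k2 := key v u w
  have c := hφ.fderiv_connection_eq hU hV hg hg' hx
  -- The transformation law, used twice more, trades `D²φ` applied to a connection term for the
  -- quadratic terms of the curvature.
  have b1 : ∀ u v w, fderiv ℝ (fderiv ℝ φ) x u (connection g x v w) =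
      fderiv ℝ φ x (connection g x u (connection g x v w))
      - connection g' (φ x) (fderiv ℝ φ x u) (fderiv ℝ (fderiv ℝ φ) x v w)
      - connection g' (φ x) (fderiv ℝ φ x u)
        (connection g' (φ x) (fderiv ℝ φ x v) (fderiv ℝ φ x w)) := by
    intro u v w
    rw [c u (connection g x v w), c v w, map_add]
    abel
  rw [b1] at k1 k2
  rw [hs2 v u, hφ.fderiv_fderiv_symm hU hx v u] at k2
  simp only [curvature, map_sub, map_add]
  have k3 := congrArg₂ (· - ·) k1 k2
  rw [← sub_eq_zero] at k3 ⊢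
  rw [← k3]
  abel

theorem frameComponents_riemann (hφ : IsIsometricEmbedding U g V g' φ) (hU : IsOpen U)
    (hV : IsOpen V) (hg : IsLorentzMetricOn U g) (hg' : IsLorentzMetricOn V g') {x : Coord}
    (hx : x ∈ U) {E E' : Matrix (Fin 4) (Fin 4) ℝ}
    (hE : ∀ M, E'.col M = fderiv ℝ φ x (E.col M)) (M N P Q : Fin 4) :
    frameComponents (riemann g x) E M N P Q =
      frameComponents (riemann g' (φ x)) E' M N P Q := by
  rw [hg.frameComponents_riemann hU hx, hg'.frameComponents_riemann hV (hφ.mapsTo hx),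
    hE, hE, hE, hE, hφ.metricForm_eq hU hx, hφ.fderiv_curvature_eq hU hV hg hg' hx]

end IsIsometricEmbedding

/-! ### Bounded parallel transport and the obstruction to extension -/

section BoundedTransport

open Filter Topology Set

theorem norm_sq_le_sum_sq (u : Coord) : ‖u‖ ^ 2 ≤ ∑ j, u j ^ 2 := by
  obtain ⟨i, hi⟩ : ∃ i, ‖u‖ = ‖u i‖ := by
    obtain ⟨i, -, hi⟩ := Finset.exists_mem_eq_sup' (s := Finset.univ) ⟨(0 : Fin 4), by simp⟩
      (fun i => ‖u i‖)
    refine ⟨i, le_antisymm ?_ (norm_le_pi_norm u i)⟩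
    rw [← hi]
    exact (pi_norm_le_iff_of_nonempty _).2 fun j => Finset.le_sup' (fun i => ‖u i‖)
      (Finset.mem_univ j)
  rw [hi, Real.norm_eq_abs, sq_abs]
  exact Finset.single_le_sum (f := fun j => u j ^ 2) (fun j _ => sq_nonneg _) (Finset.mem_univ i)

theorem abs_sum_mul_le (u v : Coord) : |∑ j, u j * v j| ≤ 4 * (‖u‖ * ‖v‖) := by
  refine (Finset.abs_sum_le_sum_abs _ _).trans ?_
  have h : ∀ j ∈ Finset.univ, |u j * v j| ≤ ‖u‖ * ‖v‖ := fun j _ => by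
    rw [abs_mul]
    exact mul_le_mul (norm_le_pi_norm u j) (norm_le_pi_norm v j) (abs_nonneg _) (norm_nonneg _)
  refine (Finset.sum_le_sum h).trans (by simp)

/-- A geodesic of a continuous connection that converges to a point has bounded velocity. -/
theorem exists_norm_velocity_le {Γ : Coord → Coord →L[ℝ] Coord →L[ℝ] Coord} {q : Coord}
    (hΓ : ContinuousAt Γ q) {σ w : ℝ → Coord} {ε : ℝ} (hε : 0 < ε)
    (hσ : ∀ s ∈ Ioo 0 ε, HasDerivAt σ (w s) s)
    (hw : ∀ s ∈ Ioo 0 ε, HasDerivAt w (-Γ (σ s) (w s) (w s)) s)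
    (hq : Tendsto σ (𝓝[>] 0) (𝓝 q)) :
    ∃ B K δ, 0 ≤ B ∧ 0 ≤ K ∧ 0 < δ ∧ δ ≤ ε ∧
      ∀ s ∈ Ioo 0 δ, ‖w s‖ ≤ B ∧ ‖Γ (σ s)‖ ≤ K := by
  set K := ‖Γ q‖ + 1 with hK
  have hK0 : 0 < K := by positivity
  have h1 : ∀ᶠ s in 𝓝[>] (0 : ℝ), ‖Γ (σ s)‖ < K :=
    ((hΓ.tendsto.comp hq).norm).eventually_lt_const (by simp [hK])
  -- The radius `1/(16K)` keeps the connection term in `G'` below `‖w‖²/4` and makes `2K|G| ≤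
  -- ‖w‖/2`; the factor 4 of `abs_sum_mul_le` is included.
  have h2 : ∀ᶠ s in 𝓝[>] (0 : ℝ), ‖σ s - q‖ < 1 / (16 * K) := by
    have h3 : Tendsto (fun s => ‖σ s - q‖) (𝓝[>] 0) (𝓝 0) := by
      simpa using (hq.sub_const q).norm
    exact h3.eventually_lt_const (by positivity)
  obtain ⟨δ, hδ, hδε⟩ : ∃ δ > 0, ∀ s ∈ Ioo 0 δ, ‖Γ (σ s)‖ < K ∧ ‖σ s - q‖ < 1 / (16 * K) := by
    obtain ⟨δ, hδ, h⟩ := mem_nhdsGT_iff_exists_Ioo_subset.1 (h1.and h2)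
    exact ⟨δ, hδ, fun s hs => h hs⟩
  set δ' := min δ ε with hδ'
  have hδ'0 : 0 < δ' := lt_min hδ hε
  have hsub : ∀ s ∈ Ioo 0 δ', s ∈ Ioo 0 δ ∧ s ∈ Ioo 0 ε := fun s hs =>
    ⟨⟨hs.1, hs.2.trans_le (min_le_left _ _)⟩, ⟨hs.1, hs.2.trans_le (min_le_right _ _)⟩⟩
  -- The inequality `‖w'‖ ≤ K‖w‖²` alone would allow blow-up. Convergence of `σ` excludes it through
  -- this virial function: `G' ≥ ‖w‖²/2` near `q`, so `2K G'` dominates the derivative of every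
  -- component of `w`.
  set G : ℝ → ℝ := fun s => ∑ j, (σ s j - q j) * w s j with hG
  have hGd : ∀ s ∈ Ioo 0 δ', HasDerivAt G
      (∑ j, (w s j * w s j + (σ s j - q j) * (-Γ (σ s) (w s) (w s)) j)) s := by
    intro s hs
    refine HasDerivAt.fun_sum fun j _ => ?_
    exact ((hasDerivAt_pi.1 (hσ s (hsub s hs).2) j).sub_const (q j)).mul
      (hasDerivAt_pi.1 (hw s (hsub s hs).2) j)
  have hΓw : ∀ s ∈ Ioo 0 δ', ‖Γ (σ s) (w s) (w s)‖ ≤ K * ‖w s‖ ^ 2 := by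
    intro s hs
    refine ((Γ (σ s)).le_opNorm₂ _ _).trans ?_
    rw [mul_assoc, ← sq]
    exact mul_le_mul_of_nonneg_right (hδε s (hsub s hs).1).1.le (sq_nonneg _)
  have hGd' : ∀ s ∈ Ioo 0 δ', K * ‖w s‖ ^ 2 ≤
      2 * K * ∑ j, (w s j * w s j + (σ s j - q j) * (-Γ (σ s) (w s) (w s)) j) := by
    intro s hs
    have e1 := norm_sq_le_sum_sq (w s)
    have e2 := (abs_le.1 (abs_sum_mul_le (σ s - q) (-Γ (σ s) (w s) (w s)))).1
    have e3 : ‖σ s - q‖ * ‖-Γ (σ s) (w s) (w s)‖ ≤ 1 / (16 * K) * (K * ‖w s‖ ^ 2) := by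
      rw [norm_neg]
      exact mul_le_mul (hδε s (hsub s hs).1).2.le (hΓw s hs) (norm_nonneg _) (by positivity)
    have e4 : 1 / (16 * K) * (K * ‖w s‖ ^ 2) = ‖w s‖ ^ 2 / 16 := by field_simp
    rw [e4] at e3
    rw [Finset.sum_add_distrib]
    simp only [Pi.sub_apply] at e2
    simp only [← sq]
    have e5 : ‖w s‖ ^ 2 / 2 ≤ ∑ j, w s j ^ 2 + ∑ j, (σ s j - q j) * (-Γ (σ s) (w s) (w s)) j := by
      nlinarith [sq_nonneg ‖w s‖]
    nlinarith
  set s₀ := δ' / 2 with hs₀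
  have hs₀m : s₀ ∈ Ioo 0 δ' := ⟨by positivity, by rw [hs₀]; linarith⟩
  -- With `c = 1` and `c = -1` this bounds `|w s i|` by data at `s₀` plus `2K|G s| ≤ ‖w s‖/2`, which
  -- is then absorbed on the left.
  have hmono : ∀ i : Fin 4, ∀ c : ℝ, |c| ≤ 1 → ∀ s ∈ Ioo 0 s₀,
      c * w s i + 2 * K * G s ≤ c * w s₀ i + 2 * K * G s₀ := by
    intro i c hc s hs
    have hder : ∀ s ∈ Ioo 0 δ', HasDerivAt (fun s => c * w s i + 2 * K * G s) _ s := fun s hs =>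
      ((hasDerivAt_pi.1 (hw s (hsub s hs).2) i).const_mul c).add ((hGd s hs).const_mul (2 * K))
    have hm : MonotoneOn (fun s => c * w s i + 2 * K * G s) (Ioo 0 δ') := by
      refine monotoneOn_of_deriv_nonneg (convex_Ioo _ _)
        (fun s hs => (hder s hs).continuousAt.continuousWithinAt)
        (fun s hs => (hder s (interior_subset hs)).differentiableAt.differentiableWithinAt) ?_
      intro s hs
      rw [interior_Ioo] at hs
      rw [(hder s hs).deriv]
      have e1 := hGd' s hs
      have e2 : |c * (-Γ (σ s) (w s) (w s)) i| ≤ K * ‖w s‖ ^ 2 := by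
        rw [abs_mul]
        have e3 : |(-Γ (σ s) (w s) (w s)) i| ≤ K * ‖w s‖ ^ 2 := by
          refine (norm_le_pi_norm (-Γ (σ s) (w s) (w s)) i).trans ?_
          rw [norm_neg]
          exact hΓw s hs
        calc |c| * |(-Γ (σ s) (w s) (w s)) i| ≤ 1 * (K * ‖w s‖ ^ 2) :=
              mul_le_mul hc e3 (abs_nonneg _) zero_le_one
          _ = _ := one_mul _
      have e3 := (abs_le.1 e2).1
      linarith
    exact hm ⟨hs.1, hs.2.trans hs₀m.2⟩ hs₀m hs.2.le
  refine ⟨2 * (‖w s₀‖ + 2 * K * |G s₀|), K, s₀, by positivity, hK0.le, hs₀m.1,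
    hs₀m.2.le.trans (min_le_right _ _), fun s hs => ⟨?_, ?_⟩⟩
  swap
  · exact (hδε s (hsub s ⟨hs.1, hs.2.trans hs₀m.2⟩).1).1.le
  have hs' : s ∈ Ioo 0 δ' := ⟨hs.1, hs.2.trans hs₀m.2⟩
  have e1 : |2 * K * G s| ≤ ‖w s‖ / 2 := by
    rw [abs_mul, abs_of_pos (by positivity)]
    have e2 := abs_sum_mul_le (σ s - q) (w s)
    have e3 : ‖σ s - q‖ * ‖w s‖ ≤ 1 / (16 * K) * ‖w s‖ :=
      mul_le_mul_of_nonneg_right (hδε s (hsub s hs').1).2.le (norm_nonneg _)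
    calc 2 * K * |G s| ≤ 2 * K * (4 * (1 / (16 * K) * ‖w s‖)) := by
          refine mul_le_mul_of_nonneg_left ?_ (by positivity)
          exact e2.trans (by linarith)
      _ = ‖w s‖ / 2 := by field_simp; norm_num
  have e2 : ‖w s‖ ≤ ‖w s₀‖ + 2 * K * |G s₀| + ‖w s‖ / 2 := by
    refine (pi_norm_le_iff_of_nonneg (by positivity)).2 fun i => ?_
    rw [Real.norm_eq_abs, abs_le]
    have f1 := hmono i 1 (by simp) s hs
    have f2 := hmono i (-1) (by simp) s hs
    have f3 := abs_le.1 (norm_le_pi_norm (w s₀) i)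
    have f4 := abs_le.1 e1
    have f5 : 2 * K * G s₀ ≤ 2 * K * |G s₀| :=
      mul_le_mul_of_nonneg_left (le_abs_self _) (by positivity)
    constructor <;> linarith [f3.1, f3.2, f4.1, f4.2]
  linarith

/-- A vector parallely propagated with bounded coefficients stays bounded. -/
theorem exists_norm_parallel_le {Γ : Coord → Coord →L[ℝ] Coord →L[ℝ] Coord} {σ w F : ℝ → Coord}
    {B K δ : ℝ} (hB : 0 ≤ B) (hK : 0 ≤ K) (hδ : 0 < δ)
    (hF : ∀ s ∈ Ioo 0 δ, HasDerivAt F (-Γ (σ s) (w s) (F s)) s)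
    (h : ∀ s ∈ Ioo 0 δ, ‖w s‖ ≤ B ∧ ‖Γ (σ s)‖ ≤ K) :
    ∃ C, ∀ᶠ s in 𝓝[>] (0 : ℝ), ‖F s‖ ≤ C := by
  -- Grönwall towards `0`: the sum of squares has derivative at least `-2 · 4 · K B ‖F‖²`, so
  -- multiplication by `exp (c s)` makes it increasing.
  set c := 8 * (K * B) with hc
  have hc0 : 0 ≤ c := by positivity
  set N : ℝ → ℝ := fun s => ∑ j, F s j * F s j with hN
  have hNd : ∀ s ∈ Ioo 0 δ, HasDerivAt (fun s => Real.exp (c * s) * N s)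
      (Real.exp (c * s) * (c * 1) * N s + Real.exp (c * s) *
        ∑ j, ((-Γ (σ s) (w s) (F s)) j * F s j + F s j * (-Γ (σ s) (w s) (F s)) j)) s := by
    intro s hs
    exact (((hasDerivAt_id s).const_mul c).exp).mul (HasDerivAt.fun_sum fun j _ =>
      (hasDerivAt_pi.1 (hF s hs) j).mul (hasDerivAt_pi.1 (hF s hs) j))
  have hm : MonotoneOn (fun s => Real.exp (c * s) * N s) (Ioo 0 δ) := by
    refine monotoneOn_of_deriv_nonneg (convex_Ioo _ _)
      (fun s hs => (hNd s hs).continuousAt.continuousWithinAt)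
      (fun s hs => (hNd s (interior_subset hs)).differentiableAt.differentiableWithinAt) ?_
    intro s hs
    rw [interior_Ioo] at hs
    rw [(hNd s hs).deriv]
    have e1 := abs_sum_mul_le (F s) (-Γ (σ s) (w s) (F s))
    have e2 : ‖-Γ (σ s) (w s) (F s)‖ ≤ K * B * ‖F s‖ := by
      rw [norm_neg]
      refine ((Γ (σ s)).le_opNorm₂ _ _).trans ?_
      have := h s hs
      gcongr
      exacts [this.2, this.1]
    have e3 : ‖F s‖ * ‖-Γ (σ s) (w s) (F s)‖ ≤ ‖F s‖ * (K * B * ‖F s‖) :=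
      mul_le_mul_of_nonneg_left e2 (norm_nonneg _)
    have e4 := norm_sq_le_sum_sq (F s)
    have e5 : ∑ j, ((-Γ (σ s) (w s) (F s)) j * F s j + F s j * (-Γ (σ s) (w s) (F s)) j) =
        2 * ∑ j, F s j * (-Γ (σ s) (w s) (F s)) j := by
      rw [Finset.mul_sum]
      exact Finset.sum_congr rfl fun _ _ => by ring
    have e6 : c * ‖F s‖ ^ 2 ≤ c * N s := by
      refine mul_le_mul_of_nonneg_left ?_ hc0
      simpa only [hN, ← sq] using e4
    have e7 := (abs_le.1 e1).1
    have e8 : 0 ≤ c * N s + 2 * ∑ j, F s j * (-Γ (σ s) (w s) (F s)) j := by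
      rw [hc] at e6 ⊢
      nlinarith
    rw [e5, mul_one]
    have := mul_nonneg (Real.exp_pos (c * s)).le e8
    linarith
  refine ⟨Real.sqrt (Real.exp (c * (δ / 2)) * N (δ / 2)), ?_⟩
  filter_upwards [Ioo_mem_nhdsGT (half_pos hδ)] with s hs
  have h1 := hm ⟨hs.1, hs.2.trans (half_lt_self hδ)⟩ ⟨half_pos hδ, half_lt_self hδ⟩ hs.2.le
  refine Real.le_sqrt_of_sq_le ((norm_sq_le_sum_sq (F s)).trans ?_)
  refine le_trans ?_ h1
  have h2 : 1 ≤ Real.exp (c * s) := Real.one_le_exp (mul_nonneg hc0 hs.1.le)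
  have h3 : 0 ≤ N s := Finset.sum_nonneg fun j _ => mul_self_nonneg _
  simp only [sq]
  nlinarith

/-- A spacetime is not locally extendible along a geodesic along which some component of the
curvature in a parallel tetrad is unbounded. -/
theorem not_isLocallyExtendibleAlong {M : Set Coord} {g : MetricField}
    (hg : IsLorentzMetricOn M g) {γ : ℝ → Coord} {ℓ : ℝ} (hγ : IsGeodesicOn g γ (Ioo 0 ℓ))
    {E : ℝ → Matrix (Fin 4) (Fin 4) ℝ} (hE : IsParallelTetradOn g γ (Ioo 0 ℓ) E)
    {A B C D : Fin 4}
    (h : Tendsto (fun s => |frameComponents (riemann g (γ s)) (E s) A B C D|) (𝓝[>] 0) atTop) :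
    ¬ IsLocallyExtendibleAlong M g γ ℓ := by
  rintro ⟨U, V, g', φ, hU, hUM, hV, hg', hφ, ⟨ε, hε, hεℓ, hγU⟩, q, hqV, hq⟩
  have hgU := hg.mono hUM
  have hγd : ∀ s ∈ Ioo 0 ε, HasDerivAt γ (deriv γ s) s := fun s hs =>
    (hγ s ⟨hs.1, hs.2.trans_le hεℓ⟩).1.hasDerivAt
  have hcon : ∀ (x u v : Coord), (fun i => -∑ j, ∑ k, christoffel g x i j k * u j * v k) =
      -connection g x u v := by
    intro x u v
    funext i
    rw [Pi.neg_apply, connection_apply]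
  have hγdd : ∀ s ∈ Ioo 0 ε,
      HasDerivAt (deriv γ) (-connection g (γ s) (deriv γ s) (deriv γ s)) s := by
    intro s hs
    rw [← hcon]
    exact (hγ s ⟨hs.1, hs.2.trans_le hεℓ⟩).2
  have hEd : ∀ N, ∀ s ∈ Ioo 0 ε, HasDerivAt (fun τ => (E τ).col N)
      (-connection g (γ s) (deriv γ s) ((E s).col N)) s := by
    intro N s hs
    rw [← hcon]
    exact hasDerivAt_pi.2 fun i => (hE s ⟨hs.1, hs.2.trans_le hεℓ⟩).2 i N
  -- The differential of `φ` carries parallel fields to parallel fields: the `D²φ` term from the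
  -- product rule cancels the one in the transformation law. The choice `X = deriv γ` shows that the
  -- image curve is a geodesic.
  have hpush : ∀ X : ℝ → Coord, (∀ s ∈ Ioo 0 ε,
      HasDerivAt X (-connection g (γ s) (deriv γ s) (X s)) s) → ∀ s ∈ Ioo 0 ε,
      HasDerivAt (fun τ => fderiv ℝ φ (γ τ) (X τ))
        (-connection g' (φ (γ s)) (fderiv ℝ φ (γ s) (deriv γ s)) (fderiv ℝ φ (γ s) (X s))) s := by
    intro X hX s hs
    have h1 := ((hφ.hasFDerivAt_fderiv hU (hγU s hs)).comp_hasDerivAt s (hγd s hs)).clm_apply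
      (hX s hs)
    have h2 := hφ.fderiv_connection_eq hU hV hgU hg' (hγU s hs) (deriv γ s) (X s)
    refine h1.congr_deriv ?_
    rw [map_neg, Function.comp_apply, h2]
    abel
  set σ : ℝ → Coord := fun s => φ (γ s) with hσ
  set w : ℝ → Coord := fun s => fderiv ℝ φ (γ s) (deriv γ s) with hw
  have hσd : ∀ s ∈ Ioo 0 ε, HasDerivAt σ (w s) s := fun s hs =>
    (((hφ.contDiffAt hU (hγU s hs)).differentiableAt (by norm_num)).hasFDerivAt).comp_hasDerivAt s
      (hγd s hs)
  have hwd := hpush (deriv γ) hγdd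
  have hΓ : ContinuousAt (connection g') q :=
    ((hg'.contDiffOn_connection hV).contDiffAt (hV.mem_nhds hqV)).continuousAt
  obtain ⟨b, K, δ, hb, hK, hδ, hδε, hbK⟩ := exists_norm_velocity_le hΓ hε hσd hwd hq
  have hF : ∀ N, ∃ C, ∀ᶠ s in 𝓝[>] (0 : ℝ), ‖fderiv ℝ φ (γ s) ((E s).col N)‖ ≤ C := fun N =>
    exists_norm_parallel_le hb hK hδ
      (fun s hs => hpush (fun τ => (E τ).col N) (hEd N) s ⟨hs.1, hs.2.trans_le hδε⟩) hbK
  set E' : ℝ → Matrix (Fin 4) (Fin 4) ℝ :=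
    fun s => Matrix.of fun i N => fderiv ℝ φ (γ s) ((E s).col N) i with hE'
  have hEO : ∀ i N, (fun s => E' s i N) =O[𝓝[>] 0] fun _ => (1 : ℝ) := by
    intro i N
    obtain ⟨c, hc⟩ := hF N
    refine Asymptotics.IsBigO.of_bound c ?_
    filter_upwards [hc] with s hs
    rw [norm_one, mul_one]
    exact (norm_le_pi_norm (fderiv ℝ φ (γ s) ((E s).col N)) i).trans hs
  have hRO : ∀ i j k l, (fun s => riemann g' (σ s) i j k l) =O[𝓝[>] 0] fun _ => (1 : ℝ) := by
    intro i j k l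
    have h1 : ContinuousAt (fun x => riemann g' x i j k l) q :=
      (hg'.continuousOn_riemann hV i j k l).continuousAt (hV.mem_nhds hqV)
    exact (h1.tendsto.comp hq).isBigO_one ℝ
  -- The curvature is continuous at `q` and the image frame is bounded, so every component stays
  -- bounded.
  have hO : (fun s => frameComponents (riemann g' (σ s)) (E' s) A B C D)
      =O[𝓝[>] 0] fun _ => (1 : ℝ) := by
    unfold frameComponents
    refine Asymptotics.IsBigO.fun_sum fun i _ => Asymptotics.IsBigO.fun_sum fun j _ =>
      Asymptotics.IsBigO.fun_sum fun k _ => Asymptotics.IsBigO.fun_sum fun l _ => ?_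
    simpa using ((((hRO i j k l).mul (hEO i A)).mul (hEO j B)).mul (hEO k C)).mul (hEO l D)
  have hev : ∀ᶠ s in 𝓝[>] (0 : ℝ), |frameComponents (riemann g (γ s)) (E s) A B C D| =
      ‖frameComponents (riemann g' (σ s)) (E' s) A B C D‖ := by
    filter_upwards [Ioo_mem_nhdsGT hε] with s hs
    rw [Real.norm_eq_abs, hφ.frameComponents_riemann hU hV hgU hg' (hγU s hs) (E' := E' s)]
    intro N
    rfl
  exact not_isBoundedUnder_of_tendsto_atTop (h.congr' hev) ((Asymptotics.isBigO_one_iff ℝ).1 hO)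

end BoundedTransport

/-! ### Christoffel symbols and curvature of the FLRW metric -/

section FLRWCurvature

open Filter Topology Set

theorem isOpen_flrwDomain {I : Set ℝ} (hI : IsOpen I) : IsOpen (flrwDomain I) :=
  hI.preimage (continuous_apply 0)

theorem flrwMetric_apply (a : ℝ → ℝ) (x : Coord) (i j : Fin 4) :
    flrwMetric a x i j = if i = j then (if i = 0 then -1 else a (x 0) ^ 2) else 0 := by
  fin_cases i <;> fin_cases j <;> simp [flrwMetric]

variable {I : Set ℝ} {a : ℝ → ℝ}

/-- The orthonormal frame of the comoving observers. -/
noncomputable def comovingTetrad (b : ℝ) : Matrix (Fin 4) (Fin 4) ℝ :=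
  Matrix.diagonal ![1, b⁻¹, b⁻¹, b⁻¹]

theorem isTetradAt_comovingTetrad {x : Coord} (hx : a (x 0) ≠ 0) :
    IsTetradAt (flrwMetric a) x (comovingTetrad (a (x 0))) := by
  unfold IsTetradAt comovingTetrad flrwMetric minkowski
  rw [Matrix.diagonal_transpose, Matrix.diagonal_mul_diagonal, Matrix.diagonal_mul_diagonal]
  congr 1
  funext i
  fin_cases i <;> simp <;> field_simp

theorem isLorentzMetricOn_flrw (ha : ContDiffOn ℝ 2 a I)
    (ha_pos : ∀ t ∈ I, 0 < a t) : IsLorentzMetricOn (flrwDomain I) (flrwMetric a) where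
  contDiffOn i j := by
    have h1 : ContDiffOn ℝ 2 (fun x : Coord => a (x 0)) (flrwDomain I) :=
      ha.comp (contDiff_apply ℝ ℝ (0 : Fin 4)).contDiffOn fun x hx => hx
    simp only [flrwMetric_apply]
    split_ifs
    · exact contDiffOn_const
    · exact h1.pow 2
    · exact contDiffOn_const
  symm x _ := Matrix.isSymm_diagonal _
  signature x hx := ⟨_, isTetradAt_comovingTetrad (ha_pos _ hx).ne'⟩

theorem partialDeriv_comp_time {f : ℝ → ℝ} {f' : ℝ} {x : Coord} (hf : HasDerivAt f f' (x 0))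
    (k : Fin 4) : partialDeriv k (fun y => f (y 0)) x = if k = 0 then f' else 0 := by
  have h1 : HasFDerivAt (fun y : Coord => y 0)
      (ContinuousLinearMap.proj (R := ℝ) (φ := fun _ : Fin 4 => ℝ) 0) x :=
    (ContinuousLinearMap.proj (R := ℝ) (φ := fun _ : Fin 4 => ℝ) 0).hasFDerivAt
  have h2 := hf.comp_hasFDerivAt x h1
  rw [partialDeriv, show (fun y : Coord => f (y 0)) = f ∘ fun y : Coord => y 0 from rfl, h2.fderiv]
  simp [Pi.single_apply, eq_comm]

theorem hasDerivAt_scale (hI : IsOpen I) (ha : ContDiffOn ℝ 2 a I) (ha_pos : ∀ t ∈ I, 0 < a t)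
    {t : ℝ} (ht : t ∈ I) : HasDerivAt a (hubble a t * a t) t := by
  have h1 := ((ha.contDiffAt (hI.mem_nhds ht)).differentiableAt (by norm_num)).hasDerivAt
  rwa [hubble, div_mul_cancel₀ _ (ha_pos t ht).ne']

theorem contDiffOn_hubble (hI : IsOpen I) (ha : ContDiffOn ℝ 2 a I) (ha_pos : ∀ t ∈ I, 0 < a t) :
    ContDiffOn ℝ 1 (hubble a) I := by
  unfold hubble
  exact (ha.deriv_of_isOpen hI (by norm_num)).div (ha.of_le (by norm_num))
    fun t ht => (ha_pos t ht).ne'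

theorem hasDerivAt_hubble (hI : IsOpen I) (ha : ContDiffOn ℝ 2 a I) (ha_pos : ∀ t ∈ I, 0 < a t)
    {t : ℝ} (ht : t ∈ I) : HasDerivAt (hubble a) (deriv (hubble a) t) t :=
  (((contDiffOn_hubble hI ha ha_pos).contDiffAt (hI.mem_nhds ht)).differentiableAt
    (by norm_num)).hasDerivAt

theorem hasDerivAt_scale_sq (hI : IsOpen I) (ha : ContDiffOn ℝ 2 a I)
    (ha_pos : ∀ t ∈ I, 0 < a t) {t : ℝ} (ht : t ∈ I) :
    HasDerivAt (fun t => a t ^ 2) (2 * hubble a t * a t ^ 2) t := by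
  refine ((hasDerivAt_scale hI ha ha_pos ht).fun_pow 2).congr_deriv ?_
  ring

theorem christoffel_flrw (hI : IsOpen I) (ha : ContDiffOn ℝ 2 a I) (ha_pos : ∀ t ∈ I, 0 < a t)
    {x : Coord} (hx : x ∈ flrwDomain I) (i j k : Fin 4) :
    christoffel (flrwMetric a) x i j k =
      hubble a (x 0) * a (x 0) ^ 2 * (if i = 0 ∧ j = k ∧ j ≠ 0 then 1 else 0)
      + hubble a (x 0) * (if i ≠ 0 ∧ ((j = 0 ∧ k = i) ∨ (k = 0 ∧ j = i)) then 1 else 0) := by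
  have h0 : a (x 0) ≠ 0 := (ha_pos _ hx).ne'
  have hinv : (flrwMetric a x)⁻¹ =
      Matrix.diagonal ![-1, (a (x 0) ^ 2)⁻¹, (a (x 0) ^ 2)⁻¹, (a (x 0) ^ 2)⁻¹] := by
    apply Matrix.inv_eq_right_inv
    unfold flrwMetric
    rw [Matrix.diagonal_mul_diagonal, ← Matrix.diagonal_one]
    congr 1
    funext i
    fin_cases i <;> simp [h0]
  have hd : ∀ i j k, partialDeriv k (fun y => flrwMetric a y i j) x =
      if i = j ∧ i ≠ 0 ∧ k = 0 then 2 * hubble a (x 0) * a (x 0) ^ 2 else 0 := by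
    intro i j k
    simp only [flrwMetric_apply]
    by_cases hij : i = j
    · subst hij
      by_cases hi : i = 0
      · simp [hi, partialDeriv]
      · simp only [if_true, hi, if_false]
        rw [partialDeriv_comp_time (f := fun t => a t ^ 2) (hasDerivAt_scale_sq hI ha ha_pos hx)]
        simp [hi]
    · simp [hij, partialDeriv]
  simp only [christoffel, hd, hinv, Matrix.diagonal_apply, ite_mul, zero_mul, Finset.sum_ite_eq,
    Finset.mem_univ, if_true]
  fin_cases i <;> fin_cases j <;> fin_cases k <;> simp <;> field_simp

set_option maxHeartbeats 4000000 in
-- This form isolates the part of constant-curvature type, with coefficient `H²`; only the `Ḣ` part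
-- distinguishes a time direction.
theorem riemann_flrw (hI : IsOpen I) (ha : ContDiffOn ℝ 2 a I) (ha_pos : ∀ t ∈ I, 0 < a t)
    {x : Coord} (hx : x ∈ flrwDomain I) (i j k l : Fin 4) :
    riemann (flrwMetric a) x i j k l =
      hubble a (x 0) ^ 2 * (flrwMetric a x i k * flrwMetric a x j l
        - flrwMetric a x i l * flrwMetric a x j k)
      - deriv (hubble a) (x 0) *
        ((if i = 0 then 1 else 0) * (if k = 0 then 1 else 0) * flrwMetric a x j l
        + flrwMetric a x i k * ((if j = 0 then 1 else 0) * (if l = 0 then 1 else 0))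
        - (if i = 0 then 1 else 0) * (if l = 0 then 1 else 0) * flrwMetric a x j k
        - flrwMetric a x i l * ((if j = 0 then 1 else 0) * (if k = 0 then 1 else 0))) := by
  have hd : ∀ i j k l, partialDeriv l (fun y => christoffel (flrwMetric a) y i j k) x =
      if l = 0 then (deriv (hubble a) (x 0) * a (x 0) ^ 2
        + hubble a (x 0) * (2 * hubble a (x 0) * a (x 0) ^ 2))
          * (if i = 0 ∧ j = k ∧ j ≠ 0 then 1 else 0)
        + deriv (hubble a) (x 0) *
          (if i ≠ 0 ∧ ((j = 0 ∧ k = i) ∨ (k = 0 ∧ j = i)) then 1 else 0) else 0 := by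
    intro i j k l
    have h1 := hasDerivAt_hubble hI ha ha_pos hx
    have h2 := ((h1.mul (hasDerivAt_scale_sq hI ha ha_pos hx)).mul_const
      (if i = 0 ∧ j = k ∧ j ≠ 0 then (1 : ℝ) else 0)).add (h1.mul_const
      (if i ≠ 0 ∧ ((j = 0 ∧ k = i) ∨ (k = 0 ∧ j = i)) then (1 : ℝ) else 0))
    rw [← partialDeriv_comp_time h2 l, partialDeriv, partialDeriv]
    congr 1
    -- The closed form of the symbols holds on an open set, so it may be differentiated.
    apply Filter.EventuallyEq.fderiv_eq
    filter_upwards [(isOpen_flrwDomain hI).mem_nhds hx] with y hy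
    exact christoffel_flrw hI ha ha_pos hy i j k
  have hm : ∀ (i : Fin 4) (f : Fin 4 → ℝ), ∑ m, flrwMetric a x i m * f m =
      (if i = 0 then -1 else a (x 0) ^ 2) * f i := by
    intro i f
    simp [flrwMetric_apply]
  unfold riemann
  rw [hm]
  simp only [riemannUp, hd, christoffel_flrw hI ha ha_pos hx, flrwMetric_apply]
  generalize hubble a (x 0) = h, deriv (hubble a) (x 0) = h', a (x 0) ^ 2 = b
  rw [Fin.sum_univ_four]
  fin_cases i <;> fin_cases j <;> fin_cases k <;> fin_cases l <;> simp <;> ring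

end FLRWCurvature

/-! ### Curvature in orthonormal frames and first integrals of null geodesics -/

section FLRWFrames

open Filter Topology Set Matrix

theorem transpose_mul_mul_apply (A E : Matrix (Fin 4) (Fin 4) ℝ) (M P : Fin 4) :
    (E.transpose * A * E) M P = ∑ i, ∑ k, A i k * E i M * E k P := by
  simp only [Matrix.mul_apply, Matrix.transpose_apply, Finset.sum_mul]
  rw [Finset.sum_comm]
  exact Finset.sum_congr rfl fun i _ => Finset.sum_congr rfl fun k _ => by ring

theorem frameComponents_mul (A B E : Matrix (Fin 4) (Fin 4) ℝ) (M N P Q : Fin 4) :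
    frameComponents (fun i j k l => A i k * B j l) E M N P Q =
      (E.transpose * A * E) M P * (E.transpose * B * E) N Q := by
  rw [transpose_mul_mul_apply, transpose_mul_mul_apply, frameComponents, Finset.sum_mul_sum]
  refine Finset.sum_congr rfl fun i _ => Finset.sum_congr rfl fun j _ => ?_
  rw [Finset.sum_mul_sum]
  exact Finset.sum_congr rfl fun k _ => Finset.sum_congr rfl fun l _ => by ring

theorem frameComponents_mul_swap (A B E : Matrix (Fin 4) (Fin 4) ℝ) (M N P Q : Fin 4) :
    frameComponents (fun i j k l => A i l * B j k) E M N P Q =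
      (E.transpose * A * E) M Q * (E.transpose * B * E) N P := by
  rw [transpose_mul_mul_apply, transpose_mul_mul_apply, frameComponents, Finset.sum_mul_sum]
  refine Finset.sum_congr rfl fun i _ => Finset.sum_congr rfl fun j _ => ?_
  rw [Finset.sum_mul_sum, Finset.sum_comm]
  exact Finset.sum_congr rfl fun k _ => Finset.sum_congr rfl fun l _ => by ring

variable {I : Set ℝ} {a : ℝ → ℝ}

/-- Orthonormality replaces every `g` by the Minkowski matrix, so the only trace of the frame is its
time row. -/
theorem frameComponents_riemann_flrw (hI : IsOpen I) (ha : ContDiffOn ℝ 2 a I)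
    (ha_pos : ∀ t ∈ I, 0 < a t) {x : Coord} (hx : x ∈ flrwDomain I)
    {E : Matrix (Fin 4) (Fin 4) ℝ} (hE : IsTetradAt (flrwMetric a) x E) (M N P Q : Fin 4) :
    frameComponents (riemann (flrwMetric a) x) E M N P Q =
      hubble a (x 0) ^ 2 * (minkowski M P * minkowski N Q - minkowski M Q * minkowski N P)
      - deriv (hubble a) (x 0) *
        (E 0 M * E 0 P * minkowski N Q + minkowski M P * (E 0 N * E 0 Q)
        - E 0 M * E 0 Q * minkowski N P - minkowski M Q * (E 0 N * E 0 P)) := by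
  set U : Matrix (Fin 4) (Fin 4) ℝ := Matrix.of fun i k =>
    (if i = 0 then 1 else 0) * (if k = 0 then 1 else 0) with hU
  have hUE : ∀ M P, (E.transpose * U * E) M P = E 0 M * E 0 P := by
    intro M P
    rw [transpose_mul_mul_apply]
    simp [hU]
  have hR : riemann (flrwMetric a) x = fun i j k l =>
      hubble a (x 0) ^ 2 * (flrwMetric a x i k * flrwMetric a x j l
        - flrwMetric a x i l * flrwMetric a x j k)
      - deriv (hubble a) (x 0) * (U i k * flrwMetric a x j l + flrwMetric a x i k * U j l
        - U i l * flrwMetric a x j k - flrwMetric a x i l * U j k) := by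
    funext i j k l
    exact riemann_flrw hI ha ha_pos hx i j k l
  have hlin : ∀ (h h' : ℝ) (T₁ T₂ T₃ T₄ T₅ T₆ : Fin 4 → Fin 4 → Fin 4 → Fin 4 → ℝ),
      frameComponents (fun i j k l => h * (T₁ i j k l - T₂ i j k l)
        - h' * (T₃ i j k l + T₄ i j k l - T₅ i j k l - T₆ i j k l)) E M N P Q =
      h * (frameComponents T₁ E M N P Q - frameComponents T₂ E M N P Q)
      - h' * (frameComponents T₃ E M N P Q + frameComponents T₄ E M N P Q
        - frameComponents T₅ E M N P Q - frameComponents T₆ E M N P Q) := by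
    intro h h' T₁ T₂ T₃ T₄ T₅ T₆
    simp only [frameComponents, Finset.mul_sum, ← Finset.sum_sub_distrib,
      ← Finset.sum_add_distrib]
    exact Finset.sum_congr rfl fun i _ => Finset.sum_congr rfl fun j _ =>
      Finset.sum_congr rfl fun k _ => Finset.sum_congr rfl fun l _ => by ring
  unfold IsTetradAt at hE
  rw [hR, hlin, frameComponents_mul, frameComponents_mul_swap, frameComponents_mul,
    frameComponents_mul, frameComponents_mul_swap, frameComponents_mul_swap, hE]
  simp only [hUE]

theorem neg_sum_christoffel_flrw (hI : IsOpen I) (ha : ContDiffOn ℝ 2 a I)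
    (ha_pos : ∀ t ∈ I, 0 < a t) {x : Coord} (hx : x ∈ flrwDomain I) (u v : Coord) (i : Fin 4) :
    -∑ j, ∑ k, christoffel (flrwMetric a) x i j k * u j * v k =
      if i = 0 then -(hubble a (x 0) * a (x 0) ^ 2 * (u 1 * v 1 + u 2 * v 2 + u 3 * v 3))
      else -(hubble a (x 0) * (u 0 * v i + u i * v 0)) := by
  simp only [christoffel_flrw hI ha ha_pos hx, Fin.sum_univ_four]
  fin_cases i <;> simp <;> ring

/-- Orthonormality of the columns turns into a relation between rows, `E η Eᵀ = g⁻¹`; this is its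
time-time entry. -/
theorem tetrad_time_row {x : Coord} {E : Matrix (Fin 4) (Fin 4) ℝ}
    (hE : IsTetradAt (flrwMetric a) x E) :
    E 0 0 ^ 2 = 1 + E 0 1 ^ 2 + E 0 2 ^ 2 + E 0 3 ^ 2 := by
  have hmm : minkowski * minkowski = 1 := by
    rw [minkowski, Matrix.diagonal_mul_diagonal, ← Matrix.diagonal_one]
    congr 1
    funext i
    fin_cases i <;> simp
  unfold IsTetradAt at hE
  have h1 : minkowski * E.transpose * flrwMetric a x * E = 1 := by
    rw [mul_assoc, mul_assoc, ← mul_assoc E.transpose, hE, hmm]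
  have h2 := mul_eq_one_comm.1 h1
  have h3 := congrFun (congrFun h2 0) 0
  rw [← mul_assoc, flrwMetric, Matrix.mul_diagonal, ← mul_assoc, Matrix.mul_apply] at h3
  simp [minkowski, Matrix.mul_diagonal, Fin.sum_univ_four] at h3
  linarith

/-- The first integrals of a null geodesic that runs into the past null boundary. -/
theorem IsBoundaryNullGeodesic.exists_velocity (hI : IsOpen I) (ha : ContDiffOn ℝ 2 a I)
    (ha_pos : ∀ t ∈ I, 0 < a t) {γ : ℝ → Coord} {ℓ : ℝ} (h : IsBoundaryNullGeodesic I a γ ℓ) :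
    ∃ (κ : ℝ) (n : Coord), 0 < κ ∧ n 1 ^ 2 + n 2 ^ 2 + n 3 ^ 2 = 1 ∧ ∀ s ∈ Ioo 0 ℓ,
      ∀ i, deriv γ s i = if i = 0 then κ / a (γ s 0) else κ * n i / a (γ s 0) ^ 2 := by
  have hI' : ∀ s ∈ Ioo 0 ℓ, γ s 0 ∈ I := fun s hs => h.mapsTo hs
  have hpos : ∀ s ∈ Ioo 0 ℓ, 0 < a (γ s 0) := fun s hs => ha_pos _ (hI' s hs)
  have hγ : ∀ s ∈ Ioo 0 ℓ, ∀ i, HasDerivAt (fun τ => γ τ i) (deriv γ s i) s := fun s hs i =>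
    hasDerivAt_pi.1 (h.geodesic s hs).1.hasDerivAt i
  have hγ' : ∀ s ∈ Ioo 0 ℓ, ∀ i, HasDerivAt (fun τ => deriv γ τ i) _ s := fun s hs i =>
    (hasDerivAt_pi.1 (h.geodesic s hs).2 i).congr_deriv
      (neg_sum_christoffel_flrw hI ha ha_pos (h.mapsTo hs) _ _ i)
  have hA : ∀ s ∈ Ioo 0 ℓ, HasDerivAt (fun τ => a (γ τ 0))
      (hubble a (γ s 0) * a (γ s 0) * deriv γ s 0) s := fun s hs =>
    (hasDerivAt_scale hI ha ha_pos (hI' s hs)).comp s (hγ s hs 0)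
  have hnull : ∀ s ∈ Ioo 0 ℓ, deriv γ s 0 ^ 2 =
      a (γ s 0) ^ 2 * (deriv γ s 1 ^ 2 + deriv γ s 2 ^ 2 + deriv γ s 3 ^ 2) := by
    intro s hs
    have h1 := h.null s hs
    simp [flrwMetric_apply, Fin.sum_univ_four] at h1
    linarith
  have hconst : ∀ f : ℝ → ℝ, (∀ s ∈ Ioo 0 ℓ, HasDerivAt f 0 s) →
      ∀ s ∈ Ioo 0 ℓ, f s = f (ℓ / 2) := by
    intro f hf s hs
    exact isOpen_Ioo.is_const_of_deriv_eq_zero isPreconnected_Ioo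
      (fun s hs => (hf s hs).differentiableAt.differentiableWithinAt)
      (fun s hs => (hf s hs).deriv) hs ⟨half_pos h.pos, half_lt_self h.pos⟩
  set m := ℓ / 2 with hm
  have hmm : m ∈ Ioo 0 ℓ := ⟨half_pos h.pos, half_lt_self h.pos⟩
  -- Conservation of `a t'` uses the null condition; that of `a² xⁱ'` below comes from translation
  -- invariance alone.
  have h0 : ∀ s ∈ Ioo 0 ℓ, a (γ s 0) * deriv γ s 0 = a (γ m 0) * deriv γ m 0 := by
    refine hconst (fun s => a (γ s 0) * deriv γ s 0) fun s hs => ?_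
    refine ((hA s hs).mul (hγ' s hs 0)).congr_deriv ?_
    rw [if_pos rfl]
    have := hnull s hs
    linear_combination (hubble a (γ s 0) * a (γ s 0)) * this
  have hi : ∀ i ≠ 0, ∀ s ∈ Ioo 0 ℓ,
      a (γ s 0) ^ 2 * deriv γ s i = a (γ m 0) ^ 2 * deriv γ m i := by
    intro i hi
    refine hconst (fun s => a (γ s 0) ^ 2 * deriv γ s i) fun s hs => ?_
    refine (((hA s hs).fun_pow 2).mul (hγ' s hs i)).congr_deriv ?_
    rw [if_neg hi]
    ring
  set κ := a (γ m 0) * deriv γ m 0 with hκ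
  have hκ0 : κ ≠ 0 := by
    intro h1
    have h2 : deriv γ m 0 = 0 := by
      rcases mul_eq_zero.1 h1 with h3 | h3
      · exact absurd h3 (hpos m hmm).ne'
      · exact h3
    have h3 := hnull m hmm
    rw [h2] at h3
    have h4 : deriv γ m 1 ^ 2 + deriv γ m 2 ^ 2 + deriv γ m 3 ^ 2 = 0 := by
      have := pow_pos (hpos m hmm) 2
      rcases mul_eq_zero.1 (h3.symm.trans (by norm_num)) with h5 | h5
      · exact absurd h5 this.ne'
      · exact h5
    refine h.velocity_ne_zero m hmm (funext fun i => ?_)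
    have e1 := sq_nonneg (deriv γ m 1)
    have e2 := sq_nonneg (deriv γ m 2)
    have e3 := sq_nonneg (deriv γ m 3)
    fin_cases i
    · exact h2
    · exact pow_eq_zero_iff two_ne_zero |>.1 (by simp only [Fin.mk_one]; linarith)
    · exact pow_eq_zero_iff two_ne_zero |>.1 (by simp only [Fin.reduceFinMk]; linarith)
    · exact pow_eq_zero_iff two_ne_zero |>.1 (by simp only [Fin.reduceFinMk]; linarith)
  have ht' : ∀ s ∈ Ioo 0 ℓ, deriv γ s 0 = κ / a (γ s 0) := by
    intro s hs
    rw [eq_div_iff (hpos s hs).ne', ← h0 s hs, mul_comm]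
  -- If `κ` were negative, `t` would decrease along the parameter and could not tend to `-∞` at the
  -- lower end.
  have hκpos : 0 < κ := by
    by_contra hneg
    have hneg' : κ < 0 := lt_of_le_of_ne (not_lt.1 hneg) hκ0
    have hanti : AntitoneOn (fun s => γ s 0) (Ioo 0 ℓ) := by
      refine antitoneOn_of_deriv_nonpos (convex_Ioo _ _)
        (fun s hs => (hγ s hs 0).continuousAt.continuousWithinAt)
        (fun s hs => (hγ s (interior_subset hs) 0).differentiableAt.differentiableWithinAt) ?_
      intro s hs
      rw [interior_Ioo] at hs
      rw [(hγ s hs 0).deriv, ht' s hs]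
      exact (div_neg_of_neg_of_pos hneg' (hpos s hs)).le
    have h1 := h.tendsto.eventually (eventually_lt_atBot (γ m 0))
    obtain ⟨s, hs1, hs2⟩ := (h1.and (Ioo_mem_nhdsGT hmm.1)).exists
    exact absurd (hanti ⟨hs2.1, hs2.2.trans hmm.2⟩ hmm hs2.2.le) (not_le.2 hs1)
  refine ⟨κ, fun i => a (γ m 0) ^ 2 * deriv γ m i / κ, hκpos, ?_, fun s hs i => ?_⟩
  · have h1 := hnull m hmm
    have h2 : κ ^ 2 = a (γ m 0) ^ 2 * deriv γ m 0 ^ 2 := by rw [hκ]; ring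
    rw [h1] at h2
    simp only [div_pow]
    rw [← add_div, ← add_div, div_eq_one_iff_eq (pow_ne_zero 2 hκ0), h2]
    ring
  · split_ifs with h1
    · rw [h1, ht' s hs]
    · rw [mul_div_cancel₀ _ hκ0, ← hi i h1 s hs, mul_div_cancel_left₀]
      exact pow_ne_zero 2 (hpos s hs).ne'

end FLRWFrames

/-! ### Parallel tetrads along null geodesics -/

section ParallelTetrads

open Filter Topology Set Matrix

variable {I : Set ℝ} {a : ℝ → ℝ} {γ : ℝ → Coord} {ℓ κ : ℝ} {n : Coord}

/-- The time components of a parallel tetrad along a null geodesic grow like `1 / a`. -/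
theorem exists_parallel_time_row (hI : IsOpen I) (ha : ContDiffOn ℝ 2 a I)
    (ha_pos : ∀ t ∈ I, 0 < a t) (h : IsBoundaryNullGeodesic I a γ ℓ)
    (hn : n 1 ^ 2 + n 2 ^ 2 + n 3 ^ 2 = 1)
    (hvel : ∀ s ∈ Ioo 0 ℓ, ∀ i,
      deriv γ s i = if i = 0 then κ / a (γ s 0) else κ * n i / a (γ s 0) ^ 2)
    {E : ℝ → Matrix (Fin 4) (Fin 4) ℝ}
    (hE : IsParallelTetradOn (flrwMetric a) γ (Ioo 0 ℓ) E) (M : Fin 4) :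
    ∃ C m : ℝ, ∀ s ∈ Ioo 0 ℓ, a (γ s 0) * E s 0 M = C - m * a (γ s 0) ^ 2 := by
  have hI' : ∀ s ∈ Ioo 0 ℓ, γ s 0 ∈ I := fun s hs => h.mapsTo hs
  have hne : ∀ s ∈ Ioo 0 ℓ, a (γ s 0) ≠ 0 := fun s hs => (ha_pos _ (hI' s hs)).ne'
  have hA : ∀ s ∈ Ioo 0 ℓ, HasDerivAt (fun τ => a (γ τ 0)) (hubble a (γ s 0) * κ) s := by
    intro s hs
    have h1 := (hasDerivAt_scale hI ha ha_pos (hI' s hs)).comp s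
      (hasDerivAt_pi.1 (h.geodesic s hs).1.hasDerivAt 0)
    refine h1.congr_deriv ?_
    rw [hvel s hs, if_pos rfl]
    field_simp [hne s hs]
  have hEd : ∀ s ∈ Ioo 0 ℓ, ∀ i, HasDerivAt (fun τ => E τ i M) _ s := fun s hs i =>
    ((hE s hs).2 i M).congr_deriv
      (neg_sum_christoffel_flrw hI ha ha_pos (h.mapsTo hs) (deriv γ s) (fun k => E s k M) i)
  have hconst : ∀ f : ℝ → ℝ, (∀ s ∈ Ioo 0 ℓ, HasDerivAt f 0 s) →
      ∀ s ∈ Ioo 0 ℓ, f s = f (ℓ / 2) := by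
    intro f hf s hs
    exact isOpen_Ioo.is_const_of_deriv_eq_zero isPreconnected_Ioo
      (fun s hs => (hf s hs).differentiableAt.differentiableWithinAt)
      (fun s hs => (hf s hs).deriv) hs ⟨half_pos h.pos, half_lt_self h.pos⟩
  set S : ℝ → ℝ := fun s => n 1 * E s 1 M + n 2 * E s 2 M + n 3 * E s 3 M with hS
  have hp : ∀ s ∈ Ioo 0 ℓ,
      HasDerivAt (fun τ => E τ 0 M) (-(hubble a (γ s 0) * κ * S s)) s := by
    intro s hs
    refine (hEd s hs 0).congr_deriv ?_
    rw [if_pos rfl, hvel s hs, hvel s hs, hvel s hs]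
    have := hne s hs
    simp [hS]
    field_simp
  have hSd : ∀ s ∈ Ioo 0 ℓ, HasDerivAt S
      (-(hubble a (γ s 0) * κ * (S s / a (γ s 0) + E s 0 M / a (γ s 0) ^ 2))) s := by
    intro s hs
    refine ((((hEd s hs 1).const_mul (n 1)).add ((hEd s hs 2).const_mul (n 2))).add
      ((hEd s hs 3).const_mul (n 3))).congr_deriv ?_
    have := hne s hs
    rw [hvel s hs, hvel s hs, hvel s hs, hvel s hs]
    simp [hS]
    field_simp
    linear_combination -E s 0 M * hubble a (γ s 0) * κ * hn
  -- Up to the factor `κ`, this is the inner product of the frame vector with the tangent, which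
  -- parallel transport preserves.
  have hm := hconst (fun s => S s - E s 0 M / a (γ s 0)) fun s hs => by
    refine ((hSd s hs).sub ((hp s hs).div (hA s hs) (hne s hs))).congr_deriv ?_
    have := hne s hs
    field_simp
    ring
  set m := S (ℓ / 2) - E (ℓ / 2) 0 M / a (γ (ℓ / 2) 0) with hmdef
  -- Given the constant `m`, the derivative of `a E⁰` is `-Hκ a m`, while that of `a²` is `2Hκ a`;
  -- hence the coefficient `m / 2`.
  have hC := hconst (fun s => a (γ s 0) * E s 0 M + m / 2 * a (γ s 0) ^ 2) fun s hs => by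
    refine (((hA s hs).mul (hp s hs)).add (((hA s hs).fun_pow 2).const_mul (m / 2))).congr_deriv ?_
    have := hne s hs
    rw [← hm s hs]
    field_simp
    ring
  refine ⟨a (γ (ℓ / 2) 0) * E (ℓ / 2) 0 M + m / 2 * a (γ (ℓ / 2) 0) ^ 2, m / 2, fun s hs => ?_⟩
  rw [← hC s hs]
  ring

/-- The rescaled time components of a parallel tetrad converge to a nonzero null covector. -/
theorem exists_parallel_time_row_limit (hI : IsOpen I) (ha : ContDiffOn ℝ 2 a I)
    (ha_pos : ∀ t ∈ I, 0 < a t) (ha0 : Tendsto a atBot (𝓝 0))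
    (h : IsBoundaryNullGeodesic I a γ ℓ) {E : ℝ → Matrix (Fin 4) (Fin 4) ℝ}
    (hE : IsParallelTetradOn (flrwMetric a) γ (Ioo 0 ℓ) E) :
    ∃ C : Fin 4 → ℝ, (∀ M, Tendsto (fun s => a (γ s 0) * E s 0 M) (𝓝[>] 0) (𝓝 (C M))) ∧
      C 0 ^ 2 = C 1 ^ 2 + C 2 ^ 2 + C 3 ^ 2 ∧ C 0 ≠ 0 := by
  obtain ⟨κ, n, -, hn, hvel⟩ := h.exists_velocity hI ha ha_pos
  choose C m hCm using exists_parallel_time_row hI ha ha_pos h hn hvel hE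
  have hA : Tendsto (fun s => a (γ s 0)) (𝓝[>] 0) (𝓝 0) := ha0.comp h.tendsto
  have hev : ∀ᶠ s in 𝓝[>] (0 : ℝ), s ∈ Ioo 0 ℓ := Ioo_mem_nhdsGT h.pos
  have hlim : ∀ M, Tendsto (fun s => a (γ s 0) * E s 0 M) (𝓝[>] 0) (𝓝 (C M)) := by
    intro M
    have h1 : Tendsto (fun s => C M - m M * a (γ s 0) ^ 2) (𝓝[>] 0) (𝓝 (C M - m M * 0 ^ 2)) :=
      ((hA.pow 2).const_mul _).const_sub _
    rw [zero_pow two_ne_zero, mul_zero, sub_zero] at h1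
    exact h1.congr' (by filter_upwards [hev] with s hs using (hCm M s hs).symm)
  -- After rescaling by `a²` the inhomogeneous `1` in the normalization becomes `a² → 0`, so the
  -- limit is null.
  have hrow : ∀ᶠ s in 𝓝[>] (0 : ℝ), (a (γ s 0) * E s 0 0) ^ 2 = a (γ s 0) ^ 2
      + (a (γ s 0) * E s 0 1) ^ 2 + (a (γ s 0) * E s 0 2) ^ 2 + (a (γ s 0) * E s 0 3) ^ 2 := by
    filter_upwards [hev] with s hs
    have h1 := tetrad_time_row (hE s hs).1
    linear_combination a (γ s 0) ^ 2 * h1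
  have hnull : C 0 ^ 2 = C 1 ^ 2 + C 2 ^ 2 + C 3 ^ 2 := by
    have h1 := ((((hA.pow 2).add ((hlim 1).pow 2)).add ((hlim 2).pow 2)).add ((hlim 3).pow 2))
    have h2 := tendsto_nhds_unique ((hlim 0).pow 2) (h1.congr' (hrow.mono fun s hs => hs.symm))
    linarith
  refine ⟨C, hlim, hnull, fun h0 => ?_⟩
  have hz : ∀ M, C M = 0 := by
    rw [h0] at hnull
    have e1 := sq_nonneg (C 1)
    have e2 := sq_nonneg (C 2)
    have e3 := sq_nonneg (C 3)
    intro M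
    fin_cases M
    · exact h0
    · exact pow_eq_zero_iff two_ne_zero |>.1 (by simp only [Fin.mk_one]; linarith)
    · exact pow_eq_zero_iff two_ne_zero |>.1 (by simp only [Fin.reduceFinMk]; linarith)
    · exact pow_eq_zero_iff two_ne_zero |>.1 (by simp only [Fin.reduceFinMk]; linarith)
  -- If `C` vanished, the whole time row would equal `-m a → 0`, against its Lorentzian
  -- normalization.
  have hE0 : ∀ M, Tendsto (fun s => E s 0 M) (𝓝[>] 0) (𝓝 0) := by
    intro M
    have h1 : Tendsto (fun s => -m M * a (γ s 0)) (𝓝[>] 0) (𝓝 0) := by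
      simpa using hA.const_mul (-m M)
    refine h1.congr' ?_
    filter_upwards [hev] with s hs
    have h2 := hCm M s hs
    have h3 : a (γ s 0) ≠ 0 := (ha_pos _ (h.mapsTo hs)).ne'
    rw [hz M] at h2
    apply mul_left_cancel₀ h3
    rw [h2]
    ring
  have h1 := (((((hE0 0).pow 2).sub ((hE0 1).pow 2)).sub ((hE0 2).pow 2)).sub ((hE0 3).pow 2))
  have h2 : Tendsto (fun _ : ℝ => (1 : ℝ)) (𝓝[>] (0 : ℝ)) (𝓝 (0 ^ 2 - 0 ^ 2 - 0 ^ 2 - 0 ^ 2)) := by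
    refine h1.congr' ?_
    filter_upwards [hev] with s hs
    have := tetrad_time_row (hE s hs).1
    linarith
  have h3 := tendsto_nhds_unique h2 tendsto_const_nhds
  norm_num at h3

/-- An orthonormal frame at scale `b`, adapted to the null direction `n`. -/
noncomputable def nullTetrad (n : Coord) (b : ℝ) : Matrix (Fin 4) (Fin 4) ℝ :=
  Matrix.of fun i M =>
    if i = 0 then (if M = 0 then (b + b⁻¹) / 2 else n M * (b⁻¹ - b) / 2)
    else if M = 0 then n i * (b⁻¹ ^ 2 - 1) / 2
    else (if i = M then b⁻¹ else 0) + n i * n M * ((b⁻¹ ^ 2 + 1) / 2 - b⁻¹)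

/-- `nullTetrad` is the comoving frame boosted along `n` with rapidity `-log b`: here `(b⁻¹ + b)/2`
and `(b⁻¹ - b)/2` are its hyperbolic cosine and sine. -/
theorem isTetradAt_nullTetrad (hn : n 1 ^ 2 + n 2 ^ 2 + n 3 ^ 2 = 1) {x : Coord}
    (hx : a (x 0) ≠ 0) : IsTetradAt (flrwMetric a) x (nullTetrad n (a (x 0))) := by
  unfold IsTetradAt
  ext M P
  rw [transpose_mul_mul_apply]
  have hb : a (x 0) * (a (x 0))⁻¹ = 1 := mul_inv_cancel₀ hx
  simp only [flrwMetric_apply, nullTetrad, Matrix.of_apply]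
  generalize a (x 0) = b at *
  -- With `c` known only through `b * c = 1`, the entries are polynomial identities modulo this
  -- relation and the one for `n`.
  generalize b⁻¹ = c at *
  fin_cases M <;> fin_cases P <;> simp [Fin.sum_univ_four, minkowski] <;> grind

/-- A parallel tetrad along a null geodesic that runs into the past null boundary. -/
theorem isParallelTetradOn_nullTetrad (hI : IsOpen I) (ha : ContDiffOn ℝ 2 a I)
    (ha_pos : ∀ t ∈ I, 0 < a t) (h : IsBoundaryNullGeodesic I a γ ℓ)
    (hn : n 1 ^ 2 + n 2 ^ 2 + n 3 ^ 2 = 1)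
    (hvel : ∀ s ∈ Ioo 0 ℓ, ∀ i,
      deriv γ s i = if i = 0 then κ / a (γ s 0) else κ * n i / a (γ s 0) ^ 2) :
    IsParallelTetradOn (flrwMetric a) γ (Ioo 0 ℓ) fun s => nullTetrad n (a (γ s 0)) := by
  intro s hs
  have hne : a (γ s 0) ≠ 0 := (ha_pos _ (h.mapsTo hs)).ne'
  refine ⟨isTetradAt_nullTetrad hn hne, fun i M => ?_⟩
  have hA : HasDerivAt (fun τ => a (γ τ 0)) (hubble a (γ s 0) * κ) s := by
    have h1 := (hasDerivAt_scale hI ha ha_pos (h.mapsTo hs)).comp s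
      (hasDerivAt_pi.1 (h.geodesic s hs).1.hasDerivAt 0)
    refine h1.congr_deriv ?_
    rw [hvel s hs, if_pos rfl]
    field_simp
  have hAi := hA.fun_inv hne
  rw [neg_sum_christoffel_flrw hI ha ha_pos (h.mapsTo hs) (deriv γ s)
    (fun k => nullTetrad n (a (γ s 0)) k M)]
  simp only [hvel s hs, nullTetrad, Matrix.of_apply]
  by_cases hi : i = 0
  · subst hi
    by_cases hM : M = 0
    · subst hM
      simp only [if_true]
      refine ((hA.add hAi).div_const 2).congr_deriv ?_
      simp
      field_simp
      linear_combination (hubble a (γ s 0) * κ * (1 - a (γ s 0) ^ 2)) * hn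
    · simp only [if_true, hM, if_false]
      refine (((hAi.sub hA).const_mul (n M)).div_const 2).congr_deriv ?_
      fin_cases M <;> simp at hM ⊢ <;> field_simp <;> grind
  · by_cases hM : M = 0
    · subst hM
      simp only [if_true, hi, if_false]
      refine ((((hAi.fun_pow 2).sub_const 1).const_mul (n i)).div_const 2).congr_deriv ?_
      rw [show 2 - 1 = 1 from rfl, pow_one]
      push_cast
      field_simp
      ring
    · simp only [if_true, hi, hM, if_false]
      refine ((hAi.mul_const (if i = M then (1 : ℝ) else 0)).add
        (((((hAi.fun_pow 2).add_const 1).div_const 2).sub hAi).const_mul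
          (n i * n M))).congr_deriv ?_ |>.congr_of_eventuallyEq ?_
      · rw [show 2 - 1 = 1 from rfl, pow_one]
        push_cast
        split_ifs <;> field_simp <;> ring
      · refine Eventually.of_forall fun τ => ?_
        simp

end ParallelTetrads

/-! ### Asymptotics of the scale factor, affine parameter and conformal time -/

open Filter Topology Set MeasureTheory in
/-- A scale factor of class `C²` that is asymptotic to `abar * exp (HΛ * t)` in the past. -/
structure IsPastDeSitter (I : Set ℝ) (a : ℝ → ℝ) (abar HΛ : ℝ) : Prop where
  isOpen : IsOpen I
  isLowerSet : IsLowerSet I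
  nonempty : I.Nonempty
  contDiffOn : ContDiffOn ℝ 2 a I
  pos : ∀ t ∈ I, 0 < a t
  abar_pos : 0 < abar
  H_pos : 0 < HΛ
  isEquivalent : Asymptotics.IsEquivalent atBot a (fun t => abar * Real.exp (HΛ * t))

/-- The time as a function of the affine parameter. -/
noncomputable def timeOfAffineParam (I : Set ℝ) (a : ℝ → ℝ) : ℝ → ℝ :=
  Function.invFunOn (affineParam a) I

namespace IsPastDeSitter

open Filter Topology Set MeasureTheory

variable {I : Set ℝ} {a : ℝ → ℝ} {abar HΛ : ℝ} (h : IsPastDeSitter I a abar HΛ)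
include h

theorem Iic_subset {t : ℝ} (ht : t ∈ I) : Iic t ⊆ I := fun _ hs => h.isLowerSet hs ht

theorem eventually_mem : ∀ᶠ t in atBot, t ∈ I := by
  obtain ⟨t, ht⟩ := h.nonempty
  filter_upwards [eventually_le_atBot t] with s hs using h.isLowerSet hs ht

theorem convex : Convex ℝ I := (h.isLowerSet.ordConnected).convex

theorem uIcc_subset {s t : ℝ} (hs : s ∈ I) (ht : t ∈ I) : uIcc s t ⊆ I :=
  h.isLowerSet.ordConnected.uIcc_subset hs ht

theorem continuousOn : ContinuousOn a I := h.contDiffOn.continuousOn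

theorem tendsto_scale : Tendsto a atBot (𝓝 0) := by
  rw [h.isEquivalent.tendsto_nhds_iff]
  have h1 : Tendsto (fun t => HΛ * t) atBot atBot := tendsto_id.const_mul_atBot h.H_pos
  simpa using (Real.tendsto_exp_atBot.comp h1).const_mul abar

theorem isBigO_exp : a =O[atBot] fun t => Real.exp (HΛ * t) :=
  h.isEquivalent.isBigO.trans (Asymptotics.isBigO_const_mul_self _ _ _)

/-- Exponential decay of `a` provides the integrability; this serves both `λ` and the convergence of
`η + 1/(Ha)`. -/
theorem integrableOn_of_isBigO {f : ℝ → ℝ} (hf : f =O[atBot] a) {t : ℝ}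
    (hc : ContinuousOn f (Iic t)) : IntegrableOn f (Iic t) := by
  have h1 : LocallyIntegrableOn f (Iic t) := hc.locallyIntegrableOn measurableSet_Iic
  exact h1.integrableOn_of_isBigO_atBot (hf.trans h.isBigO_exp)
    ⟨Iic 0, Iic_mem_atBot 0, integrableOn_exp_mul_Iic h.H_pos 0⟩

theorem integrableOn_Iic {t : ℝ} (ht : t ∈ I) : IntegrableOn a (Iic t) :=
  h.integrableOn_of_isBigO (Asymptotics.isBigO_refl _ _) (h.continuousOn.mono (h.Iic_subset ht))

theorem affineParam_eq {s t : ℝ} (hs : s ∈ I) (ht : t ∈ I) :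
    affineParam a t = affineParam a s + ∫ τ in s..t, a τ := by
  rw [affineParam, affineParam,
    ← intervalIntegral.integral_Iic_sub_Iic (h.integrableOn_Iic hs) (h.integrableOn_Iic ht)]
  ring

theorem hasDerivAt_integral {f : ℝ → ℝ} (hf : ContinuousOn f I) {s t : ℝ} (hs : s ∈ I)
    (ht : t ∈ I) : HasDerivAt (fun u => ∫ τ in s..u, f τ) (f t) t :=
  intervalIntegral.integral_hasDerivAt_right
    (hf.mono (h.uIcc_subset hs ht)).intervalIntegrable
    (hf.stronglyMeasurableAtFilter h.isOpen t ht) (hf.continuousAt (h.isOpen.mem_nhds ht))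

theorem hasDerivAt_affineParam {t : ℝ} (ht : t ∈ I) : HasDerivAt (affineParam a) (a t) t := by
  refine ((h.hasDerivAt_integral h.continuousOn ht ht).const_add
    (affineParam a t)).congr_of_eventuallyEq ?_
  filter_upwards [h.isOpen.mem_nhds ht] with s hs using h.affineParam_eq ht hs

theorem continuousOn_inv : ContinuousOn (fun t => (a t)⁻¹) I :=
  h.continuousOn.inv₀ fun t ht => (h.pos t ht).ne'

theorem hasDerivAt_conformalTime {t₀ t : ℝ} (ht₀ : t₀ ∈ I) (ht : t ∈ I) :
    HasDerivAt (conformalTime a t₀) (a t)⁻¹ t :=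
  h.hasDerivAt_integral h.continuousOn_inv ht₀ ht

theorem tendsto_affineParam : Tendsto (affineParam a) atBot (𝓝 0) := by
  obtain ⟨t, ht⟩ := h.nonempty
  have h1 := intervalIntegral_tendsto_integral_Iic t (h.integrableOn_Iic ht) tendsto_id
  have h2 := h1.const_sub (affineParam a t)
  rw [affineParam, sub_self] at h2
  refine h2.congr' ?_
  filter_upwards [h.eventually_mem] with s hs
  have := h.affineParam_eq hs ht
  rw [affineParam] at this
  rw [this]
  simp

theorem strictMonoOn_affineParam : StrictMonoOn (affineParam a) I := by
  refine strictMonoOn_of_deriv_pos h.convex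
    (fun t ht => (h.hasDerivAt_affineParam ht).continuousAt.continuousWithinAt) fun t ht => ?_
  rw [(h.hasDerivAt_affineParam (interior_subset ht)).deriv]
  exact h.pos t (interior_subset ht)

theorem affineParam_pos {t : ℝ} (ht : t ∈ I) : 0 < affineParam a t := by
  have h1 : t - 1 ∈ I := h.isLowerSet (by linarith) ht
  have h2 : 0 ≤ affineParam a (t - 1) := by
    refine le_of_tendsto h.tendsto_affineParam ?_
    filter_upwards [eventually_le_atBot (t - 1)] with s hs
    exact h.strictMonoOn_affineParam.monotoneOn (h.isLowerSet hs h1) h1 hs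
  exact h2.trans_lt (h.strictMonoOn_affineParam h1 ht (by linarith))

/-- Integration gains one derivative over `a`; thus `λ` and `η` reach the class `C³` required of an
isometric embedding. -/
theorem contDiffOn_of_hasDerivAt {f g : ℝ → ℝ} (hf : ∀ t ∈ I, HasDerivAt f (g t) t)
    (hg : ContDiffOn ℝ 2 g I) : ContDiffOn ℝ 3 f I := by
  rw [show (3 : WithTop ℕ∞) = 2 + 1 by norm_num, contDiffOn_succ_iff_deriv_of_isOpen h.isOpen]
  refine ⟨fun t ht => (hf t ht).differentiableAt.differentiableWithinAt, by simp, ?_⟩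
  exact hg.congr fun t ht => (hf t ht).deriv

theorem contDiffOn_affineParam : ContDiffOn ℝ 3 (affineParam a) I :=
  h.contDiffOn_of_hasDerivAt (fun _ ht => h.hasDerivAt_affineParam ht) h.contDiffOn

theorem contDiffOn_conformalTime {t₀ : ℝ} (ht₀ : t₀ ∈ I) :
    ContDiffOn ℝ 3 (conformalTime a t₀) I :=
  h.contDiffOn_of_hasDerivAt (fun _ ht => h.hasDerivAt_conformalTime ht₀ ht)
    (h.contDiffOn.inv fun t ht => (h.pos t ht).ne')

theorem Ioc_subset_image {t : ℝ} (ht : t ∈ I) :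
    Ioc 0 (affineParam a t) ⊆ affineParam a '' I := by
  intro y hy
  have h1 := h.tendsto_affineParam.eventually (gt_mem_nhds hy.1)
  obtain ⟨s, hs1, hs2⟩ := (h1.and (eventually_le_atBot t)).exists
  have hsI : s ∈ I := h.isLowerSet hs2 ht
  have h2 : ContinuousOn (affineParam a) (Icc s t) := fun u hu =>
    (h.hasDerivAt_affineParam (h.isLowerSet hu.2 ht)).continuousAt.continuousWithinAt
  obtain ⟨u, hu, rfl⟩ := intermediate_value_Icc hs2 h2 ⟨hs1.le, hy.2⟩
  exact ⟨u, h.isLowerSet hu.2 ht, rfl⟩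

theorem isOpen_image : IsOpen (affineParam a '' I) := by
  rw [isOpen_iff_mem_nhds]
  rintro _ ⟨t, ht, rfl⟩
  have h1 : HasStrictDerivAt (affineParam a) (a t) t :=
    (h.contDiffOn_affineParam.contDiffAt (h.isOpen.mem_nhds ht)).hasStrictDerivAt'
      (h.hasDerivAt_affineParam ht) (by norm_num)
  rw [← h1.map_nhds_eq (h.pos t ht).ne']
  exact image_mem_map (h.isOpen.mem_nhds ht)

omit h in
theorem time_mem {y : ℝ} (hy : y ∈ affineParam a '' I) : timeOfAffineParam I a y ∈ I :=
  Function.invFunOn_mem hy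

omit h in
theorem affineParam_time {y : ℝ} (hy : y ∈ affineParam a '' I) :
    affineParam a (timeOfAffineParam I a y) = y :=
  Function.invFunOn_eq hy

theorem time_affineParam {t : ℝ} (ht : t ∈ I) : timeOfAffineParam I a (affineParam a t) = t :=
  h.strictMonoOn_affineParam.injOn (time_mem ⟨t, ht, rfl⟩) ht
    (affineParam_time ⟨t, ht, rfl⟩)

/-- A monotone map onto an open set is continuous, and the derivative of an inverse then applies. -/
theorem hasDerivAt_time {y : ℝ} (hy : y ∈ affineParam a '' I) :
    HasDerivAt (timeOfAffineParam I a) (a (timeOfAffineParam I a y))⁻¹ y := by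
  have hmem := time_mem hy
  have himg : timeOfAffineParam I a '' (affineParam a '' I) = I := by
    rw [image_image]
    exact (image_congr fun t ht => h.time_affineParam ht).trans (image_id' I)
  have hmono : MonotoneOn (timeOfAffineParam I a) (affineParam a '' I) := by
    rintro _ ⟨s, hs, rfl⟩ _ ⟨t, ht, rfl⟩ hst
    rw [h.time_affineParam hs, h.time_affineParam ht]
    exact (h.strictMonoOn_affineParam.le_iff_le hs ht).1 hst
  have hcont : ContinuousAt (timeOfAffineParam I a) y :=
    continuousAt_of_monotoneOn_of_image_mem_nhds hmono (h.isOpen_image.mem_nhds hy)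
      (by rw [himg]; exact h.isOpen.mem_nhds hmem)
  refine HasDerivAt.of_local_left_inverse hcont (h.hasDerivAt_affineParam hmem)
    (h.pos _ hmem).ne' ?_
  filter_upwards [h.isOpen_image.mem_nhds hy] with z hz using affineParam_time hz

theorem tendsto_time : Tendsto (timeOfAffineParam I a) (𝓝[>] 0) atBot := by
  rw [tendsto_atBot]
  intro b
  obtain ⟨t, ht, htb⟩ := (h.eventually_mem.and (eventually_le_atBot b)).exists
  filter_upwards [Ioc_mem_nhdsGT (h.affineParam_pos ht)] with y hy
  have hy' := h.Ioc_subset_image ht hy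
  refine le_trans ?_ htb
  rw [← h.strictMonoOn_affineParam.le_iff_le (time_mem hy') ht, affineParam_time hy']
  exact hy.2

theorem hasDerivAt_scale {t : ℝ} (ht : t ∈ I) : HasDerivAt a (hubble a t * a t) t :=
  _root_.hasDerivAt_scale h.isOpen h.contDiffOn h.pos ht

theorem hasDerivAt_hubble {t : ℝ} (ht : t ∈ I) :
    HasDerivAt (hubble a) (deriv (hubble a) t) t :=
  _root_.hasDerivAt_hubble h.isOpen h.contDiffOn h.pos ht

theorem tendsto_log_scale :
    Tendsto (fun t => Real.log (a t) - HΛ * t) atBot (𝓝 (Real.log abar)) := by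
  have h1 : ∀ᶠ t in atBot, abar * Real.exp (HΛ * t) ≠ 0 :=
    Eventually.of_forall fun t => (mul_pos h.abar_pos (Real.exp_pos _)).ne'
  have h2 := (Asymptotics.isEquivalent_iff_tendsto_one h1).1 h.isEquivalent
  have h3 := (h2.log one_ne_zero).add_const (Real.log abar)
  rw [Real.log_one, zero_add] at h3
  refine h3.congr' ?_
  filter_upwards [h.eventually_mem] with t ht
  rw [Pi.div_apply, Real.log_div (h.pos t ht).ne' (mul_pos h.abar_pos (Real.exp_pos _)).ne',
    Real.log_mul h.abar_pos.ne' (Real.exp_pos _).ne', Real.log_exp]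
  ring

/-- If the Hubble parameter varies slowly in the past, it converges to `HΛ`. -/
theorem tendsto_hubble (hH : Tendsto (deriv (hubble a)) atBot (𝓝 0)) :
    Tendsto (hubble a) atBot (𝓝 HΛ) := by
  have hf := h.tendsto_log_scale
  -- The increment over `[t - 1, t]` tends to `0` and equals `H(ξ) - HΛ` for some `ξ` in between;
  -- smallness of `Ḣ` then controls `H(t) - H(ξ)`.
  have hf1 : Tendsto (fun t => (Real.log (a t) - HΛ * t)
      - (Real.log (a (t - 1)) - HΛ * (t - 1))) atBot (𝓝 0) := by
    have h1 : Tendsto (fun t : ℝ => t - 1) atBot atBot := tendsto_atBot_add_const_right _ _ tendsto_id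
    simpa using hf.sub (hf.comp h1)
  have hfd : ∀ t ∈ I, HasDerivAt (fun t => Real.log (a t) - HΛ * t) (hubble a t - HΛ) t := by
    intro t ht
    have h0 := (h.pos t ht).ne'
    refine (((h.hasDerivAt_scale ht).log h0).sub ((hasDerivAt_id t).const_mul HΛ)).congr_deriv ?_
    field_simp
  rw [Metric.tendsto_nhds]
  intro ε hε
  have e1 : ∀ᶠ t in atBot, |deriv (hubble a) t| < ε / 2 := by
    have := (Metric.tendsto_nhds.1 hH) (ε / 2) (by positivity)
    simpa [Real.dist_eq] using this
  have e2 := (Metric.tendsto_nhds.1 hf1) (ε / 2) (by positivity)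
  obtain ⟨b, hb⟩ := eventually_atBot.1 (e1.and h.eventually_mem)
  filter_upwards [e2, eventually_le_atBot b] with t ht htb
  have hI : ∀ s ≤ t, s ∈ I := fun s hs => (hb s (hs.trans htb)).2
  obtain ⟨ξ, hξ, hξ'⟩ := exists_hasDerivAt_eq_slope (fun t => Real.log (a t) - HΛ * t)
    (fun t => hubble a t - HΛ) (show t - 1 < t by linarith)
    (fun s hs => (hfd s (hI s hs.2)).continuousAt.continuousWithinAt)
    (fun s hs => hfd s (hI s hs.2.le))
  obtain ⟨ζ, hζ, hζ'⟩ := exists_hasDerivAt_eq_slope (hubble a) (deriv (hubble a)) hξ.2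
    (fun s hs => (h.hasDerivAt_hubble (hI s hs.2)).continuousAt.continuousWithinAt)
    (fun s hs => h.hasDerivAt_hubble (hI s hs.2.le))
  have h1 := (hb ζ (hζ.2.le.trans htb)).1
  rw [sub_sub_cancel, div_one] at hξ'
  rw [Real.dist_eq, sub_zero, ← hξ'] at ht
  have h2 : hubble a t - hubble a ξ = deriv (hubble a) ζ * (t - ξ) := by
    rw [hζ', div_mul_cancel₀]
    exact (sub_pos.2 hξ.2).ne'
  have h3 : |hubble a t - hubble a ξ| ≤ ε / 2 := by
    rw [h2, abs_mul]
    have h4 : |t - ξ| ≤ 1 := by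
      rw [abs_le]
      constructor <;> linarith [hξ.1, hξ.2]
    calc _ ≤ |deriv (hubble a) ζ| * 1 := mul_le_mul_of_nonneg_left h4 (abs_nonneg _)
      _ ≤ ε / 2 := by rw [mul_one]; exact h1.le
  rw [Real.dist_eq]
  calc |hubble a t - HΛ| = |(hubble a t - hubble a ξ) + (hubble a ξ - HΛ)| := by ring_nf
    _ ≤ |hubble a t - hubble a ξ| + |hubble a ξ - HΛ| := abs_add_le _ _
    _ < ε := by linarith

section Regular

variable {L : ℝ} (hL : Tendsto (fun t => deriv (hubble a) t / a t ^ 2) atBot (𝓝 L))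
include hL

theorem tendsto_deriv_hubble_div : Tendsto (fun t => deriv (hubble a) t / a t) atBot (𝓝 0) := by
  have h1 := hL.mul h.tendsto_scale
  rw [mul_zero] at h1
  refine h1.congr' ?_
  filter_upwards [h.eventually_mem] with t ht
  have := (h.pos t ht).ne'
  field_simp

theorem tendsto_deriv_hubble : Tendsto (deriv (hubble a)) atBot (𝓝 0) := by
  have h1 := (h.tendsto_deriv_hubble_div hL).mul h.tendsto_scale
  rw [mul_zero] at h1
  refine h1.congr' ?_
  filter_upwards [h.eventually_mem] with t ht
  have := (h.pos t ht).ne'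
  field_simp

theorem tendsto_hubble' : Tendsto (hubble a) atBot (𝓝 HΛ) :=
  h.tendsto_hubble (h.tendsto_deriv_hubble hL)

/-- The sum of the conformal time and the inverse comoving Hubble parameter converges. -/
theorem exists_tendsto_conformalTime_add {t₀ : ℝ} (ht₀ : t₀ ∈ I) :
    ∃ c, Tendsto (fun t => conformalTime a t₀ t + (hubble a t * a t)⁻¹) atBot (𝓝 c) := by
  have hH := h.tendsto_hubble' hL
  obtain ⟨b, hb⟩ := eventually_atBot.1
    ((hH.eventually (lt_mem_nhds h.H_pos)).and h.eventually_mem)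
  -- The divergent terms `1/a` cancel; what remains is `-(Ḣ/a²) a / H²`, which is `O(a)` and hence
  -- integrable.
  have hd : ∀ t ∈ Iic b, HasDerivAt (fun t => conformalTime a t₀ t + (hubble a t * a t)⁻¹)
      (-(deriv (hubble a) t / a t ^ 2 / hubble a t ^ 2 * a t)) t := by
    intro t ht
    have h1 := (hb t ht).1.ne'
    have h2 := (h.pos t (hb t ht).2).ne'
    refine ((h.hasDerivAt_conformalTime ht₀ (hb t ht).2).add
      (((h.hasDerivAt_hubble (hb t ht).2).mul (h.hasDerivAt_scale (hb t ht).2)).fun_inv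
        (mul_ne_zero h1 h2))).congr_deriv ?_
    simp only [Pi.mul_apply]
    field_simp
    ring
  have hO : (fun t => -(deriv (hubble a) t / a t ^ 2 / hubble a t ^ 2 * a t)) =O[atBot] a := by
    have h1 : (fun t => deriv (hubble a) t / a t ^ 2 / hubble a t ^ 2) =O[atBot]
        fun _ => (1 : ℝ) :=
      (hL.div (hH.pow 2) (pow_ne_zero 2 h.H_pos.ne')).isBigO_one ℝ
    simpa using (h1.mul (Asymptotics.isBigO_refl a atBot)).neg_left
  have hcont : ContinuousOn (fun t => -(deriv (hubble a) t / a t ^ 2 / hubble a t ^ 2 * a t))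
      (Iic b) := by
    have hsub : Iic b ⊆ I := fun t ht => (hb t ht).2
    have c1 : ContinuousOn a (Iic b) := h.continuousOn.mono hsub
    have c2 : ContinuousOn (hubble a) (Iic b) := fun t ht =>
      (h.hasDerivAt_hubble (hsub ht)).continuousAt.continuousWithinAt
    have c3 : ContinuousOn (deriv (hubble a)) (Iic b) :=
      ((contDiffOn_hubble h.isOpen h.contDiffOn h.pos).continuousOn_deriv_of_isOpen h.isOpen
        le_rfl).mono hsub
    exact (((c3.div (c1.pow 2) fun t ht => pow_ne_zero 2 (h.pos t (hsub ht)).ne').div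
      (c2.pow 2) fun t ht => pow_ne_zero 2 (hb t ht).1.ne').mul c1).neg
  exact ⟨_, tendsto_limUnder_of_hasDerivAt_of_integrableOn_Iic hd
    (h.integrableOn_of_isBigO hO hcont)⟩

theorem tendsto_scale_mul_conformalTime {t₀ : ℝ} (ht₀ : t₀ ∈ I) :
    Tendsto (fun t => a t * conformalTime a t₀ t) atBot (𝓝 (-HΛ⁻¹)) := by
  obtain ⟨c, hc⟩ := h.exists_tendsto_conformalTime_add hL ht₀
  have hH := h.tendsto_hubble' hL
  have h1 := (h.tendsto_scale.mul hc).sub (hH.inv₀ h.H_pos.ne')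
  rw [zero_mul, zero_sub] at h1
  refine h1.congr' ?_
  filter_upwards [h.eventually_mem, hH.eventually (lt_mem_nhds h.H_pos)] with t ht ht'
  have h2 := (h.pos t ht).ne'
  have h3 : hubble a t ≠ 0 := ne_of_gt ht'
  field_simp
  ring

/-- The expression is `d(aη)/dλ`. It equals `H (η + 1/(Ha))`, so its two divergent summands
compensate each other. -/
theorem exists_tendsto_deriv_scale_mul_conformalTime {t₀ : ℝ} (ht₀ : t₀ ∈ I) :
    ∃ c, Tendsto (fun t => hubble a t * conformalTime a t₀ t + (a t)⁻¹) atBot (𝓝 c) := by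
  obtain ⟨c, hc⟩ := h.exists_tendsto_conformalTime_add hL ht₀
  have hH := h.tendsto_hubble' hL
  refine ⟨_, (hH.mul hc).congr' ?_⟩
  filter_upwards [h.eventually_mem, hH.eventually (lt_mem_nhds h.H_pos)] with t ht ht'
  have h2 := (h.pos t ht).ne'
  have h3 : hubble a t ≠ 0 := ne_of_gt ht'
  field_simp

theorem tendsto_conformalTime {t₀ : ℝ} (ht₀ : t₀ ∈ I) :
    Tendsto (conformalTime a t₀) atBot atBot := by
  have h1 := h.tendsto_scale_mul_conformalTime hL ht₀
  have h2 : Tendsto a atBot (𝓝[>] 0) := tendsto_nhdsWithin_iff.2 ⟨h.tendsto_scale, by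
    filter_upwards [h.eventually_mem] with t ht using h.pos t ht⟩
  refine (h1.neg_mul_atTop (neg_lt_zero.2 (inv_pos.2 h.H_pos))
    (tendsto_inv_nhdsGT_zero.comp h2)).congr' ?_
  filter_upwards [h.eventually_mem] with t ht
  have := (h.pos t ht).ne'
  simp only [Function.comp_apply]
  field_simp

end Regular

end IsPastDeSitter

/-! ### Asymptotics of the radius and direction along straight lines -/

section NullRays

open Filter Topology Set

theorem radius_sq (x : Coord) : radius x ^ 2 = x 1 ^ 2 + x 2 ^ 2 + x 3 ^ 2 :=
  Real.sq_sqrt (by positivity)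

theorem radius_nonneg (x : Coord) : 0 ≤ radius x := Real.sqrt_nonneg _

theorem radius_eq_of_sq_eq {x : Coord} {r : ℝ} (hr : 0 ≤ r)
    (h : x 1 ^ 2 + x 2 ^ 2 + x 3 ^ 2 = r ^ 2) : radius x = r := by
  rw [radius, h, Real.sqrt_sq hr]

theorem continuous_radius : Continuous radius := by
  unfold radius
  fun_prop

theorem nullCoordinates_zero (a : ℝ → ℝ) (t₀ : ℝ) (x : Coord) :
    nullCoordinates a t₀ x 0 = affineParam a (x 0) := rfl

theorem nullCoordinates_ne_zero (a : ℝ → ℝ) (t₀ : ℝ) (x : Coord) {i : Fin 4} (hi : i ≠ 0) :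
    nullCoordinates a t₀ x i =
      Real.exp (conformalTime a t₀ (x 0) + radius x) * (x i / radius x) := by
  obtain ⟨j, rfl⟩ := Fin.exists_succ_eq.2 hi
  rfl

variable {l : Filter ℝ} {X : ℝ → Coord} {e : ℝ → ℝ} {x n : Coord}

theorem tendsto_radius_div (hn : n 1 ^ 2 + n 2 ^ 2 + n 3 ^ 2 = 1) (he : Tendsto e l atTop)
    (hX : ∀ᶠ s in l, ∀ i ≠ 0, X s i = x i - n i * e s) :
    Tendsto (fun s => radius (X s) / e s) l (𝓝 1) := by
  have h1 : ∀ i, Tendsto (fun s => (x i / e s - n i) ^ 2) l (𝓝 (n i ^ 2)) := by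
    intro i
    have h2 := ((he.const_div_atTop (x i)).sub_const (n i)).pow 2
    rwa [zero_sub, neg_sq] at h2
  have h2 := (((h1 1).add (h1 2)).add (h1 3)).sqrt
  rw [hn, Real.sqrt_one] at h2
  refine h2.congr' ?_
  filter_upwards [hX, he.eventually_gt_atTop 0] with s hs hes
  rw [radius, hs 1 (by decide), hs 2 (by decide), hs 3 (by decide), ← Real.sqrt_sq hes.le,
    ← Real.sqrt_div (by positivity), Real.sqrt_sq hes.le]
  congr 1
  field_simp

/-- Write the difference as `(r² - e²)/(r + e)`: the `e²` terms cancel for unit `n`, leaving `-2 e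
x·n` plus a constant over a denominator asymptotic to `2e`. -/
theorem tendsto_radius_sub (hn : n 1 ^ 2 + n 2 ^ 2 + n 3 ^ 2 = 1) (he : Tendsto e l atTop)
    (hX : ∀ᶠ s in l, ∀ i ≠ 0, X s i = x i - n i * e s) :
    Tendsto (fun s => radius (X s) - e s) l (𝓝 (-(x 1 * n 1 + x 2 * n 2 + x 3 * n 3))) := by
  have h1 := tendsto_radius_div hn he hX
  have h2 := ((he.const_div_atTop (x 1 ^ 2 + x 2 ^ 2 + x 3 ^ 2)).sub_const
    (2 * (x 1 * n 1 + x 2 * n 2 + x 3 * n 3))).div (h1.add_const 1) (by norm_num)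
  have h3 : (0 - 2 * (x 1 * n 1 + x 2 * n 2 + x 3 * n 3)) / (1 + 1) =
      -(x 1 * n 1 + x 2 * n 2 + x 3 * n 3) := by ring
  rw [h3] at h2
  refine h2.congr' ?_
  filter_upwards [hX, he.eventually_gt_atTop 0] with s hs hes
  have h4 := radius_sq (X s)
  have h5 : radius (X s) + e s ≠ 0 := (add_pos_of_nonneg_of_pos (radius_nonneg _) hes).ne'
  rw [hs 1 (by decide), hs 2 (by decide), hs 3 (by decide)] at h4
  have h6 : radius (X s) / e s + 1 = (radius (X s) + e s) / e s := by field_simp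
  simp only [Pi.div_apply]
  rw [h6, div_eq_iff (div_ne_zero h5 hes.ne')]
  field_simp
  linear_combination -h4 - e s ^ 2 * hn

theorem tendsto_div_radius (hn : n 1 ^ 2 + n 2 ^ 2 + n 3 ^ 2 = 1) (he : Tendsto e l atTop)
    (hX : ∀ᶠ s in l, ∀ i ≠ 0, X s i = x i - n i * e s) {i : Fin 4} (hi : i ≠ 0) :
    Tendsto (fun s => X s i / radius (X s)) l (𝓝 (-n i)) := by
  have h1 := tendsto_radius_div hn he hX
  have h2 := ((he.const_div_atTop (x i)).sub_const (n i)).div h1 one_ne_zero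
  rw [zero_sub, div_one] at h2
  refine h2.congr' ?_
  filter_upwards [hX, he.eventually_gt_atTop 0] with s hs hes
  rw [hs i hi]
  simp only [Pi.div_apply]
  rw [div_sub' hes.ne', div_div_div_cancel_right₀ hes.ne', mul_comm (e s)]

end NullRays

/-! ### Null geodesics running into the boundary and their end points -/

section NullGeodesics

open Filter Topology Set

variable {I : Set ℝ} {a : ℝ → ℝ} {abar HΛ : ℝ}

/-- The radial null geodesic with direction `n` that starts at the past null boundary. -/
noncomputable def nullRay (I : Set ℝ) (a : ℝ → ℝ) (t₀ : ℝ) (x n : Coord) (s : ℝ) : Coord :=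
  fun i => if i = 0 then timeOfAffineParam I a s
    else x i + n i * conformalTime a t₀ (timeOfAffineParam I a s)

/-- With `λ` itself as parameter the velocity is `(1/a, n/a²)`, the solution of the first integrals
with `κ = 1`. -/
theorem IsPastDeSitter.isBoundaryNullGeodesic_nullRay (h : IsPastDeSitter I a abar HΛ) {t₀ : ℝ}
    (ht₀ : t₀ ∈ I) (x : Coord) {n : Coord} (hn : n 1 ^ 2 + n 2 ^ 2 + n 3 ^ 2 = 1) {ℓ : ℝ}
    (hℓ : 0 < ℓ) (hℓI : Ioo 0 ℓ ⊆ affineParam a '' I) :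
    IsBoundaryNullGeodesic I a (nullRay I a t₀ x n) ℓ := by
  set T := timeOfAffineParam I a with hT
  have hTI : ∀ s ∈ Ioo 0 ℓ, T s ∈ I := fun s hs => time_mem (hℓI hs)
  have hne : ∀ s ∈ Ioo 0 ℓ, a (T s) ≠ 0 := fun s hs => (h.pos _ (hTI s hs)).ne'
  have hTd : ∀ s ∈ Ioo 0 ℓ, HasDerivAt T (a (T s))⁻¹ s := fun s hs => h.hasDerivAt_time (hℓI hs)
  set W : ℝ → Coord := fun s i => if i = 0 then (a (T s))⁻¹ else n i * (a (T s))⁻¹ ^ 2 with hW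
  have hγ : ∀ s ∈ Ioo 0 ℓ, HasDerivAt (nullRay I a t₀ x n) (W s) s := by
    intro s hs
    refine hasDerivAt_pi.2 fun i => ?_
    by_cases hi : i = 0
    · simpa only [nullRay, hW, if_pos hi] using hTd s hs
    · simp only [nullRay, hW, if_neg hi]
      refine ((((h.hasDerivAt_conformalTime ht₀ (hTI s hs)).comp s (hTd s hs)).const_mul
        (n i)).const_add (x i)).congr_deriv ?_
      ring
  have hder : ∀ s ∈ Ioo 0 ℓ, deriv (nullRay I a t₀ x n) s = W s := fun s hs => (hγ s hs).deriv
  have h0 : ∀ s, nullRay I a t₀ x n s 0 = T s := fun s => rfl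
  refine ⟨hℓ, hTI, fun s hs => ⟨(hγ s hs).differentiableAt, ?_⟩, fun s hs hz => ?_,
    fun s hs => ?_, h.tendsto_time⟩
  · have hA : HasDerivAt (fun τ => (a (T τ))⁻¹) (-(hubble a (T s)) / a (T s) ^ 2) s := by
      refine (((h.hasDerivAt_scale (hTI s hs)).comp s (hTd s hs)).fun_inv (hne s hs)).congr_deriv ?_
      have := hne s hs
      simp only [Function.comp_apply]
      field_simp
    have hev : deriv (nullRay I a t₀ x n) =ᶠ[𝓝 s] W := by
      filter_upwards [isOpen_Ioo.mem_nhds hs] with τ hτ using hder τ hτ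
    refine HasDerivAt.congr_of_eventuallyEq ?_ hev
    rw [hder s hs]
    refine hasDerivAt_pi.2 fun i => ?_
    rw [neg_sum_christoffel_flrw h.isOpen h.contDiffOn h.pos (hTI s hs), h0]
    have := hne s hs
    by_cases hi : i = 0
    · simp only [hW, if_pos hi]
      refine hA.congr_deriv ?_
      simp
      field_simp
      linear_combination hubble a (T s) * hn
    · simp only [hW, if_neg hi]
      refine ((hA.fun_pow 2).const_mul (n i)).congr_deriv ?_
      rw [show 2 - 1 = 1 from rfl, pow_one]
      push_cast
      simp
      field_simp
      ring
  · rw [hder s hs] at hz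
    have h1 := congrFun hz 0
    simp only [hW, if_true, Pi.zero_apply] at h1
    exact inv_ne_zero (hne s hs) h1
  · have := hne s hs
    rw [hder s hs]
    simp [flrwMetric_apply, Fin.sum_univ_four, hW, h0]
    field_simp
    linear_combination hn

/-- Every point lies on a null geodesic that starts at the past null boundary. -/
theorem IsPastDeSitter.exists_isBoundaryNullGeodesic (h : IsPastDeSitter I a abar HΛ) {x : Coord}
    (hx : x ∈ flrwDomain I) :
    ∃ γ ℓ, IsBoundaryNullGeodesic I a γ ℓ ∧ x ∈ γ '' Ioo 0 ℓ := by
  have hxI : x 0 ∈ I := hx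
  -- A later time in the open set `I` puts `λ(x 0)` strictly inside the parameter interval `(0,
  -- λ(t))`.
  obtain ⟨t, ht, hxt⟩ : ∃ t ∈ I, x 0 < t := by
    obtain ⟨u, hu, h1⟩ := mem_nhdsGE_iff_exists_Ico_subset.1
      (mem_nhdsWithin_of_mem_nhds (h.isOpen.mem_nhds hxI))
    exact ⟨(x 0 + u) / 2, h1 ⟨by linarith [mem_Ioi.1 hu], by linarith [mem_Ioi.1 hu]⟩,
      by linarith [mem_Ioi.1 hu]⟩
  set n : Coord := Pi.single 1 1 with hn
  refine ⟨nullRay I a (x 0) (fun i => x i - n i * conformalTime a (x 0) (x 0)) n, affineParam a t,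
    h.isBoundaryNullGeodesic_nullRay hxI _ (by simp [hn]) (h.affineParam_pos ht)
      (fun y hy => h.Ioc_subset_image ht ⟨hy.1, hy.2.le⟩), affineParam a (x 0),
    ⟨h.affineParam_pos hxI, h.strictMonoOn_affineParam hxI ht hxt⟩, ?_⟩
  funext i
  rw [nullRay, h.time_affineParam hxI]
  split_ifs with hi
  · rw [hi]
  · ring

/-- The spatial path of a null geodesic in terms of the conformal time. -/
theorem IsPastDeSitter.exists_position (h : IsPastDeSitter I a abar HΛ) {t₀ : ℝ} (ht₀ : t₀ ∈ I)
    {γ : ℝ → Coord} {ℓ : ℝ} (hγ : IsBoundaryNullGeodesic I a γ ℓ) :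
    ∃ x n : Coord, n 1 ^ 2 + n 2 ^ 2 + n 3 ^ 2 = 1 ∧ ∀ s ∈ Ioo 0 ℓ, ∀ i ≠ 0,
      γ s i = x i + n i * conformalTime a t₀ (γ s 0) := by
  obtain ⟨κ, n, -, hn, hvel⟩ := hγ.exists_velocity h.isOpen h.contDiffOn h.pos
  refine ⟨fun i => γ (ℓ / 2) i - n i * conformalTime a t₀ (γ (ℓ / 2) 0), n, hn,
    fun s hs i hi => ?_⟩
  have hd : ∀ s ∈ Ioo 0 ℓ, HasDerivAt (fun τ => γ τ i - n i * conformalTime a t₀ (γ τ 0)) 0 s := by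
    intro s hs
    have h1 := fun i => hasDerivAt_pi.1 (hγ.geodesic s hs).1.hasDerivAt i
    refine ((h1 i).sub (((h.hasDerivAt_conformalTime ht₀ (hγ.mapsTo hs)).comp s
      (h1 0)).const_mul (n i))).congr_deriv ?_
    rw [hvel s hs, hvel s hs, if_neg hi, if_pos rfl]
    have : a (γ s 0) ≠ 0 := (h.pos _ (hγ.mapsTo hs)).ne'
    field_simp
    ring
  have h2 := isOpen_Ioo.is_const_of_deriv_eq_zero isPreconnected_Ioo
    (fun s hs => (hd s hs).differentiableAt.differentiableWithinAt)
    (fun s hs => (hd s hs).deriv) hs ⟨half_pos hγ.pos, half_lt_self hγ.pos⟩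
  linarith

/-- As `η → -∞`, the ray goes to spatial infinity in the direction `-n`, while `v = r - (-η)` stays
finite and tends to `-x·n`. -/
theorem IsPastDeSitter.tendsto_nullCoordinates (h : IsPastDeSitter I a abar HΛ) {L : ℝ}
    (hL : Tendsto (fun t => deriv (hubble a) t / a t ^ 2) atBot (𝓝 L)) {t₀ : ℝ} (ht₀ : t₀ ∈ I)
    {γ : ℝ → Coord} {x n : Coord} (hn : n 1 ^ 2 + n 2 ^ 2 + n 3 ^ 2 = 1)
    (hγ0 : Tendsto (fun s => γ s 0) (𝓝[>] 0) atBot)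
    (hγ : ∀ᶠ s in 𝓝[>] (0 : ℝ), ∀ i ≠ 0, γ s i = x i + n i * conformalTime a t₀ (γ s 0)) :
    (∀ᶠ s in 𝓝[>] (0 : ℝ), radius (γ s) ≠ 0) ∧
    Tendsto (fun s => nullCoordinates a t₀ (γ s)) (𝓝[>] 0) (𝓝 fun i =>
      if i = 0 then 0 else Real.exp (-(x 1 * n 1 + x 2 * n 2 + x 3 * n 3)) * -n i) := by
  set e : ℝ → ℝ := fun s => -conformalTime a t₀ (γ s 0) with he
  have het : Tendsto e (𝓝[>] 0) atTop :=
    tendsto_neg_atBot_atTop.comp ((h.tendsto_conformalTime hL ht₀).comp hγ0)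
  have hX : ∀ᶠ s in 𝓝[>] (0 : ℝ), ∀ i ≠ 0, γ s i = x i - n i * e s := by
    filter_upwards [hγ] with s hs i hi
    rw [hs i hi, he]
    ring
  refine ⟨?_, tendsto_pi_nhds.2 fun i => ?_⟩
  · filter_upwards [(tendsto_radius_div hn het hX).eventually (lt_mem_nhds one_pos)] with s hs hz
    rw [hz, zero_div] at hs
    exact lt_irrefl _ hs
  · by_cases hi : i = 0
    · subst hi
      simp only [nullCoordinates_zero, if_true]
      exact h.tendsto_affineParam.comp hγ0
    · simp only [nullCoordinates_ne_zero a t₀ _ hi, if_neg hi]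
      refine Tendsto.mul ?_ (tendsto_div_radius hn het hX hi)
      refine (Real.continuous_exp.tendsto _).comp ((tendsto_radius_sub hn het hX).congr fun s => ?_)
      simp only [he]
      ring

end NullGeodesics

/-! ### Gluing `C²` functions across a point -/

section Gluing

open Filter Topology Set

variable {S : Set ℝ}

theorem eventuallyEq_glue_of_pos (hS : IsOpen S) (hpos : S ⊆ Ioi 0) (f p : ℝ → ℝ) {y : ℝ}
    (hy : y ∈ S) : (fun z => if 0 < z then f z else p z) =ᶠ[𝓝 y] f := by
  filter_upwards [hS.mem_nhds hy] with z hz using if_pos (hpos hz)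

theorem eventuallyEq_glue_of_neg (f p : ℝ → ℝ) {y : ℝ} (hy : y < 0) :
    (fun z => if 0 < z then f z else p z) =ᶠ[𝓝 y] p := by
  filter_upwards [gt_mem_nhds hy] with z hz using if_neg (not_lt.2 (le_of_lt hz))

theorem isOpen_Iic_union (hS : IsOpen S) (hS0 : S ∈ 𝓝[>] 0) : IsOpen (Iic 0 ∪ S) := by
  rw [isOpen_iff_mem_nhds]
  rintro y (hy | hy)
  · rcases (mem_Iic.1 hy).lt_or_eq with hy | rfl
    · filter_upwards [gt_mem_nhds hy] with z hz using Or.inl (le_of_lt hz)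
    · rw [← nhdsLE_sup_nhdsGT, mem_sup]
      exact ⟨mem_of_superset self_mem_nhdsWithin subset_union_left,
        mem_of_superset hS0 subset_union_right⟩
  · exact mem_of_superset (hS.mem_nhds hy) subset_union_right

theorem hasDerivAt_glue (hS : IsOpen S) (hpos : S ⊆ Ioi 0) (hS0 : S ∈ 𝓝[>] 0)
    {f f' p p' : ℝ → ℝ} (hf : ∀ y ∈ S, HasDerivAt f (f' y) y) (hp : ∀ y, HasDerivAt p (p' y) y)
    (h0 : Tendsto f (𝓝[>] 0) (𝓝 (p 0))) (h1 : Tendsto f' (𝓝[>] 0) (𝓝 (p' 0))) :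
    ∀ y ∈ Iic 0 ∪ S, HasDerivAt (fun z => if 0 < z then f z else p z)
      (if 0 < y then f' y else p' y) y := by
  set F := fun z => if 0 < z then f z else p z with hF
  have hSd : ∀ y ∈ S, HasDerivAt F (f' y) y := fun y hy =>
    (hf y hy).congr_of_eventuallyEq (eventuallyEq_glue_of_pos hS hpos f p hy)
  rintro y (hy | hy)
  · rcases (mem_Iic.1 hy).lt_or_eq with hy | rfl
    · rw [if_neg (not_lt.2 hy.le)]
      exact (hp y).congr_of_eventuallyEq (eventuallyEq_glue_of_neg f p hy)
    · rw [if_neg (lt_irrefl _)]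
      have hF0 : F 0 = p 0 := if_neg (lt_irrefl _)
      have hl : HasDerivWithinAt F (p' 0) (Iic 0) 0 :=
        (hp 0).hasDerivWithinAt.congr (fun z hz => if_neg (not_lt.2 hz)) hF0
      -- On the right the derivative at `0` is the limit of the derivatives; on the left it is that
      -- of `p`.
      have hr : HasDerivWithinAt F (p' 0) (Ici 0) 0 := by
        refine hasDerivWithinAt_Ici_of_tendsto_deriv
          (fun z hz => (hSd z hz).differentiableAt.differentiableWithinAt) ?_ hS0 ?_
        · rw [ContinuousWithinAt, hF0]
          refine (h0.mono_left (nhdsWithin_mono 0 hpos)).congr' ?_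
          filter_upwards [self_mem_nhdsWithin] with z hz using (if_pos (hpos hz)).symm
        · refine h1.congr' ?_
          filter_upwards [hS0] with z hz using (hSd z hz).deriv.symm
      simpa [Iic_union_Ici] using hl.union hr
  · rw [if_pos (mem_Ioi.1 (hpos hy))]
    exact hSd y hy

theorem continuousOn_glue (hS : IsOpen S) (hpos : S ⊆ Ioi 0) {f p : ℝ → ℝ}
    (hf : ContinuousOn f S) (hp : Continuous p) (h0 : Tendsto f (𝓝[>] 0) (𝓝 (p 0))) :
    ContinuousOn (fun z => if 0 < z then f z else p z) (Iic 0 ∪ S) := by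
  refine fun y hy => ContinuousAt.continuousWithinAt ?_
  rcases hy with hy | hy
  · rcases (mem_Iic.1 hy).lt_or_eq with hy | rfl
    · exact hp.continuousAt.congr (eventuallyEq_glue_of_neg f p hy).symm
    · rw [ContinuousAt, if_neg (lt_irrefl _), ← nhdsLE_sup_nhdsGT, tendsto_sup]
      constructor
      · refine (hp.continuousAt.tendsto.mono_left nhdsWithin_le_nhds).congr' ?_
        filter_upwards [self_mem_nhdsWithin] with z hz using (if_neg (not_lt.2 hz)).symm
      · refine h0.congr' ?_
        filter_upwards [self_mem_nhdsWithin] with z hz using (if_pos hz).symm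
  · exact (hf.continuousAt (hS.mem_nhds hy)).congr (eventuallyEq_glue_of_pos hS hpos f p hy).symm

/-- A `C²` function on the right of `0` whose first two derivatives have limits at `0` extends to
a `C²` function. -/
theorem exists_contDiffOn_extension (hS : IsOpen S) (hpos : S ⊆ Ioi 0) (hS0 : S ∈ 𝓝[>] 0)
    {f f' f'' : ℝ → ℝ} (hf : ∀ y ∈ S, HasDerivAt f (f' y) y)
    (hf' : ∀ y ∈ S, HasDerivAt f' (f'' y) y) (hf'' : ContinuousOn f'' S) {L L' L'' : ℝ}
    (h0 : Tendsto f (𝓝[>] 0) (𝓝 L)) (h1 : Tendsto f' (𝓝[>] 0) (𝓝 L'))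
    (h2 : Tendsto f'' (𝓝[>] 0) (𝓝 L'')) :
    ∃ F : ℝ → ℝ, ContDiffOn ℝ 2 F (Iic 0 ∪ S) ∧ (∀ y ∈ S, F y = f y) ∧ F 0 = L := by
  have hJ := isOpen_Iic_union hS hS0
  -- The quadratic Taylor polynomial of the limits continues the function to the left, and its
  -- derivatives match the limits of `f'` and `f''`.
  have d0 := hasDerivAt_glue hS hpos hS0 hf (p := fun y => L + L' * y + L'' / 2 * y ^ 2)
    (p' := fun y => L' + L'' * y) (fun y => by
      refine ((((hasDerivAt_id y).const_mul L').const_add L).add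
        ((hasDerivAt_pow 2 y).const_mul (L'' / 2))).congr_deriv ?_
      rw [show 2 - 1 = 1 from rfl, pow_one]
      push_cast
      ring) (by simpa using h0) (by simpa using h1)
  have d1 := hasDerivAt_glue hS hpos hS0 hf' (p := fun y => L' + L'' * y)
    (p' := fun _ => L'') (fun y => by
      refine (((hasDerivAt_id y).const_mul L'').const_add L').congr_deriv ?_
      ring) (by simpa using h1) h2
  have d2 := continuousOn_glue hS hpos hf'' (continuous_const (y := L'')) h2
  refine ⟨fun z => if 0 < z then f z else L + L' * z + L'' / 2 * z ^ 2, ?_,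
    fun y hy => if_pos (mem_Ioi.1 (hpos hy)), by simp⟩
  rw [show (2 : WithTop ℕ∞) = 1 + 1 by norm_num, contDiffOn_succ_iff_deriv_of_isOpen hJ]
  refine ⟨fun y hy => (d0 y hy).differentiableAt.differentiableWithinAt, by simp, ?_⟩
  refine ContDiffOn.congr ?_ fun y hy => (d0 y hy).deriv
  rw [show (1 : WithTop ℕ∞) = 0 + 1 by norm_num, contDiffOn_succ_iff_deriv_of_isOpen hJ]
  refine ⟨fun y hy => (d1 y hy).differentiableAt.differentiableWithinAt, by simp, ?_⟩
  exact (contDiffOn_zero.2 d2).congr fun y hy => (d1 y hy).deriv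

end Gluing

/-! ### `C²` extension of the metric coefficients in the affine parameter -/

namespace IsPastDeSitter

open Filter Topology Set

variable {I : Set ℝ} {a : ℝ → ℝ} {abar HΛ : ℝ}

theorem image_subset_Ioi (h : IsPastDeSitter I a abar HΛ) : affineParam a '' I ⊆ Ioi 0 := by
  rintro _ ⟨t, ht, rfl⟩
  exact h.affineParam_pos ht

theorem image_mem_nhdsGT (h : IsPastDeSitter I a abar HΛ) : affineParam a '' I ∈ 𝓝[>] 0 := by
  obtain ⟨t, ht⟩ := h.nonempty
  exact mem_of_superset (Ioc_mem_nhdsGT (h.affineParam_pos ht)) (h.Ioc_subset_image ht)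

/-- The factor `a t` in the hypotheses makes `f'` and `f''` the derivatives with respect to `λ`,
written as functions of `t`. -/
theorem exists_extension (h : IsPastDeSitter I a abar HΛ) {f f' f'' : ℝ → ℝ}
    (hf : ∀ t ∈ I, HasDerivAt f (f' t * a t) t) (hf' : ∀ t ∈ I, HasDerivAt f' (f'' t * a t) t)
    (hf'' : ContinuousOn f'' I) {L L' L'' : ℝ} (h0 : Tendsto f atBot (𝓝 L))
    (h1 : Tendsto f' atBot (𝓝 L')) (h2 : Tendsto f'' atBot (𝓝 L'')) :
    ∃ F : ℝ → ℝ, ContDiffOn ℝ 2 F (Iic 0 ∪ affineParam a '' I) ∧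
      (∀ t ∈ I, F (affineParam a t) = f t) ∧ F 0 = L := by
  have key : ∀ f f' : ℝ → ℝ, (∀ t ∈ I, HasDerivAt f (f' t * a t) t) →
      ∀ y ∈ affineParam a '' I, HasDerivAt (fun y => f (timeOfAffineParam I a y))
        (f' (timeOfAffineParam I a y)) y := by
    intro f f' hf y hy
    refine ((hf _ (time_mem hy)).comp y (h.hasDerivAt_time hy)).congr_deriv ?_
    rw [mul_assoc, mul_inv_cancel₀ (h.pos _ (time_mem hy)).ne', mul_one]
  obtain ⟨F, hF, hFf, hF0⟩ := exists_contDiffOn_extension h.isOpen_image h.image_subset_Ioi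
    h.image_mem_nhdsGT (key f f' hf) (key f' f'' hf')
    (hf''.comp (fun y hy => (h.hasDerivAt_time hy).continuousAt.continuousWithinAt)
      fun y hy => time_mem hy)
    (h0.comp h.tendsto_time) (h1.comp h.tendsto_time) (h2.comp h.tendsto_time)
  refine ⟨F, hF, fun t ht => ?_, hF0⟩
  rw [hFf _ ⟨t, ht, rfl⟩, h.time_affineParam ht]

theorem exists_extended_coefficients (h : IsPastDeSitter I a abar HΛ) {L : ℝ}
    (hL : Tendsto (fun t => deriv (hubble a) t / a t ^ 2) atBot (𝓝 L)) {t₀ : ℝ} (ht₀ : t₀ ∈ I) :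
    ∃ α β : ℝ → ℝ, ContDiffOn ℝ 2 α (Iic 0 ∪ affineParam a '' I) ∧
      ContDiffOn ℝ 2 β (Iic 0 ∪ affineParam a '' I) ∧
      (∀ t ∈ I, α (affineParam a t) = a t) ∧
      (∀ t ∈ I, β (affineParam a t) = a t * conformalTime a t₀ t) ∧
      α 0 = 0 ∧ β 0 = -HΛ⁻¹ := by
  have hne : ∀ t ∈ I, a t ≠ 0 := fun t ht => (h.pos t ht).ne'
  have hH'c : ContinuousOn (deriv (hubble a)) I :=
    (contDiffOn_hubble h.isOpen h.contDiffOn h.pos).continuousOn_deriv_of_isOpen h.isOpen le_rfl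
  have hηc : ContinuousOn (conformalTime a t₀) I := fun t ht =>
    (h.hasDerivAt_conformalTime ht₀ ht).continuousAt.continuousWithinAt
  obtain ⟨c, hc⟩ := h.exists_tendsto_deriv_scale_mul_conformalTime hL ht₀
  obtain ⟨α, hα, hαa, hα0⟩ := h.exists_extension (f' := hubble a)
    (f'' := fun t => deriv (hubble a) t / a t) (fun t ht => h.hasDerivAt_scale ht)
    (fun t ht => (h.hasDerivAt_hubble ht).congr_deriv (div_mul_cancel₀ _ (hne t ht)).symm)
    (hH'c.div h.continuousOn hne) h.tendsto_scale (h.tendsto_hubble' hL)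
    (h.tendsto_deriv_hubble_div hL)
  obtain ⟨β, hβ, hβa, hβ0⟩ := h.exists_extension (f := fun t => a t * conformalTime a t₀ t)
    (f' := fun t => hubble a t * conformalTime a t₀ t + (a t)⁻¹)
    (f'' := fun t => deriv (hubble a) t * conformalTime a t₀ t / a t)
    (fun t ht => by
      refine ((h.hasDerivAt_scale ht).mul (h.hasDerivAt_conformalTime ht₀ ht)).congr_deriv ?_
      have := hne t ht
      field_simp)
    (fun t ht => by
      refine (((h.hasDerivAt_hubble ht).mul (h.hasDerivAt_conformalTime ht₀ ht)).add
        ((h.hasDerivAt_scale ht).fun_inv (hne t ht))).congr_deriv ?_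
      have := hne t ht
      field_simp
      ring)
    ((hH'c.mul hηc).div h.continuousOn hne) (h.tendsto_scale_mul_conformalTime hL ht₀) hc
    -- The second derivative of `β` is `(Ḣ/a²)(aη)`, so here the full hypothesis on `Ḣ/a²` is
    -- needed.
    ((hL.mul (h.tendsto_scale_mul_conformalTime hL ht₀)).congr' (by
      filter_upwards [h.eventually_mem] with t ht
      have := hne t ht
      field_simp))
  exact ⟨α, β, hα, hβ, hαa, hβa, hα0, hβ0⟩

end IsPastDeSitter

/-! ### Matrix algebra of the metric in the coordinates `(λ, eᵛ ω)` -/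

section NullConeMetric

/-- The coordinate components of the metric `A dv² - 2 dv dλ + R² dω²` at a point `(λ, w m)`. -/
noncomputable def nullConeMatrix (A R w : ℝ) (m : Coord) : Matrix (Fin 4) (Fin 4) ℝ :=
  Matrix.of fun i j =>
    if i = 0 then (if j = 0 then 0 else -(w⁻¹ * m j))
    else if j = 0 then -(w⁻¹ * m i)
    else w⁻¹ ^ 2 * (A * (m i * m j) + R ^ 2 * ((if i = j then 1 else 0) - m i * m j))

/-- An orthonormal frame for `nullConeMatrix`. -/
noncomputable def nullConeTetrad (A R w : ℝ) (m : Coord) : Matrix (Fin 4) (Fin 4) ℝ :=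
  Matrix.of fun i M =>
    if i = 0 then (if M = 0 then (A + 1) / 2 else m M * (A - 1) / 2)
    else if M = 0 then w * m i
    else w * (m i * m M + R⁻¹ * ((if i = M then 1 else 0) - m i * m M))

theorem nullConeMatrix_mul_tetrad {A R w : ℝ} {m : Coord} (hR : R ≠ 0) (hw : w ≠ 0)
    (hm : m 1 ^ 2 + m 2 ^ 2 + m 3 ^ 2 = 1) :
    nullConeMatrix A R w m * nullConeTetrad A R w m = Matrix.of fun i M =>
      if i = 0 then (if M = 0 then -1 else -m M)
      else if M = 0 then w⁻¹ * (m i * (A - 1) / 2)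
      else w⁻¹ * (m i * m M * (A + 1) / 2 + R * ((if i = M then 1 else 0) - m i * m M)) := by
  ext i M
  have h1 : R * R⁻¹ = 1 := mul_inv_cancel₀ hR
  have h2 : w * w⁻¹ = 1 := mul_inv_cancel₀ hw
  simp only [nullConeMatrix, nullConeTetrad, Matrix.mul_apply, Matrix.of_apply, Fin.sum_univ_four]
  generalize R⁻¹ = k at *
  generalize w⁻¹ = c at *
  fin_cases i <;> fin_cases M <;> simp <;> grind

theorem transpose_mul_nullConeMatrix_mul {A R w : ℝ} {m : Coord} (hR : R ≠ 0) (hw : w ≠ 0)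
    (hm : m 1 ^ 2 + m 2 ^ 2 + m 3 ^ 2 = 1) :
    (nullConeTetrad A R w m).transpose * nullConeMatrix A R w m * nullConeTetrad A R w m =
      minkowski := by
  rw [Matrix.mul_assoc, nullConeMatrix_mul_tetrad hR hw hm]
  ext i M
  have h1 : R * R⁻¹ = 1 := mul_inv_cancel₀ hR
  have h2 : w * w⁻¹ = 1 := mul_inv_cancel₀ hw
  simp only [nullConeTetrad, Matrix.transpose_apply, Matrix.mul_apply, Matrix.of_apply,
    Fin.sum_univ_four]
  generalize R⁻¹ = k at *
  generalize w⁻¹ = c at *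
  fin_cases i <;> fin_cases M <;> simp [minkowski] <;> grind

/-- The Jacobian matrix of the coordinates `(λ, w m)` at a point `(t, r m)`. -/
noncomputable def nullConeJacobian (b r w : ℝ) (m : Coord) : Matrix (Fin 4) (Fin 4) ℝ :=
  Matrix.of fun k i =>
    if k = 0 then (if i = 0 then b else 0)
    else if i = 0 then w * m k * b⁻¹
    else w * (m k * m i + r⁻¹ * ((if k = i then 1 else 0) - m k * m i))

theorem nullConeMatrix_mul_jacobian {b r w : ℝ} {m : Coord} (hb : b ≠ 0) (hr : r ≠ 0) (hw : w ≠ 0)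
    (hm : m 1 ^ 2 + m 2 ^ 2 + m 3 ^ 2 = 1) :
    nullConeMatrix (b ^ 2) (b * r) w m * nullConeJacobian b r w m = Matrix.of fun i M =>
      if i = 0 then (if M = 0 then -b⁻¹ else -m M)
      else if M = 0 then 0
      else w⁻¹ * b ^ 2 * (m i * m M + r * ((if i = M then 1 else 0) - m i * m M)) := by
  ext i M
  have h0 : b * b⁻¹ = 1 := mul_inv_cancel₀ hb
  have h1 : r * r⁻¹ = 1 := mul_inv_cancel₀ hr
  have h2 : w * w⁻¹ = 1 := mul_inv_cancel₀ hw
  simp only [nullConeMatrix, nullConeJacobian, Matrix.mul_apply, Matrix.of_apply,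
    Fin.sum_univ_four]
  generalize b⁻¹ = d at *
  generalize r⁻¹ = k at *
  generalize w⁻¹ = c at *
  fin_cases i <;> fin_cases M <;> simp <;> grind

/-- Matrix form of `a² dv² - 2 dv dλ = -dt² + a² dr²` for `dλ = a dt`, `dv = dt/a + dr`, with the
sphere of area radius `a r`. -/
theorem transpose_mul_nullConeMatrix_mul_jacobian {b r w : ℝ} {m : Coord} (hb : b ≠ 0)
    (hr : r ≠ 0) (hw : w ≠ 0) (hm : m 1 ^ 2 + m 2 ^ 2 + m 3 ^ 2 = 1) :
    (nullConeJacobian b r w m).transpose * nullConeMatrix (b ^ 2) (b * r) w m *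
      nullConeJacobian b r w m = Matrix.diagonal ![-1, b ^ 2, b ^ 2, b ^ 2] := by
  rw [Matrix.mul_assoc, nullConeMatrix_mul_jacobian hb hr hw hm]
  ext i M
  have h0 : b * b⁻¹ = 1 := mul_inv_cancel₀ hb
  have h1 : r * r⁻¹ = 1 := mul_inv_cancel₀ hr
  have h2 : w * w⁻¹ = 1 := mul_inv_cancel₀ hw
  simp only [nullConeJacobian, Matrix.transpose_apply, Matrix.mul_apply, Matrix.of_apply,
    Fin.sum_univ_four]
  generalize b⁻¹ = d at *
  generalize r⁻¹ = k at *
  generalize w⁻¹ = c at *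
  fin_cases i <;> fin_cases M <;> simp <;> grind

end NullConeMetric

/-! ### The extended metric and the coordinate map -/

section ExtendedMetric

open Filter Topology Set

/-- The radial projection to the unit sphere. -/
noncomputable def direction (y : Coord) : Coord := fun i => y i / radius y

theorem direction_sq {y : Coord} (hy : radius y ≠ 0) :
    direction y 1 ^ 2 + direction y 2 ^ 2 + direction y 3 ^ 2 = 1 := by
  simp only [direction, div_pow]
  rw [← add_div, ← add_div, ← radius_sq, div_self (pow_ne_zero 2 hy)]

/-- The metric `α² dv² - 2 dv dλ + (α v - β)² dω²` with `α`, `β` functions of `λ`. -/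
noncomputable def extendedMetric (α β : ℝ → ℝ) : MetricField := fun y =>
  nullConeMatrix (α (y 0) ^ 2) (α (y 0) * Real.log (radius y) - β (y 0)) (radius y) (direction y)

/-- The domain on which `extendedMetric α β` is nondegenerate. -/
def extendedDomain (J : Set ℝ) (α β : ℝ → ℝ) : Set Coord :=
  {y | (y 0 ∈ J ∧ radius y ≠ 0) ∧ 0 < α (y 0) * Real.log (radius y) - β (y 0)}

theorem contDiffAt_radius {k : WithTop ℕ∞} {y : Coord} (hy : radius y ≠ 0) :
    ContDiffAt ℝ k radius y := by
  have h1 : y 1 ^ 2 + y 2 ^ 2 + y 3 ^ 2 ≠ 0 := by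
    rw [← radius_sq]
    exact pow_ne_zero 2 hy
  unfold radius
  exact ContDiffAt.sqrt (by fun_prop) h1

variable {J : Set ℝ} {α β : ℝ → ℝ}

theorem contDiffOn_extendedRadius (hα : ContDiffOn ℝ 2 α J) (hβ : ContDiffOn ℝ 2 β J) :
    ContDiffOn ℝ 2 (fun y : Coord => α (y 0) * Real.log (radius y) - β (y 0))
      {y | y 0 ∈ J ∧ radius y ≠ 0} := by
  have h0 : ContDiffOn ℝ 2 (fun y : Coord => y 0) {y | y 0 ∈ J ∧ radius y ≠ 0} :=
    (contDiff_apply ℝ ℝ (0 : Fin 4)).contDiffOn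
  have hr : ContDiffOn ℝ 2 radius {y | y 0 ∈ J ∧ radius y ≠ 0} := fun y hy =>
    (contDiffAt_radius hy.2).contDiffWithinAt
  exact ((hα.comp h0 fun y hy => hy.1).mul (hr.log fun y hy => hy.2)).sub
    (hβ.comp h0 fun y hy => hy.1)

theorem isOpen_extendedDomain (hJ : IsOpen J) (hα : ContDiffOn ℝ 2 α J)
    (hβ : ContDiffOn ℝ 2 β J) : IsOpen (extendedDomain J α β) := by
  have h1 : IsOpen {y : Coord | y 0 ∈ J ∧ radius y ≠ 0} :=
    (hJ.preimage (continuous_apply 0)).inter (isOpen_ne.preimage continuous_radius)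
  exact (contDiffOn_extendedRadius hα hβ).continuousOn.isOpen_inter_preimage h1 isOpen_Ioi

theorem isLorentzMetricOn_extendedMetric (hα : ContDiffOn ℝ 2 α J) (hβ : ContDiffOn ℝ 2 β J) :
    IsLorentzMetricOn (extendedDomain J α β) (extendedMetric α β) where
  contDiffOn i j := by
    have hsub : extendedDomain J α β ⊆ {y | y 0 ∈ J ∧ radius y ≠ 0} := fun y hy => hy.1
    have h0 : ContDiffOn ℝ 2 (fun y : Coord => y 0) (extendedDomain J α β) :=
      (contDiff_apply ℝ ℝ (0 : Fin 4)).contDiffOn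
    have hr : ContDiffOn ℝ 2 radius (extendedDomain J α β) := fun y hy =>
      (contDiffAt_radius hy.1.2).contDiffWithinAt
    have hri := hr.inv fun y hy => hy.1.2
    have hR := (contDiffOn_extendedRadius hα hβ).mono hsub
    have hA := (hα.comp h0 fun y hy => hy.1.1).pow 2
    have hm : ∀ i, ContDiffOn ℝ 2 (fun y => direction y i) (extendedDomain J α β) := fun i =>
      (contDiff_apply ℝ ℝ i).contDiffOn.div hr fun y hy => hy.1.2
    unfold extendedMetric nullConeMatrix
    simp only [Matrix.of_apply]
    split_ifs
    · exact contDiffOn_const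
    · exact (hri.mul (hm j)).neg
    · exact (hri.mul (hm i)).neg
    · exact (hri.pow 2).mul ((hA.mul ((hm i).mul (hm j))).add
        ((hR.pow 2).mul (contDiffOn_const.sub ((hm i).mul (hm j)))))
    · exact (hri.pow 2).mul ((hA.mul ((hm i).mul (hm j))).add
        ((hR.pow 2).mul (contDiffOn_const.sub ((hm i).mul (hm j)))))
  symm y _ := by
    refine Matrix.IsSymm.ext fun i j => ?_
    unfold extendedMetric nullConeMatrix
    simp only [Matrix.of_apply, eq_comm (a := j) (b := i), mul_comm (direction y j)]
    split_ifs <;> rfl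
  signature y hy := ⟨_, transpose_mul_nullConeMatrix_mul hy.2.ne' hy.1.2 (direction_sq hy.1.2)⟩

variable {I : Set ℝ} {a : ℝ → ℝ} {abar HΛ : ℝ}

theorem radius_nullCoordinates (a : ℝ → ℝ) (t₀ : ℝ) {x : Coord} (hx : radius x ≠ 0) :
    radius (nullCoordinates a t₀ x) = Real.exp (conformalTime a t₀ (x 0) + radius x) := by
  refine radius_eq_of_sq_eq (Real.exp_pos _).le ?_
  rw [nullCoordinates_ne_zero a t₀ x (by decide), nullCoordinates_ne_zero a t₀ x (by decide),
    nullCoordinates_ne_zero a t₀ x (by decide)]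
  have h1 := direction_sq hx
  simp only [direction] at h1
  linear_combination Real.exp (conformalTime a t₀ (x 0) + radius x) ^ 2 * h1

theorem direction_nullCoordinates (a : ℝ → ℝ) (t₀ : ℝ) {x : Coord} (hx : radius x ≠ 0)
    {i : Fin 4} (hi : i ≠ 0) : direction (nullCoordinates a t₀ x) i = direction x i := by
  rw [direction, radius_nullCoordinates a t₀ hx, nullCoordinates_ne_zero a t₀ x hi,
    mul_div_cancel_left₀ _ (Real.exp_pos _).ne', direction]

/-- The entry of `direction` at index `0` has no geometric meaning and differs between the two sides
of the coordinate map; the matrix does not use it. -/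
theorem nullConeMatrix_congr {A R w : ℝ} {m m' : Coord} (h : ∀ i ≠ 0, m i = m' i) :
    nullConeMatrix A R w m = nullConeMatrix A R w m' := by
  ext i j
  simp only [nullConeMatrix, Matrix.of_apply]
  split_ifs with h1 h2 h3
  · rfl
  · rw [h j h2]
  · rw [h i h1]
  · rw [h i h1, h j h3]
  · rw [h i h1, h j h3]

theorem IsPastDeSitter.partialDeriv_nullCoordinates (h : IsPastDeSitter I a abar HΛ) {t₀ : ℝ}
    (ht₀ : t₀ ∈ I) {x : Coord} (hx : x ∈ flrwDomain I) (hr : radius x ≠ 0) (i k : Fin 4) :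
    partialDeriv i (fun y => nullCoordinates a t₀ y k) x =
      nullConeJacobian (a (x 0)) (radius x) (Real.exp (conformalTime a t₀ (x 0) + radius x))
        (direction x) k i := by
  have hp : ∀ j, HasFDerivAt (fun y : Coord => y j)
      (ContinuousLinearMap.proj (R := ℝ) (φ := fun _ : Fin 4 => ℝ) j) x := fun j =>
    (ContinuousLinearMap.proj (R := ℝ) (φ := fun _ : Fin 4 => ℝ) j).hasFDerivAt
  by_cases hk : k = 0
  · subst hk
    simp only [nullCoordinates_zero]
    rw [partialDeriv_comp_time (h.hasDerivAt_affineParam hx)]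
    simp [nullConeJacobian]
  · simp only [nullCoordinates_ne_zero a t₀ _ hk]
    have hrad : HasFDerivAt radius ((radius x)⁻¹ •
        (x 1 • ContinuousLinearMap.proj (R := ℝ) (φ := fun _ : Fin 4 => ℝ) 1
        + x 2 • ContinuousLinearMap.proj (R := ℝ) (φ := fun _ : Fin 4 => ℝ) 2
        + x 3 • ContinuousLinearMap.proj (R := ℝ) (φ := fun _ : Fin 4 => ℝ) 3)) x := by
      have h1 : x 1 ^ 2 + x 2 ^ 2 + x 3 ^ 2 ≠ 0 := by
        rw [← radius_sq]
        exact pow_ne_zero 2 hr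
      have h2 := ((((hp 1).pow 2).add ((hp 2).pow 2)).add ((hp 3).pow 2)).sqrt h1
      refine h2.congr_fderiv ?_
      ext v
      have h3 : Real.sqrt (x 1 ^ 2 + x 2 ^ 2 + x 3 ^ 2) = radius x := rfl
      simp [h3]
      field_simp
    have hη := (h.hasDerivAt_conformalTime ht₀ hx).comp_hasFDerivAt x (hp 0)
    have hinv := (hasDerivAt_inv hr).comp_hasFDerivAt x hrad
    have hd := ((hη.add hrad).exp).mul ((hp k).mul hinv)
    have he : (fun y => Real.exp (conformalTime a t₀ (y 0) + radius y) * (y k / radius y)) =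
        fun y => Real.exp (conformalTime a t₀ (y 0) + radius y) * (y k * (radius y)⁻¹) := by
      simp only [div_eq_mul_inv]
    rw [partialDeriv, he]
    erw [hd.fderiv]
    have ha : a (x 0) ≠ 0 := (h.pos _ hx).ne'
    simp only [nullConeJacobian, Matrix.of_apply, direction, if_neg hk]
    fin_cases i
    all_goals
      fin_cases k <;> first | exact absurd rfl hk | (simp; field_simp; try ring)

end ExtendedMetric

/-! ### The regular case: extension across the boundary -/

section Extension

open Filter Topology Set

variable {I : Set ℝ} {a : ℝ → ℝ} {abar HΛ : ℝ} {α β : ℝ → ℝ} {t₀ : ℝ}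

theorem isOpen_radius_ne_zero (hI : IsOpen I) : IsOpen {x ∈ flrwDomain I | radius x ≠ 0} :=
  (isOpen_flrwDomain hI).inter (isOpen_ne.preimage continuous_radius)

theorem IsPastDeSitter.extendedRadius_nullCoordinates (hαa : ∀ t ∈ I, α (affineParam a t) = a t)
    (hβa : ∀ t ∈ I, β (affineParam a t) = a t * conformalTime a t₀ t) {x : Coord}
    (hx : x ∈ flrwDomain I) (hr : radius x ≠ 0) :
    α (nullCoordinates a t₀ x 0) * Real.log (radius (nullCoordinates a t₀ x))
      - β (nullCoordinates a t₀ x 0) = a (x 0) * radius x := by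
  rw [nullCoordinates_zero, hαa _ hx, hβa _ hx, radius_nullCoordinates a t₀ hr, Real.log_exp]
  ring

theorem IsPastDeSitter.isIsometricEmbedding_nullCoordinates (h : IsPastDeSitter I a abar HΛ)
    (ht₀ : t₀ ∈ I) (hαa : ∀ t ∈ I, α (affineParam a t) = a t)
    (hβa : ∀ t ∈ I, β (affineParam a t) = a t * conformalTime a t₀ t) :
    IsIsometricEmbedding {x ∈ flrwDomain I | radius x ≠ 0} (flrwMetric a)
      (extendedDomain (Iic 0 ∪ affineParam a '' I) α β) (extendedMetric α β)
      (nullCoordinates a t₀) where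
  contDiffOn := by
    rw [contDiffOn_pi]
    have h0 : ContDiffOn ℝ 3 (fun y : Coord => y 0) {x ∈ flrwDomain I | radius x ≠ 0} :=
      (contDiff_apply ℝ ℝ (0 : Fin 4)).contDiffOn
    have hr : ContDiffOn ℝ 3 radius {x ∈ flrwDomain I | radius x ≠ 0} := fun y hy =>
      (contDiffAt_radius hy.2).contDiffWithinAt
    intro i
    by_cases hi : i = 0
    · subst hi
      exact h.contDiffOn_affineParam.comp h0 fun y hy => hy.1
    · simp only [nullCoordinates_ne_zero a t₀ _ hi]
      exact ((((h.contDiffOn_conformalTime ht₀).comp h0 fun y hy => hy.1).add hr).exp).mul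
        ((contDiff_apply ℝ ℝ i).contDiffOn.div hr fun y hy => hy.2)
  injOn := by
    intro x hx y hy hxy
    have h1 : x 0 = y 0 := h.strictMonoOn_affineParam.injOn hx.1 hy.1 (congrFun hxy 0)
    have h2 : radius x = radius y := by
      have h3 := congrArg radius hxy
      rw [radius_nullCoordinates a t₀ hx.2, radius_nullCoordinates a t₀ hy.2, h1] at h3
      exact add_left_cancel (Real.exp_injective h3)
    funext i
    by_cases hi : i = 0
    · rw [hi, h1]
    · have h3 := direction_nullCoordinates a t₀ hx.2 hi
      rw [hxy, direction_nullCoordinates a t₀ hy.2 hi, direction, direction, h2] at h3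
      exact ((div_left_inj' hy.2).1 h3).symm
  mapsTo x hx := by
    refine ⟨⟨Or.inr ⟨x 0, hx.1, rfl⟩, ?_⟩, ?_⟩
    · rw [radius_nullCoordinates a t₀ hx.2]
      exact (Real.exp_pos _).ne'
    · rw [extendedRadius_nullCoordinates hαa hβa hx.1 hx.2]
      exact mul_pos (h.pos _ hx.1) ((radius_nonneg x).lt_of_ne' hx.2)
  pullback x hx i j := by
    have h1 := transpose_mul_nullConeMatrix_mul_jacobian (h.pos _ hx.1).ne' hx.2
      (Real.exp_pos (conformalTime a t₀ (x 0) + radius x)).ne' (direction_sq hx.2)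
    have h2 : extendedMetric α β (nullCoordinates a t₀ x) =
        nullConeMatrix (a (x 0) ^ 2) (a (x 0) * radius x)
          (Real.exp (conformalTime a t₀ (x 0) + radius x)) (direction x) := by
      rw [extendedMetric, extendedRadius_nullCoordinates hαa hβa hx.1 hx.2,
        nullCoordinates_zero, hαa _ hx.1, radius_nullCoordinates a t₀ hx.2]
      exact nullConeMatrix_congr fun i hi => direction_nullCoordinates a t₀ hx.2 hi
    rw [flrwMetric, ← h1, transpose_mul_mul_apply, h2]
    simp only [h.partialDeriv_nullCoordinates ht₀ hx.1 hx.2]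

theorem IsPastDeSitter.image_nullCoordinates (h : IsPastDeSitter I a abar HΛ)
    (ht₀ : t₀ ∈ I) (hαa : ∀ t ∈ I, α (affineParam a t) = a t)
    (hβa : ∀ t ∈ I, β (affineParam a t) = a t * conformalTime a t₀ t) :
    nullCoordinates a t₀ '' {x ∈ flrwDomain I | radius x ≠ 0} =
      {y ∈ extendedDomain (Iic 0 ∪ affineParam a '' I) α β | 0 < y 0} := by
  refine Subset.antisymm ?_ ?_
  · rintro _ ⟨x, hx, rfl⟩
    exact ⟨(h.isIsometricEmbedding_nullCoordinates ht₀ hαa hβa).mapsTo hx,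
      h.affineParam_pos hx.1⟩
  · rintro y ⟨⟨⟨hyJ, hyr⟩, hyR⟩, hy0⟩
    obtain ⟨t, ht, hty⟩ : y 0 ∈ affineParam a '' I := hyJ.resolve_left (not_le.2 hy0)
    have hy : 0 < radius y := (radius_nonneg y).lt_of_ne' hyr
    -- Inverting the coordinates gives `r = v - η`. Since `α v - β = a (v - η)`, the domain
    -- condition is exactly its positivity.
    set r := Real.log (radius y) - conformalTime a t₀ t with hr
    have hr0 : 0 < r := by
      rw [← hty, hαa t ht, hβa t ht, ← mul_sub] at hyR
      exact pos_of_mul_pos_right hyR (h.pos t ht).le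
    set x : Coord := fun i => if i = 0 then t else r * direction y i with hx
    have hxr : radius x = r := by
      refine radius_eq_of_sq_eq hr0.le ?_
      simp only [hx, if_neg (show (1 : Fin 4) ≠ 0 by decide),
        if_neg (show (2 : Fin 4) ≠ 0 by decide), if_neg (show (3 : Fin 4) ≠ 0 by decide)]
      linear_combination r ^ 2 * direction_sq hyr
    refine ⟨x, ⟨ht, by rw [hxr]; exact hr0.ne'⟩, ?_⟩
    funext i
    by_cases hi : i = 0
    · subst hi
      exact hty
    · rw [nullCoordinates_ne_zero a t₀ x hi, hxr]
      simp only [hx, if_neg hi, if_true]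
      rw [mul_div_cancel_left₀ _ hr0.ne', hr, add_sub_cancel, Real.exp_log hy, direction,
        mul_div_cancel₀ _ hyr]

/-- At `λ = 0` the area radius `α v - β` is the constant `1/HΛ`, whatever the value of `v`. -/
theorem IsPastDeSitter.mem_extendedDomain (h : IsPastDeSitter I a abar HΛ) (hα0 : α 0 = 0)
    (hβ0 : β 0 = -HΛ⁻¹) {y : Coord} (hy0 : y 0 = 0) (hyr : radius y ≠ 0) :
    y ∈ extendedDomain (Iic 0 ∪ affineParam a '' I) α β := by
  refine ⟨⟨Or.inl hy0.le, hyr⟩, ?_⟩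
  rw [hy0, hα0, hβ0, zero_mul, zero_sub, neg_neg]
  exact inv_pos.2 h.H_pos

variable {L : ℝ} (hL : Tendsto (fun t => deriv (hubble a) t / a t ^ 2) atBot (𝓝 L))
include hL

theorem IsPastDeSitter.exists_endpoint (h : IsPastDeSitter I a abar HΛ) (ht₀ : t₀ ∈ I)
    {γ : ℝ → Coord} {ℓ : ℝ} (hγ : IsBoundaryNullGeodesic I a γ ℓ) :
    (∀ᶠ s in 𝓝[>] (0 : ℝ), radius (γ s) ≠ 0) ∧ ∃ q : Coord, q 0 = 0 ∧ radius q ≠ 0 ∧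
      Tendsto (fun s => nullCoordinates a t₀ (γ s)) (𝓝[>] 0) (𝓝 q) := by
  obtain ⟨x, n, hn, hpos⟩ := h.exists_position ht₀ hγ
  obtain ⟨h1, h2⟩ := h.tendsto_nullCoordinates hL ht₀ hn hγ.tendsto (by
    filter_upwards [Ioo_mem_nhdsGT hγ.pos] with s hs using hpos s hs)
  refine ⟨h1, _, rfl, ?_, h2⟩
  rw [radius_eq_of_sq_eq (Real.exp_pos (-(x 1 * n 1 + x 2 * n 2 + x 3 * n 3))).le]
  · exact (Real.exp_pos _).ne'
  · simp only [if_neg (show (1 : Fin 4) ≠ 0 by decide),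
      if_neg (show (2 : Fin 4) ≠ 0 by decide), if_neg (show (3 : Fin 4) ≠ 0 by decide)]
    linear_combination Real.exp (-(x 1 * n 1 + x 2 * n 2 + x 3 * n 3)) ^ 2 * hn

/-- For an end point `(v, ω)`, the ray with direction `n = -ω` and offset `x = v ω` has `-x·n = v`.
-/
theorem IsPastDeSitter.exists_geodesic_to_endpoint (h : IsPastDeSitter I a abar HΛ) (ht₀ : t₀ ∈ I)
    {q : Coord} (hq0 : q 0 = 0) (hqr : radius q ≠ 0) :
    ∃ γ ℓ, IsBoundaryNullGeodesic I a γ ℓ ∧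
      Tendsto (fun s => nullCoordinates a t₀ (γ s)) (𝓝[>] 0) (𝓝 q) := by
  set n : Coord := fun i => -direction q i with hn
  set x : Coord := fun i => Real.log (radius q) * direction q i with hx
  have hd := direction_sq hqr
  have hn1 : n 1 ^ 2 + n 2 ^ 2 + n 3 ^ 2 = 1 := by
    simp only [hn]
    linear_combination hd
  refine ⟨nullRay I a t₀ x n, affineParam a t₀, h.isBoundaryNullGeodesic_nullRay ht₀ x hn1
    (h.affineParam_pos ht₀) fun y hy => h.Ioc_subset_image ht₀ ⟨hy.1, hy.2.le⟩, ?_⟩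
  obtain ⟨-, h2⟩ := h.tendsto_nullCoordinates hL ht₀ (γ := nullRay I a t₀ x n) (x := x) hn1
    h.tendsto_time (Eventually.of_forall fun s i hi => if_neg hi)
  convert h2 using 2
  funext i
  split_ifs with hi
  · rw [hi, hq0]
  · have h3 : -(x 1 * n 1 + x 2 * n 2 + x 3 * n 3) = Real.log (radius q) := by
      simp only [hx, hn]
      linear_combination Real.log (radius q) * hd
    rw [h3, Real.exp_log ((radius_nonneg q).lt_of_ne' hqr), hn]
    simp only [neg_neg, direction]
    rw [mul_div_cancel₀ _ hqr]

theorem IsPastDeSitter.extendsInNullCoordinates (h : IsPastDeSitter I a abar HΛ) (ht₀ : t₀ ∈ I) :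
    ExtendsInNullCoordinates I a t₀ := by
  obtain ⟨α, β, hα, hβ, hαa, hβa, hα0, hβ0⟩ := h.exists_extended_coefficients hL ht₀
  have hJ := isOpen_Iic_union h.isOpen_image h.image_mem_nhdsGT
  refine ⟨extendedDomain (Iic 0 ∪ affineParam a '' I) α β, extendedMetric α β,
    isOpen_extendedDomain hJ hα hβ, isLorentzMetricOn_extendedMetric hα hβ,
    h.isIsometricEmbedding_nullCoordinates ht₀ hαa hβa, h.image_nullCoordinates ht₀ hαa hβa,
    ?_, fun γ ℓ hγ => ?_, fun q hq hq0 => h.exists_geodesic_to_endpoint hL ht₀ hq0 hq.1.2⟩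
  · ext y
    exact ⟨fun hy => ⟨hy.2, hy.1.1.2⟩, fun hy => ⟨h.mem_extendedDomain hα0 hβ0 hy.1 hy.2, hy.1⟩⟩
  · obtain ⟨-, q, hq0, hqr, hq⟩ := h.exists_endpoint hL ht₀ hγ
    exact ⟨q, h.mem_extendedDomain hα0 hβ0 hq0 hqr, hq0, hq⟩

theorem IsPastDeSitter.isLocallyExtendibleAlong (h : IsPastDeSitter I a abar HΛ) {γ : ℝ → Coord}
    {ℓ : ℝ} (hγ : IsBoundaryNullGeodesic I a γ ℓ) :
    IsLocallyExtendibleAlong (flrwDomain I) (flrwMetric a) γ ℓ := by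
  obtain ⟨t₀, ht₀⟩ := h.nonempty
  obtain ⟨V, g', hV, hg', hφ, -, -, hend, -⟩ := h.extendsInNullCoordinates hL ht₀
  obtain ⟨q, hq, -, hlim⟩ := hend γ ℓ hγ
  refine ⟨_, V, g', nullCoordinates a t₀, isOpen_radius_ne_zero h.isOpen, fun x hx => hx.1, hV,
    hg', hφ, ?_, q, hq, hlim⟩
  -- The geodesic may cross `r = 0`, where the coordinates fail, but not close to its past end.
  obtain ⟨ε, hε, hεr⟩ := mem_nhdsGT_iff_exists_Ioo_subset.1 (h.exists_endpoint hL ht₀ hγ).1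
  refine ⟨min ε ℓ, lt_min hε hγ.pos, min_le_right _ _, fun s hs => ⟨?_, ?_⟩⟩
  · exact hγ.mapsTo ⟨hs.1, hs.2.trans_le (min_le_right _ _)⟩
  · exact hεr ⟨hs.1, hs.2.trans_le (min_le_left _ _)⟩

/-- Each product `Ḣ E⁰ E⁰` is `(Ḣ/a²)(a E⁰)(a E⁰)`, a product of convergent factors. -/
theorem IsPastDeSitter.not_isPPCurvatureSingularity (h : IsPastDeSitter I a abar HΛ)
    {γ : ℝ → Coord} {ℓ : ℝ} (hγ : IsBoundaryNullGeodesic I a γ ℓ) :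
    ¬ IsPPCurvatureSingularity (flrwMetric a) γ ℓ := by
  rintro ⟨E, hE, M, N, P, Q, hno⟩
  obtain ⟨C, hC, -, -⟩ := exists_parallel_time_row_limit h.isOpen h.contDiffOn h.pos
    h.tendsto_scale hγ hE
  have hH := (h.tendsto_hubble' hL).comp hγ.tendsto
  have hu : ∀ M P, Tendsto (fun s => deriv (hubble a) (γ s 0) * (E s 0 M * E s 0 P)) (𝓝[>] 0)
      (𝓝 (L * (C M * C P))) := by
    intro M P
    refine ((hL.comp hγ.tendsto).mul ((hC M).mul (hC P))).congr' ?_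
    filter_upwards [Ioo_mem_nhdsGT hγ.pos] with s hs
    have : a (γ s 0) ≠ 0 := (h.pos _ (hγ.mapsTo hs)).ne'
    simp only [Function.comp_apply]
    field_simp
  refine hno ⟨_, Tendsto.congr' ?_ (((hH.pow 2).mul_const
    (minkowski M P * minkowski N Q - minkowski M Q * minkowski N P)).sub
    (((((hu M P).mul_const (minkowski N Q)).add ((hu N Q).mul_const (minkowski M P))).sub
      ((hu M Q).mul_const (minkowski N P))).sub ((hu N P).mul_const (minkowski M Q))))⟩
  filter_upwards [Ioo_mem_nhdsGT hγ.pos] with s hs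
  rw [frameComponents_riemann_flrw h.isOpen h.contDiffOn h.pos (hγ.mapsTo hs) (hE s hs).1]
  simp only [Function.comp_apply]
  ring

end Extension

/-! ### The singular case: divergent frame components, convergent scalars -/

section Singular

open Filter Topology Set

variable {I : Set ℝ} {a : ℝ → ℝ} {abar HΛ : ℝ} {γ : ℝ → Coord} {ℓ : ℝ}

/-- If `Ḣ / a²` is unbounded, so is a component of the curvature in any parallel tetrad. -/
theorem IsPastDeSitter.exists_tendsto_frameComponents (h : IsPastDeSitter I a abar HΛ)
    (hS : Tendsto (fun t => |deriv (hubble a) t / a t ^ 2|) atBot atTop)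
    (hγ : IsBoundaryNullGeodesic I a γ ℓ) {E : ℝ → Matrix (Fin 4) (Fin 4) ℝ}
    (hE : IsParallelTetradOn (flrwMetric a) γ (Ioo 0 ℓ) E) :
    ∃ M N P Q : Fin 4, Tendsto
      (fun s => |frameComponents (riemann (flrwMetric a) (γ s)) (E s) M N P Q|) (𝓝[>] 0) atTop := by
  obtain ⟨C, hC, hnull, hC0⟩ := exists_parallel_time_row_limit h.isOpen h.contDiffOn h.pos
    h.tendsto_scale hγ hE
  obtain ⟨i, hi0, hi⟩ : ∃ i : Fin 4, i ≠ 0 ∧ C i ≠ 0 := by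
    by_contra! hne
    rw [hne 1 (by decide), hne 2 (by decide), hne 3 (by decide)] at hnull
    exact hC0 (pow_eq_zero_iff two_ne_zero |>.1 (by linarith))
  -- For such `j`, the component `0 j i j` loses every term but `-Ḣ E⁰₀ E⁰ᵢ`, asymptotically
  -- `-(Ḣ/a²) C₀ Cᵢ` with `C₀ Cᵢ ≠ 0`.
  obtain ⟨j, hj0, hji⟩ : ∃ j : Fin 4, j ≠ 0 ∧ j ≠ i :=
    (by decide : ∀ i : Fin 4, ∃ j : Fin 4, j ≠ 0 ∧ j ≠ i) i
  have hoff : ∀ k l : Fin 4, k ≠ l → minkowski k l = 0 := fun k l hkl =>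
    Matrix.diagonal_apply_ne _ hkl
  have hjj : minkowski j j = 1 := by
    rw [minkowski, Matrix.diagonal_apply_eq]
    fin_cases j <;> simp at hj0 ⊢
  refine ⟨0, j, i, j, Tendsto.congr' ?_ ((hS.comp hγ.tendsto).atTop_mul_pos
    (abs_pos.2 (mul_ne_zero hC0 hi)) ((hC 0).mul (hC i)).abs)⟩
  filter_upwards [Ioo_mem_nhdsGT hγ.pos] with s hs
  rw [frameComponents_riemann_flrw h.isOpen h.contDiffOn h.pos (hγ.mapsTo hs) (hE s hs).1,
    hoff 0 i hi0.symm, hoff 0 j hj0.symm, hoff j i hji, hjj, Function.comp_apply, ← abs_mul,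
    ← abs_neg]
  have : a (γ s 0) ≠ 0 := (h.pos _ (hγ.mapsTo hs)).ne'
  congr 1
  field_simp
  ring

theorem IsPastDeSitter.exists_isParallelTetradOn (h : IsPastDeSitter I a abar HΛ)
    (hγ : IsBoundaryNullGeodesic I a γ ℓ) :
    ∃ E, IsParallelTetradOn (flrwMetric a) γ (Ioo 0 ℓ) E := by
  obtain ⟨κ, n, -, hn, hvel⟩ := hγ.exists_velocity h.isOpen h.contDiffOn h.pos
  exact ⟨_, isParallelTetradOn_nullTetrad h.isOpen h.contDiffOn h.pos hγ hn hvel⟩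

theorem IsPastDeSitter.isPPCurvatureSingularity (h : IsPastDeSitter I a abar HΛ)
    (hS : Tendsto (fun t => |deriv (hubble a) t / a t ^ 2|) atBot atTop)
    (hγ : IsBoundaryNullGeodesic I a γ ℓ) : IsPPCurvatureSingularity (flrwMetric a) γ ℓ := by
  obtain ⟨E, hE⟩ := h.exists_isParallelTetradOn hγ
  obtain ⟨M, N, P, Q, hlim⟩ := h.exists_tendsto_frameComponents hS hγ hE
  exact ⟨E, hE, M, N, P, Q, fun ⟨L, hL⟩ => not_tendsto_nhds_of_tendsto_atTop hlim _ hL.abs⟩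

theorem IsPastDeSitter.not_isLocallyExtendibleAlong (h : IsPastDeSitter I a abar HΛ)
    (hS : Tendsto (fun t => |deriv (hubble a) t / a t ^ 2|) atBot atTop)
    (hγ : IsBoundaryNullGeodesic I a γ ℓ) :
    ¬ IsLocallyExtendibleAlong (flrwDomain I) (flrwMetric a) γ ℓ := by
  obtain ⟨E, hE⟩ := h.exists_isParallelTetradOn hγ
  obtain ⟨M, N, P, Q, hlim⟩ := h.exists_tendsto_frameComponents hS hγ hE
  exact _root_.not_isLocallyExtendibleAlong (isLorentzMetricOn_flrw h.contDiffOn h.pos) hγ.geodesic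
    hE hlim

/-- Composition of frame changes, needed to compare an arbitrary tetrad with the comoving one. -/
theorem frameComponents_frameComponents (T : Fin 4 → Fin 4 → Fin 4 → Fin 4 → ℝ)
    (E A : Matrix (Fin 4) (Fin 4) ℝ) :
    frameComponents (frameComponents T E) A = frameComponents T (E * A) := by
  funext M N P Q
  have hc : ∀ (F : Fin 4 → Fin 4 → Fin 4 → Fin 4 → ℝ) (B : Matrix (Fin 4) (Fin 4) ℝ) M N P Q,
      frameComponents F B M N P Q =
      ∑ i, B i M * ∑ j, B j N * ∑ k, B k P * ∑ l, B l Q * F i j k l := by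
    intro F B M N P Q
    simp only [frameComponents, Finset.mul_sum]
    exact Finset.sum_congr rfl fun _ _ => Finset.sum_congr rfl fun _ _ =>
      Finset.sum_congr rfl fun _ _ => Finset.sum_congr rfl fun _ _ => by ring
  have hm : ∀ (f : Fin 4 → ℝ) M, ∑ i, (E * A) i M * f i = ∑ k, A k M * ∑ i, E i k * f i := by
    intro f M
    simp only [Matrix.mul_apply, Finset.sum_mul, Finset.mul_sum]
    rw [Finset.sum_comm]
    exact Finset.sum_congr rfl fun _ _ => Finset.sum_congr rfl fun _ _ => by ring
  have hs : ∀ (x : Fin 4 → ℝ) (f : Fin 4 → Fin 4 → ℝ) M, ∑ k, A k M * ∑ i, x i * f k i =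
      ∑ i, x i * ∑ k, A k M * f k i := by
    intro x f M
    simp only [Finset.mul_sum]
    rw [Finset.sum_comm]
    exact Finset.sum_congr rfl fun _ _ => Finset.sum_congr rfl fun _ _ => by ring
  rw [hc, hc]
  simp only [hc T E, hm, hs]

/-- The components of the curvature in the comoving frame are functions of `H` and `Ḣ`. -/
theorem IsPastDeSitter.not_isScalarCurvatureSingularity (h : IsPastDeSitter I a abar HΛ)
    (hH' : Tendsto (deriv (hubble a)) atBot (𝓝 0)) (hγ : IsBoundaryNullGeodesic I a γ ℓ) :
    ¬ IsScalarCurvatureSingularity (flrwMetric a) γ ℓ := by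
  rintro ⟨p, hp, E, hE, hno⟩
  have hH := (h.tendsto_hubble hH').comp hγ.tendsto
  have hH'' := hH'.comp hγ.tendsto
  set D : ℝ → Matrix (Fin 4) (Fin 4) ℝ := fun s => comovingTetrad (a (γ s 0)) with hD
  have hDt : ∀ s ∈ Ioo 0 ℓ, IsTetradAt (flrwMetric a) (γ s) (D s) := fun s hs =>
    isTetradAt_comovingTetrad (h.pos _ (hγ.mapsTo hs)).ne'
  have hval : ∀ s ∈ Ioo 0 ℓ, p.value (frameComponents (riemann (flrwMetric a) (γ s)) (E s)) =
      p.value (frameComponents (riemann (flrwMetric a) (γ s)) (D s)) := by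
    intro s hs
    have hdet : IsUnit (D s).det := by
      have h1 : (D s).det = (a (γ s 0))⁻¹ ^ 3 := by
        simp [hD, comovingTetrad, Matrix.det_diagonal, Fin.prod_univ_four]
        ring
      rw [h1, isUnit_iff_ne_zero]
      exact pow_ne_zero 3 (inv_ne_zero (h.pos _ (hγ.mapsTo hs)).ne')
    have hEA : D s * ((D s)⁻¹ * E s) = E s := by
      rw [← Matrix.mul_assoc, Matrix.mul_nonsing_inv _ hdet, Matrix.one_mul]
    -- Two orthonormal frames at a point differ by a Lorentz transformation, under which `p` is
    -- invariant.
    have hA : ((D s)⁻¹ * E s).transpose * minkowski * ((D s)⁻¹ * E s) = minkowski := by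
      have h1 : minkowski = (D s).transpose * flrwMetric a (γ s) * D s := (hDt s hs).symm
      have h2 : (E s).transpose * flrwMetric a (γ s) * E s = minkowski := hE s hs
      calc _ = (D s * ((D s)⁻¹ * E s)).transpose * flrwMetric a (γ s) *
              (D s * ((D s)⁻¹ * E s)) := by
            conv_lhs => rw [h1]
            simp only [Matrix.transpose_mul, Matrix.mul_assoc]
        _ = minkowski := by rw [hEA, h2]
    conv_lhs => rw [← hEA, ← frameComponents_frameComponents]
    exact hp _ hA _
  have hcomp : ∀ M N P Q, ∃ c, Tendsto
      (fun s => frameComponents (riemann (flrwMetric a) (γ s)) (D s) M N P Q) (𝓝[>] 0) (𝓝 c) := by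
    intro M N P Q
    have hrow : ∀ s M, D s 0 M = if M = 0 then 1 else 0 := by
      intro s M
      fin_cases M <;> simp [hD, comovingTetrad]
    refine ⟨_, Tendsto.congr' ?_ (((hH.pow 2).mul_const
      (minkowski M P * minkowski N Q - minkowski M Q * minkowski N P)).sub
      (hH''.mul_const ((if M = 0 then 1 else 0) * (if P = 0 then 1 else 0) * minkowski N Q
        + minkowski M P * ((if N = 0 then 1 else 0) * (if Q = 0 then 1 else 0))
        - (if M = 0 then 1 else 0) * (if Q = 0 then 1 else 0) * minkowski N P
        - minkowski M Q * ((if N = 0 then 1 else 0) * (if P = 0 then 1 else 0)))))⟩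
    filter_upwards [Ioo_mem_nhdsGT hγ.pos] with s hs
    rw [frameComponents_riemann_flrw h.isOpen h.contDiffOn h.pos (hγ.mapsTo hs) (hDt s hs)]
    simp only [hrow, Function.comp_apply]
  choose c hc using hcomp
  refine hno ⟨p.value c, Tendsto.congr' (f₁ := fun s =>
    p.value (frameComponents (riemann (flrwMetric a) (γ s)) (D s))) ?_ ?_⟩
  · filter_upwards [Ioo_mem_nhdsGT hγ.pos] with s hs using (hval s hs).symm
  · have h1 : Continuous fun x : Fin 4 × Fin 4 × Fin 4 × Fin 4 → ℝ => MvPolynomial.eval x p :=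
      MvPolynomial.continuous_eval p
    exact (h1.tendsto _).comp (tendsto_pi_nhds.2 fun q => hc q.1 q.2.1 q.2.2.1 q.2.2.2)

end Singular
theorem mainTheorem1 (I : Set ℝ) (hI_open : IsOpen I) (hI_lower : IsLowerSet I)
    (hI_ne : I.Nonempty) (a : ℝ → ℝ) (ha : ContDiffOn ℝ 2 a I) (ha_pos : ∀ t ∈ I, 0 < a t)
    (abar HΛ : ℝ) (habar : 0 < abar) (hHΛ : 0 < HΛ)
    (hdS : Asymptotics.IsEquivalent Filter.atBot a (fun t => abar * Real.exp (HΛ * t))) :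
    -- there is a past null boundary, reached by null geodesics in finite affine time
    (∀ t ∈ I, MeasureTheory.IntegrableOn a (Set.Iic t)) ∧
    (∀ x ∈ flrwDomain I, ∃ γ ℓ, IsBoundaryNullGeodesic I a γ ℓ ∧ x ∈ γ '' Set.Ioo 0 ℓ) ∧
    -- the singular case
    (Filter.Tendsto (fun t => |deriv (hubble a) t / a t ^ 2|) Filter.atBot Filter.atTop →
      ∀ γ ℓ, IsBoundaryNullGeodesic I a γ ℓ →
        IsPPCurvatureSingularity (flrwMetric a) γ ℓ ∧
        (∀ E, IsParallelTetradOn (flrwMetric a) γ (Set.Ioo 0 ℓ) E → ∃ M N P Q : Fin 4,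
          Filter.Tendsto (fun s => |frameComponents (riemann (flrwMetric a) (γ s)) (E s) M N P Q|)
            (nhdsWithin 0 (Set.Ioi 0)) Filter.atTop) ∧
        (Filter.Tendsto (deriv (hubble a)) Filter.atBot (nhds 0) →
          ¬ IsScalarCurvatureSingularity (flrwMetric a) γ ℓ) ∧
        ¬ IsLocallyExtendibleAlong (flrwDomain I) (flrwMetric a) γ ℓ) ∧
    -- the regular case
    ((∃ L : ℝ, Filter.Tendsto (fun t => deriv (hubble a) t / a t ^ 2) Filter.atBot (nhds L)) →
      (∀ γ ℓ, IsBoundaryNullGeodesic I a γ ℓ →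
        ¬ IsPPCurvatureSingularity (flrwMetric a) γ ℓ ∧
        IsLocallyExtendibleAlong (flrwDomain I) (flrwMetric a) γ ℓ) ∧
      ∀ t₀ ∈ I, ExtendsInNullCoordinates I a t₀) := by
  have h : IsPastDeSitter I a abar HΛ :=
    ⟨hI_open, hI_lower, hI_ne, ha, ha_pos, habar, hHΛ, hdS⟩
  refine ⟨fun t ht => h.integrableOn_Iic ht, fun x hx => h.exists_isBoundaryNullGeodesic hx,
    fun hS γ ℓ hγ => ⟨h.isPPCurvatureSingularity hS hγ,
      fun E hE => h.exists_tendsto_frameComponents hS hγ hE,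
      fun hH' => h.not_isScalarCurvatureSingularity hH' hγ,
      h.not_isLocallyExtendibleAlong hS hγ⟩, ?_⟩
  rintro ⟨L, hL⟩
  exact ⟨fun γ ℓ hγ => ⟨h.not_isPPCurvatureSingularity hL hγ, h.isLocallyExtendibleAlong hL hγ⟩,
    fun t₀ ht₀ => h.extendsInNullCoordinates hL ht₀⟩
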